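/- Let $K$ be a field. All vector spaces are $\mathbb Z_2$-graded vector spaces over $K$; in signs, a homogeneous element stands for its degree. A Lie superalgebra is a $\mathbb Z_2$-graded space $L$ with a bilinear bracket such that $[L_\alpha,L_\beta]\subset L_{\alpha+\beta}$, $[a,b]=-(-1)^{\alpha\beta}[b,a]$ and $[a,[b,c]]=[[a,b],c]+(-1)^{\alpha\beta}[b,[a,c]]$ for $a\in L_\alpha$, $b\in L_\beta$, $c\in L$. Let $(\mathfrak g,\pi)$ and $(\mathfrak h,\mu)$ be Lie superalgebras and let $\rho:\mathfrak g\to \mathrm{Der}(\mathfrak h)$ be a morphism of Lie superalgebras of degree $0$. **Cochains.** For $\sigma\in S_n$ and $X=(X_1,\dots,X_n)$ with homogeneous entries let $\epsilon(\sigma,X)=\mathrm{sgn}(\sigma)(-1)^{k}$, where $k$ is the number of pairs $i<j$ with $\sigma(j)<\sigma(i)$ and $X_{\sigma(i)},X_{\sigma(j)}$ both odd. For an $n$-linear map $F$ put $(\sigma.F)(X)=\epsilon(\sigma,X)F(X_{\sigma(1)},\dots,X_{\sigma(n)})$. $\mathrm{Hom}(\wedge^nV,W)$ is the space of the $n$-linear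 maps $F:V^n\to W$ with $\sigma.F=F$ for all $\sigma\in S_n$, and $\mathrm{Hom}_\alpha(\wedge^nV,W)$ is its part of degree $\alpha\in\mathbb Z_2$. **The bracket $[\,,]$.** On $V=\mathfrak g\oplus\mathfrak h$, for an $(n+1)$-linear $F:V^{n+1}\to V$ of degree $f$ and an $(n'+1)$-linear $F':V^{n'+1}\to V$ of degree $f'$, put $$[F,F']=F\circ F'-(-1)^{nn'+ff'}F'\circ F,\qquad F\circ F'=\sum_{\sigma}\sigma.(F*F'),$$ $$(F*F')(X_1,\dots,X_{n+n'+1})=(-1)^{f'(X_1+\cdots+X_n)}F(X_1,\dots,X_n,F'(X_{n+1},\dots,X_{n+n'+1})),$$ where $\sigma$ runs over the permutations in $S_{n+n'+1}$ with $\sigma(1)<\dots<\sigma(n)$ and $\sigma(n+1)<\dots<\sigma(n+n'+1)$; extend $[\,,]$ bilinearly. Regard $\pi,\mu,\rho$ and $f\in\mathrm{Hom}(\wedge^n\mathfrak g,\mathfrak h)$ as multilinear maps on $\mathfrak g\oplus\mathfrak h$: $\pi$ is $((x,u),(y,v))\mapsto(\pi(x,y),0)$, $\mu$ is $((x,u),(y,v))\mapsto(0,\mu(u,v))$,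 $\rho$ is $((x,u),(y,v))\mapsto(0,\rho(x)v-(-1)^{uy}\rho(y)u)$ for homogeneous $u,y$, and $f$ is $((x_1,u_1),\dots,(x_n,u_n))\mapsto(0,f(x_1,\dots,x_n))$. **Theorem.** Let $C^*(\mathfrak g,\mathfrak h)=\bigoplus_{n\ge1}\mathrm{Hom}(\wedge^n\mathfrak g,\mathfrak h)$, with $\mathrm{Hom}_\alpha(\wedge^n\mathfrak g,\mathfrak h)$ in degree $(n,\alpha)$. The formulas $$[\![f_1,f_2]\!]=(-1)^{m-1}[[\mu,f_1],f_2]\quad(f_1\in\mathrm{Hom}(\wedge^m\mathfrak g,\mathfrak h),\ f_2\in\mathrm{Hom}(\wedge^n\mathfrak g,\mathfrak h)),\qquad \partial_{\pi+\rho}f=[\pi+\rho,f]$$ define a bilinear bracket and a linear map on $C^*(\mathfrak g,\mathfrak h)$, and $(C^*(\mathfrak g,\mathfrak h),[\![\,,]\!],\partial_{\pi+\rho})$ is a differential $\mathbb N\times\mathbb Z_2$-graded Lie algebra. That is, for $x$ of degree $(k,a)$, $y$ of degree $(l,b)$ and any $z$: $[\![x,y]\!]$ has degree $(k+l,a+b)$,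 $[\![x,y]\!]=-(-1)^{kl+ab}[\![y,x]\!]$, $[\![x,[\![y,z]\!]]\!]=[\![[\![x,y]\!],z]\!]+(-1)^{kl+ab}[\![y,[\![x,z]\!]]\!]$, $\partial_{\pi+\rho}x$ has degree $(k+1,a)$, $\partial_{\pi+\rho}[\![x,z]\!]=[\![\partial_{\pi+\rho}x,z]\!]+(-1)^{k}[\![x,\partial_{\pi+\rho}z]\!]$, and $\partial_{\pi+\rho}^2=0$. If moreover $\operatorname{char}K\neq2$, then a linear map $D:\mathfrak g\to\mathfrak h$ of degree $0$ is a crossed homomorphism with respect to $\rho$, i.e. $$D(\pi(x,y))=\rho(x)D(y)-(-1)^{\alpha\beta}\rho(y)D(x)+\mu(D(x),D(y))\qquad(x\in\mathfrak g_\alpha,\ y\in\mathfrak g_\beta),$$ if and only if $D$ is a Maurer–Cartan element of $(C^*(\mathfrak g,\mathfrak h),[\![\,,]\!],\partial_{\pi+\rho})$, i.e. $D$ has degree $(1,0)$ and $\partial_{\pi+\rho}D+\tfrac12[\![D,D]\!]=0$. -/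

import Mathlib

open scoped DirectSum

noncomputable section

namespace SuperLie

/-! ### Graded Lie algebras

The index set of the gradings is `ℕ × ZMod 2`; the sign of a pair of degrees `(k, a)`, `(l, b)` is
`(-1) ^ (k * l + a * b)`. -/

section Graded

variable {K E : Type*} [Field K] [AddCommGroup E] [Module K E]

/-- The Koszul sign `(-1) ^ (k * l + a * b)` of the degrees `(k, a)` and `(l, b)`. -/
def koszulSign (i j : ℕ × ZMod 2) : ℤˣ :=
  (-1 : ℤˣ) ^ (i.1 * j.1) * (-1 : ℤˣ) ^ (i.2 * j.2)

/-- `E = ⨁ 𝓔 i` with the bracket `br` is an `ℕ × ℤ₂`-graded Lie algebra. -/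
structure IsGradedLieAlgebra (𝓔 : ℕ × ZMod 2 → Submodule K E) (br : E →ₗ[K] E →ₗ[K] E) :
    Prop where
  isInternal : DirectSum.IsInternal 𝓔
  bracket_mem : ∀ i j x y, x ∈ 𝓔 i → y ∈ 𝓔 j → br x y ∈ 𝓔 (i + j)
  skew : ∀ i j x y, x ∈ 𝓔 i → y ∈ 𝓔 j → br x y = -(koszulSign i j • br y x)
  jacobi : ∀ i j x y z, x ∈ 𝓔 i → y ∈ 𝓔 j →
    br x (br y z) = br (br x y) z + koszulSign i j • br y (br x z)

/-- `d` is a graded derivation of degree `δ`. -/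
structure IsGradedDerivation (𝓔 : ℕ × ZMod 2 → Submodule K E) (br : E →ₗ[K] E →ₗ[K] E)
    (δ : ℕ × ZMod 2) (d : E →ₗ[K] E) : Prop where
  map_mem : ∀ i x, x ∈ 𝓔 i → d x ∈ 𝓔 (i + δ)
  leibniz : ∀ i x y, x ∈ 𝓔 i → d (br x y) = br (d x) y + koszulSign δ i • br x (d y)

/-- `(E, br, d)` is a differential `ℕ × ℤ₂`-graded Lie algebra. -/
structure IsDGLieAlgebra (𝓔 : ℕ × ZMod 2 → Submodule K E) (br : E →ₗ[K] E →ₗ[K] E)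
    (d : E →ₗ[K] E) : Prop where
  gradedLie : IsGradedLieAlgebra 𝓔 br
  derivation : IsGradedDerivation 𝓔 br (1, 0) d
  d_d : ∀ x, d (d x) = 0

/-- `ω` is a Maurer–Cartan element: it has degree `(1, 0)` and `dω + ½[ω, ω] = 0`. -/
def IsMaurerCartan (𝓔 : ℕ × ZMod 2 → Submodule K E) (br : E →ₗ[K] E →ₗ[K] E)
    (d : E →ₗ[K] E) (ω : E) : Prop :=
  ω ∈ 𝓔 (1, 0) ∧ d ω + (1 / 2 : K) • br ω ω = 0

end Graded

/-! ### Lie superalgebras, derivations, actions, crossed homomorphisms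

A `ℤ₂`-graded vector space is a space `V` with a family `𝒱 : ZMod 2 → Submodule K V` and an
instance of `DirectSum.Decomposition 𝒱`. -/

section Super

variable {K V W : Type*} [Field K] [AddCommGroup V] [Module K V] [AddCommGroup W] [Module K W]

/-- `V` with the grading `𝒱` and the bracket `br` is a Lie superalgebra. -/
structure IsLieSuperalgebra (𝒱 : ZMod 2 → Submodule K V) (br : V →ₗ[K] V →ₗ[K] V) :
    Prop where
  bracket_mem : ∀ α β a b, a ∈ 𝒱 α → b ∈ 𝒱 β → br a b ∈ 𝒱 (α + β)
  skew : ∀ α β a b, a ∈ 𝒱 α → b ∈ 𝒱 β → br a b = -((-1 : ℤˣ) ^ (α * β) • br b a)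
  jacobi : ∀ α β a b c, a ∈ 𝒱 α → b ∈ 𝒱 β →
    br a (br b c) = br (br a b) c + (-1 : ℤˣ) ^ (α * β) • br b (br a c)

/-- `D` is a derivation of degree `s` of the superalgebra `(V, br)`. -/
structure IsSuperDerivation (𝒱 : ZMod 2 → Submodule K V) (br : V →ₗ[K] V →ₗ[K] V)
    (s : ZMod 2) (D : V →ₗ[K] V) : Prop where
  map_mem : ∀ α a, a ∈ 𝒱 α → D a ∈ 𝒱 (s + α)
  leibniz : ∀ α a b, a ∈ 𝒱 α → D (br a b) = br (D a) b + (-1 : ℤˣ) ^ (s * α) • br a (D b)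

/-- `ρ` is an action of the Lie superalgebra `(V, π)` on the Lie superalgebra `(W, μ)`:
a morphism `V → Der W` of Lie superalgebras of degree `0`. -/
structure IsAction (𝒱 : ZMod 2 → Submodule K V) (𝒲 : ZMod 2 → Submodule K W)
    (π : V →ₗ[K] V →ₗ[K] V) (μ : W →ₗ[K] W →ₗ[K] W) (ρ : V →ₗ[K] W →ₗ[K] W) : Prop where
  derivation : ∀ α x, x ∈ 𝒱 α → IsSuperDerivation 𝒲 μ α (ρ x)
  map_bracket : ∀ α β x y, x ∈ 𝒱 α → y ∈ 𝒱 β →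
    ρ (π x y) = ρ x ∘ₗ ρ y - (-1 : ℤˣ) ^ (α * β) • (ρ y ∘ₗ ρ x)

/-- The identity that makes a linear map `D : V → W` of degree `0` a crossed homomorphism with
respect to the action `ρ`. -/
def IsCrossedHom (𝒱 : ZMod 2 → Submodule K V) (π : V →ₗ[K] V →ₗ[K] V)
    (μ : W →ₗ[K] W →ₗ[K] W) (ρ : V →ₗ[K] W →ₗ[K] W) (D : V →ₗ[K] W) : Prop :=
  ∀ α β x y, x ∈ 𝒱 α → y ∈ 𝒱 β →
    D (π x y) = ρ x (D y) - (-1 : ℤˣ) ^ (α * β) • ρ y (D x) + μ (D x) (D y)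

/-- The projection of a `ℤ₂`-graded vector space onto its component of degree `α`. -/
def proj (𝒱 : ZMod 2 → Submodule K V) [DirectSum.Decomposition 𝒱] (α : ZMod 2) : V →ₗ[K] V :=
  (𝒱 α).subtype ∘ₗ DirectSum.component K (ZMod 2) (fun i => 𝒱 i) α ∘ₗ
    (DirectSum.decomposeLinearEquiv 𝒱).toLinearMap

theorem sum_proj (𝒱 : ZMod 2 → Submodule K V) [DirectSum.Decomposition 𝒱] (x : V) :
    ∑ α, proj 𝒱 α x = x := by
  classical
  conv_rhs => rw [← DirectSum.sum_support_decompose 𝒱 x]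
  symm
  apply Finset.sum_subset (Finset.subset_univ _)
  intro i _ hi
  simpa using hi

theorem proj_of_mem (𝒱 : ZMod 2 → Submodule K V) [DirectSum.Decomposition 𝒱] {α : ZMod 2}
    {x : V} (hx : x ∈ 𝒱 α) (β : ZMod 2) : proj 𝒱 β x = if β = α then x else 0 := by
  split_ifs with h
  · subst h
    exact DirectSum.decompose_of_mem_same 𝒱 hx
  · exact DirectSum.decompose_of_mem_ne 𝒱 hx (Ne.symm h)

/-- The grading `(V ⊕ W)_α = V_α ⊕ W_α`. -/
def prodGrading (𝒱 : ZMod 2 → Submodule K V) (𝒲 : ZMod 2 → Submodule K W) (α : ZMod 2) :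
    Submodule K (V × W) :=
  (𝒱 α).prod (𝒲 α)

theorem proj_mem (𝒱 : ZMod 2 → Submodule K V) [DirectSum.Decomposition 𝒱] (α : ZMod 2) (x : V) :
    proj 𝒱 α x ∈ 𝒱 α :=
  (DirectSum.decompose 𝒱 x α).2

instance prodDecomposition (𝒱 : ZMod 2 → Submodule K V) (𝒲 : ZMod 2 → Submodule K W)
    [DirectSum.Decomposition 𝒱] [DirectSum.Decomposition 𝒲] :
    DirectSum.Decomposition (prodGrading 𝒱 𝒲) :=
  DirectSum.Decomposition.ofLinearMap (prodGrading 𝒱 𝒲)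
    (∑ α, DirectSum.lof K (ZMod 2) (fun i => prodGrading 𝒱 𝒲 i) α ∘ₗ
      ((proj 𝒱 α).prodMap (proj 𝒲 α)).codRestrict (prodGrading 𝒱 𝒲 α)
        fun z => ⟨proj_mem 𝒱 α z.1, proj_mem 𝒲 α z.2⟩)
    (by
      refine LinearMap.ext fun z => ?_
      simp only [LinearMap.comp_apply, LinearMap.sum_apply, map_sum, DirectSum.coeLinearMap_lof]
      refine Prod.ext ?_ ?_
      · rw [Prod.fst_sum]
        exact sum_proj 𝒱 z.1
      · rw [Prod.snd_sum]
        exact sum_proj 𝒲 z.2)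
    (by
      refine DirectSum.linearMap_ext K fun i => LinearMap.ext fun x => ?_
      simp only [LinearMap.comp_apply, LinearMap.sum_apply, DirectSum.coeLinearMap_lof,
        LinearMap.id_apply]
      rw [Finset.sum_eq_single i]
      · congr 1
        refine Subtype.ext (Prod.ext ?_ ?_)
        · exact (proj_of_mem 𝒱 x.2.1 i).trans (if_pos rfl)
        · exact (proj_of_mem 𝒲 x.2.2 i).trans (if_pos rfl)
      · intro j _ hj
        convert map_zero (DirectSum.lof K (ZMod 2) (fun i => prodGrading 𝒱 𝒲 i) j)
        refine Subtype.ext (Prod.ext ?_ ?_)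
        · exact (proj_of_mem 𝒱 x.2.1 j).trans (if_neg hj)
        · exact (proj_of_mem 𝒲 x.2.2 j).trans (if_neg hj)
      · simp)

end Super

/-! ### Graded alternating multilinear maps -/

section Cochains

variable {K V W : Type*} [Field K] [AddCommGroup V] [Module K V] [AddCommGroup W] [Module K W]
variable (𝒱 : ZMod 2 → Submodule K V) (𝒲 : ZMod 2 → Submodule K W)

/-- The sign `ε(σ, X) = ε(σ) (-1) ^ K(σ, X)` for `X = (X₁, …, Xₙ)` with `Xᵢ` homogeneous of degree
`p i`; here `K(σ, X)` is the number of the inversions of `σ` between odd entries. -/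
def eps {n : ℕ} (σ : Equiv.Perm (Fin n)) (p : Fin n → ZMod 2) : ℤˣ :=
  Equiv.Perm.sign σ * (-1 : ℤˣ) ^ (Finset.univ.filter fun ij : Fin n × Fin n =>
    ij.1 < ij.2 ∧ p (σ ij.1) = 1 ∧ p (σ ij.2) = 1 ∧ σ ij.2 < σ ij.1).card

variable [DirectSum.Decomposition 𝒱] [DirectSum.Decomposition 𝒲]

/-- The multilinear map whose value at homogeneous `X₁, …, Xₙ` of degrees `p 1, …, p n` is
`c p • F (X₁, …, Xₙ)`. -/
def signTwist {n : ℕ} (c : (Fin n → ZMod 2) → ℤˣ) :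
    MultilinearMap K (fun _ : Fin n => V) W →ₗ[K] MultilinearMap K (fun _ : Fin n => V) W :=
  ∑ p : Fin n → ZMod 2, c p • MultilinearMap.compLinearMapₗ fun i => proj 𝒱 (p i)

/-- The action of a permutation: `(σ.F)(X) = ε(σ, X) F(σ⁻¹X)`, where
`σ⁻¹X = (X (σ 1), …, X (σ n))`. -/
def permAct {n : ℕ} (σ : Equiv.Perm (Fin n)) :
    MultilinearMap K (fun _ : Fin n => V) W →ₗ[K] MultilinearMap K (fun _ : Fin n => V) W :=
  signTwist 𝒱 (eps σ) ∘ₗ (MultilinearMap.domDomCongrLinearEquiv K K V W σ).toLinearMap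

variable (W) in
/-- `Hom(∧ⁿ V, W)`: the `n`-linear maps `F` with `σ.F = F` for every permutation `σ`. -/
def superAlt (n : ℕ) : Submodule K (MultilinearMap K (fun _ : Fin n => V) W) :=
  ⨅ σ : Equiv.Perm (Fin n), LinearMap.eqLocus (permAct 𝒱 σ) LinearMap.id

/-- The `n`-linear maps that are homogeneous of degree `α`. -/
def homDeg (𝒱 : ZMod 2 → Submodule K V) (𝒲 : ZMod 2 → Submodule K W) (n : ℕ) (α : ZMod 2) :
    Submodule K (MultilinearMap K (fun _ : Fin n => V) W) where
  carrier := {F | ∀ (p : Fin n → ZMod 2) (X : Fin n → V), (∀ i, X i ∈ 𝒱 (p i)) →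
    F X ∈ 𝒲 (α + ∑ i, p i)}
  add_mem' hF hG p X hX := add_mem (hF p X hX) (hG p X hX)
  zero_mem' _ _ _ := zero_mem _
  smul_mem' c _ hF p X hX := Submodule.smul_mem _ c (hF p X hX)

/-- The component of degree `α` of an `n`-linear map. -/
def homComp (n : ℕ) (α : ZMod 2) :
    MultilinearMap K (fun _ : Fin n => V) W →ₗ[K] MultilinearMap K (fun _ : Fin n => V) W :=
  ∑ p : Fin n → ZMod 2, (proj 𝒲 (α + ∑ i, p i)).compMultilinearMapₗ K ∘ₗ
    MultilinearMap.compLinearMapₗ fun i => proj 𝒱 (p i)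

/-- `C*(V, W) = ⨁_{n ≥ 1} Hom(∧ⁿ V, W)`; the summand of index `k` is `Hom(∧ᵏ⁺¹ V, W)`. -/
abbrev Cochain (W : Type*) [AddCommGroup W] [Module K W] : Type _ :=
  ⨁ k : ℕ, superAlt (W := W) 𝒱 (k + 1)

/-- The `ℕ × ℤ₂`-grading of `C*(V, W)`: the part of degree `(n, α)` is `Hom_α(∧ⁿ V, W)` for
`n ≥ 1`, and it is `0` for `n = 0`. -/
def cochainGrading : ℕ × ZMod 2 → Submodule K (Cochain 𝒱 W)
  | (0, _) => ⊥
  | (k + 1, α) => ((homDeg 𝒱 𝒲 (k + 1) α).comap (superAlt W 𝒱 (k + 1)).subtype).map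
      (DirectSum.lof K ℕ (fun k => superAlt (W := W) 𝒱 (k + 1)) k)

theorem signTwist_one {n : ℕ} (F : MultilinearMap K (fun _ : Fin n => V) W) :
    signTwist 𝒱 (fun _ => 1) F = F := by
  ext X
  have h := F.map_sum (fun i α => proj 𝒱 α (X i))
  simp only [sum_proj] at h
  rw [h]
  simp [signTwist]

/-- A linear map `D : V → W` as an element of `Hom(∧¹ V, W)`. -/
def ofLinear₁ (D : V →ₗ[K] W) : superAlt W 𝒱 1 :=
  ⟨MultilinearMap.ofSubsingleton K V W (0 : Fin 1) D, by
    rw [superAlt, Submodule.mem_iInf]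
    intro σ
    obtain rfl : σ = 1 := Subsingleton.elim _ _
    have h : eps (1 : Equiv.Perm (Fin 1)) = fun _ => 1 := by
      funext p
      simp [eps, Subsingleton.elim (_ : Fin 1) 0]
    rw [LinearMap.mem_eqLocus, permAct, h, LinearMap.comp_apply, signTwist_one]
    rfl⟩

/-- A linear map `D : V → W` as an element of `C*(V, W)`. -/
def ofLinear (D : V →ₗ[K] W) : Cochain 𝒱 W :=
  DirectSum.lof K ℕ (fun k => superAlt (W := W) 𝒱 (k + 1)) 0 (ofLinear₁ 𝒱 D)

end Cochains

/-! ### The graded Lie bracket on multilinear maps -/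

theorem update_castAdd {V : Type*} {n m : ℕ} (X : Fin (n + m) → V) (i : Fin n) (x : V) :
    (fun k : Fin n => Function.update X (Fin.castAdd m i) x (Fin.castAdd m k)) =
      Function.update (fun k : Fin n => X (Fin.castAdd m k)) i x := by
  ext k
  by_cases h : k = i <;> simp [h]

theorem update_castAdd' {V : Type*} {n m : ℕ} (X : Fin (n + m) → V) (i : Fin n) (x : V) :
    (fun k : Fin m => Function.update X (Fin.castAdd m i) x (Fin.natAdd n k)) =
      fun k : Fin m => X (Fin.natAdd n k) := by
  ext k
  have h : Fin.natAdd n k ≠ Fin.castAdd m i := by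
    intro h
    have := congrArg Fin.val h
    simp at this
    omega
  simp [h]

theorem update_natAdd {V : Type*} {n m : ℕ} (X : Fin (n + m) → V) (i : Fin m) (x : V) :
    (fun k : Fin m => Function.update X (Fin.natAdd n i) x (Fin.natAdd n k)) =
      Function.update (fun k : Fin m => X (Fin.natAdd n k)) i x := by
  ext k
  by_cases h : k = i <;> simp [h]

theorem update_natAdd' {V : Type*} {n m : ℕ} (X : Fin (n + m) → V) (i : Fin m) (x : V) :
    (fun k : Fin n => Function.update X (Fin.natAdd n i) x (Fin.castAdd m k)) =
      fun k : Fin n => X (Fin.castAdd m k) := by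
  ext k
  have h : Fin.castAdd m k ≠ Fin.natAdd n i := by
    intro h
    have := congrArg Fin.val h
    simp at this
    omega
  simp [h]

section Bracket

variable {K V : Type*} [Field K] [AddCommGroup V] [Module K V]

theorem snoc_eq_update {n : ℕ} (X : Fin n → V) (x : V) :
    (Fin.snoc (α := fun _ => V) X x : Fin (n + 1) → V) =
      Function.update (Fin.snoc (α := fun _ => V) X 0) (Fin.last n) x := by
  rw [Fin.update_snoc_last]

/-- The map `(X₁, …, X_{n+m}) ↦ F (X₁, …, Xₙ, F' (X_{n+1}, …, X_{n+m}))`. -/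
def insertLast {n m : ℕ} (F : MultilinearMap K (fun _ : Fin (n + 1) => V) V)
    (F' : MultilinearMap K (fun _ : Fin m => V) V) :
    MultilinearMap K (fun _ : Fin (n + m) => V) V where
  toFun X := F (Fin.snoc (α := fun _ => V) (fun i : Fin n => X (Fin.castAdd m i))
    (F' fun j : Fin m => X (Fin.natAdd n j)))
  map_update_add' := by
    intro inst X i x y
    obtain rfl := Subsingleton.elim inst (instDecidableEqFin (n + m))
    refine Fin.addCases (fun i => ?_) (fun j => ?_) i
    · simp only [update_castAdd, update_castAdd', Fin.snoc_update, F.map_update_add]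
    · simp only [update_natAdd, update_natAdd', F'.map_update_add]
      simp only [snoc_eq_update _ (_ + _), snoc_eq_update _ (F' _), F.map_update_add]
  map_update_smul' := by
    intro inst X i c x
    obtain rfl := Subsingleton.elim inst (instDecidableEqFin (n + m))
    refine Fin.addCases (fun i => ?_) (fun j => ?_) i
    · simp only [update_castAdd, update_castAdd', Fin.snoc_update, F.map_update_smul]
    · simp only [update_natAdd, update_natAdd', F'.map_update_smul]
      simp only [snoc_eq_update _ (_ • _), snoc_eq_update _ (F' _), F.map_update_smul]

theorem insertLast_add_left {n m : ℕ} (F G : MultilinearMap K (fun _ : Fin (n + 1) => V) V)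
    (F' : MultilinearMap K (fun _ : Fin m => V) V) :
    insertLast (F + G) F' = insertLast F F' + insertLast G F' := rfl

theorem insertLast_smul_left {n m : ℕ} (c : K)
    (F : MultilinearMap K (fun _ : Fin (n + 1) => V) V)
    (F' : MultilinearMap K (fun _ : Fin m => V) V) :
    insertLast (c • F) F' = c • insertLast F F' := rfl

theorem insertLast_add_right {n m : ℕ} (F : MultilinearMap K (fun _ : Fin (n + 1) => V) V)
    (F' G' : MultilinearMap K (fun _ : Fin m => V) V) :
    insertLast F (F' + G') = insertLast F F' + insertLast F G' := by
  ext X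
  change F (Fin.snoc (α := fun _ => V) _ (_ + _)) = F _ + F _
  rw [snoc_eq_update, F.map_update_add, Fin.update_snoc_last, Fin.update_snoc_last]

theorem insertLast_smul_right {n m : ℕ} (c : K)
    (F : MultilinearMap K (fun _ : Fin (n + 1) => V) V)
    (F' : MultilinearMap K (fun _ : Fin m => V) V) :
    insertLast F (c • F') = c • insertLast F F' := by
  ext X
  change F (Fin.snoc (α := fun _ => V) _ (c • _)) = c • F _
  rw [snoc_eq_update, F.map_update_smul, Fin.update_snoc_last]

variable (𝒱 : ZMod 2 → Submodule K V) [DirectSum.Decomposition 𝒱]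

/-- The product `F * F'`: for `F'` of degree `b` and `Xᵢ` of degree `p i`,
`(F * F')(X) = (-1) ^ (b (p 1 + ⋯ + p n)) F (X₁, …, Xₙ, F' (X_{n+1}, …, X_{n+m}))`. -/
def star {n m : ℕ} (F : MultilinearMap K (fun _ : Fin (n + 1) => V) V)
    (F' : MultilinearMap K (fun _ : Fin m => V) V) :
    MultilinearMap K (fun _ : Fin (n + m) => V) V :=
  ∑ b : ZMod 2, signTwist 𝒱 (fun p => (-1 : ℤˣ) ^ (b * ∑ i : Fin n, p (Fin.castAdd m i)))
    (insertLast F (homComp 𝒱 𝒱 m b F'))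

open Classical in
/-- The shuffles `S_{(n, m)}`: the permutations that increase on the first `n` and on the last `m`
indices. -/
def shuffles (n m : ℕ) : Finset (Equiv.Perm (Fin (n + m))) :=
  Finset.univ.filter fun σ =>
    StrictMono (fun i : Fin n => σ (Fin.castAdd m i)) ∧
      StrictMono (fun j : Fin m => σ (Fin.natAdd n j))

/-- The product `F ∘ F' = ∑ σ.(F * F')` over the shuffles `σ`; it is bilinear. -/
def circ (n m : ℕ) : MultilinearMap K (fun _ : Fin (n + 1) => V) V →ₗ[K]
    MultilinearMap K (fun _ : Fin m => V) V →ₗ[K] MultilinearMap K (fun _ : Fin (n + m) => V) V :=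
  LinearMap.mk₂ K (fun F F' => ∑ σ ∈ shuffles n m, permAct 𝒱 σ (star 𝒱 F F'))
    (fun F G F' => by
      simp only [star, insertLast_add_left, map_add, Finset.sum_add_distrib])
    (fun c F F' => by
      simp only [star, insertLast_smul_left, map_smul, Finset.smul_sum, map_sum])
    (fun F F' G' => by
      simp only [star, insertLast_add_right, map_add, Finset.sum_add_distrib])
    (fun c F F' => by
      simp only [star, insertLast_smul_right, map_smul, Finset.smul_sum, map_sum])

variable (K V) in
/-- The sum of the spaces of `(s + 1)`-linear maps `V × ⋯ × V → V`, `s ≥ 0`; it contains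
`⨁_s Hom(∧ˢ⁺¹ V, V)`. -/
abbrev Multi : Type _ := ⨁ s : ℕ, MultilinearMap K (fun _ : Fin (s + 1) => V) V

variable (K V) in
/-- The inclusion of the summand of index `s`. -/
abbrev Multi.incl (s : ℕ) : MultilinearMap K (fun _ : Fin (s + 1) => V) V →ₗ[K] Multi K V :=
  DirectSum.lof K ℕ (fun s => MultilinearMap K (fun _ : Fin (s + 1) => V) V) s

/-- The bracket `[F, F'] = F ∘ F' - (-1) ^ (n n' + f f') F' ∘ F` for `F` of degree `(n, f)` and
`F'` of degree `(n', f')` (so `F` is `(n + 1)`-linear and `F'` is `(n' + 1)`-linear), extended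
bilinearly. -/
def nrBracket : Multi K V →ₗ[K] Multi K V →ₗ[K] Multi K V :=
  DirectSum.toModule K ℕ _ fun n => LinearMap.flip <| DirectSum.toModule K ℕ _ fun n' =>
    LinearMap.flip <| LinearMap.mk₂ K
      (fun F F' => Multi.incl K V (n + n') (circ 𝒱 n (n' + 1) F F') -
        ∑ f : ZMod 2, ∑ f' : ZMod 2, ((-1 : ℤˣ) ^ (n * n') * (-1 : ℤˣ) ^ (f * f')) •
          Multi.incl K V (n' + n) (circ 𝒱 n' (n + 1)
            (homComp 𝒱 𝒱 (n' + 1) f' F') (homComp 𝒱 𝒱 (n + 1) f F)))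
      (fun F G F' => by
        simp only [map_add, LinearMap.add_apply, smul_add, Finset.sum_add_distrib]; abel)
      (fun c F F' => by
        simp only [map_smul, LinearMap.smul_apply, smul_comm _ c, ← Finset.smul_sum]
        rw [smul_sub])
      (fun F F' G' => by
        simp only [map_add, LinearMap.add_apply, smul_add, Finset.sum_add_distrib]; abel)
      (fun c F F' => by
        simp only [map_smul, LinearMap.smul_apply, smul_comm _ c, ← Finset.smul_sum]
        rw [smul_sub])

/-- A bilinear map `V × V → V` as an element of the summand of index `1`. -/
def ofBilin (B : V →ₗ[K] V →ₗ[K] V) : Multi K V :=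
  Multi.incl K V 1
    { toFun := fun X : Fin 2 → V => B (X 0) (X 1)
      map_update_add' := by
        intro inst X i x y
        obtain rfl := Subsingleton.elim inst (instDecidableEqFin 2)
        fin_cases i <;> simp
      map_update_smul' := by
        intro inst X i c x
        obtain rfl := Subsingleton.elim inst (instDecidableEqFin 2)
        fin_cases i <;> simp }

end Bracket

/-! ### The structure maps and the cochains as multilinear maps on `𝔤 ⊕ 𝔥` -/

section Hat

variable {K 𝔤 𝔥 : Type*} [Field K] [AddCommGroup 𝔤] [Module K 𝔤] [AddCommGroup 𝔥] [Module K 𝔥]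

variable (𝔥) in
/-- `π` on `𝔤 ⊕ 𝔥`: `((x, u), (y, v)) ↦ (π(x, y), 0)`. -/
def hatPi (π : 𝔤 →ₗ[K] 𝔤 →ₗ[K] 𝔤) : Multi K (𝔤 × 𝔥) :=
  ofBilin ((π.compl₁₂ (LinearMap.fst K 𝔤 𝔥) (LinearMap.fst K 𝔤 𝔥)).compr₂ (LinearMap.inl K 𝔤 𝔥))

variable (𝔤) in
/-- `μ` on `𝔤 ⊕ 𝔥`: `((x, u), (y, v)) ↦ (0, μ(u, v))`. -/
def hatMu (μ : 𝔥 →ₗ[K] 𝔥 →ₗ[K] 𝔥) : Multi K (𝔤 × 𝔥) :=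
  ofBilin ((μ.compl₁₂ (LinearMap.snd K 𝔤 𝔥) (LinearMap.snd K 𝔤 𝔥)).compr₂ (LinearMap.inr K 𝔤 𝔥))

/-- `ρ` on `𝔤 ⊕ 𝔥`: `((x, u), (y, v)) ↦ (0, ρ(x)v - (-1) ^ (α β) ρ(y)u)` for `u` of degree `α` and
`y` of degree `β`. -/
def hatRho (𝒢 : ZMod 2 → Submodule K 𝔤) (ℋ : ZMod 2 → Submodule K 𝔥)
    [DirectSum.Decomposition 𝒢] [DirectSum.Decomposition ℋ] (ρ : 𝔤 →ₗ[K] 𝔥 →ₗ[K] 𝔥) :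
    Multi K (𝔤 × 𝔥) :=
  ofBilin ((ρ.compl₁₂ (LinearMap.fst K 𝔤 𝔥) (LinearMap.snd K 𝔤 𝔥) -
    ∑ α : ZMod 2, ∑ β : ZMod 2, (-1 : ℤˣ) ^ (α * β) •
      (ρ.compl₁₂ (proj 𝒢 β ∘ₗ LinearMap.fst K 𝔤 𝔥) (proj ℋ α ∘ₗ LinearMap.snd K 𝔤 𝔥)).flip).compr₂
        (LinearMap.inr K 𝔤 𝔥))

variable (𝔥) in
/-- The embedding of `C*(𝔤, 𝔥)`: `f ∈ Hom(∧ⁿ 𝔤, 𝔥)` becomes the map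
`((x₁, u₁), …, (xₙ, uₙ)) ↦ (0, f(x₁, …, xₙ))`. -/
def hat (𝒢 : ZMod 2 → Submodule K 𝔤) [DirectSum.Decomposition 𝒢] :
    Cochain 𝒢 𝔥 →ₗ[K] Multi K (𝔤 × 𝔥) :=
  DirectSum.lmap fun k =>
    (LinearMap.inr K 𝔤 𝔥).compMultilinearMapₗ K ∘ₗ
      MultilinearMap.compLinearMapₗ (fun _ => LinearMap.fst K 𝔤 𝔥) ∘ₗ
        (superAlt 𝔥 𝒢 (k + 1)).subtype

theorem hat_injective (𝒢 : ZMod 2 → Submodule K 𝔤) [DirectSum.Decomposition 𝒢] :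
    Function.Injective (hat 𝔥 𝒢) := by
  refine (DirectSum.lmap_injective _).2 fun k f g h => ?_
  ext X
  have := congrArg Prod.snd (congrArg (fun F => F (fun i => (X i, (0 : 𝔥)))) h)
  simpa using this

end Hat

end SuperLie

end

noncomputable section

namespace SuperLie

/-! ### Signed sums over the splittings of a list -/

section Unshuffle

variable {V M : Type*} [AddCommGroup M]

/-! The theorem is the derived bracket construction inside the Nijenhuis–Richardson algebra of `V =
𝔤 ⊕ 𝔥`, the graded alternating maps on `V` with the bracket `nrBracket`.

The Jacobi identity of that algebra comes from a graded pre-Lie property. The associator `(Φ ∘ Ψ₁) ∘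
Ψ₂ - Φ ∘ (Ψ₁ ∘ Ψ₂)` is the sum over the insertions of `Ψ₁` and `Ψ₂` into two different entries of
`Φ` (`lcirc_lcirc`), hence symmetric in `Ψ₁`, `Ψ₂` up to sign (`lassoc_symm`); `lbr_jacobi` is then
formal. To make the signs tractable, a multilinear map is encoded as a function of lists of vectors
labelled by degrees. The sum over shuffles becomes the recursion `unsh`, and all sign identities are
proved by induction on lists; `enc_circ` translates back.

The bracket `π + ρ + μ` of the semidirect product satisfies the Jacobi identity, which says that its
square under `∘` is zero. Specializing to `μ = 0` and to `π = ρ = 0`, and then subtracting, gives `θ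
∘ θ = 0` for `θ = π + ρ`, `μ ∘ μ = 0` and `[θ, μ] = 0`. The field may have characteristic `2`, where
`[θ, θ] = 2 θ ∘ θ = 0` is void; so `[θ, [θ, x]] = 0` is deduced from `θ ∘ θ = 0` itself
(`lbr_lbr_self`).

Give `𝔤` weight `0` and `𝔥` weight `1`. Then `π` and `ρ` have weight `0`, `μ` has weight `-1` and
cochains have weight `1`. Conversely a homogeneous alternating map of weight `1` is a cochain
(`exists_hat_eq`), and one of weight `2` is zero (`eq_zero_of_hasWeight_two`). So `[[μ, f₁], f₂]`
and `[θ, f]` are cochains again, and cochains commute under `nrBracket`. With these facts the axioms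
follow from Jacobi (`derived_skew`, `derived_jacobi`, `derived_leibniz`).

For the last claim, `[[μ, D], D]` takes the value `2 μ(Dx, Dy)` and `[θ, D]` the value `ρ(x)Dy ∓
ρ(y)Dx - D(π(x, y))`, so the Maurer–Cartan equation is the crossed homomorphism identity once `2` is
invertible. -/

theorem sign_smul_congr {a b : ZMod 2} {x y : M} (h : a = b) (h' : x = y) :
    (-1 : ℤˣ) ^ a • x = (-1 : ℤˣ) ^ b • y := by
  rw [h, h']

theorem neg_one_sign_smul (x : M) : (-1 : ℤˣ) • x = -x := by
  rw [Units.smul_def, Units.val_neg, Units.val_one, neg_one_smul]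

theorem neg_eq_sign_smul (x : M) : -x = (-1 : ℤˣ) ^ (1 : ZMod 2) • x := by
  rw [uzpow_one, neg_one_sign_smul]

theorem zmodTwo_add_self (a : ZMod 2) : a + a = 0 := CharTwo.add_self_eq_zero a

/-- The sum of the labels of a list of labelled vectors. -/
def lsum (L : List (ZMod 2 × V)) : ZMod 2 := (L.map Prod.fst).sum

/-- The parity of the length of a list. -/
def llen (L : List (ZMod 2 × V)) : ZMod 2 := L.length

@[simp] theorem lsum_nil : lsum ([] : List (ZMod 2 × V)) = 0 := rfl

@[simp] theorem lsum_cons (x : ZMod 2 × V) (L : List (ZMod 2 × V)) :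
    lsum (x :: L) = x.1 + lsum L := by
  simp [lsum]

@[simp] theorem lsum_append (A B : List (ZMod 2 × V)) : lsum (A ++ B) = lsum A + lsum B := by
  simp [lsum]

@[simp] theorem llen_nil : llen ([] : List (ZMod 2 × V)) = 0 := by simp [llen]

@[simp] theorem llen_cons (x : ZMod 2 × V) (L : List (ZMod 2 × V)) :
    llen (x :: L) = llen L + 1 := by
  simp [llen]

@[simp] theorem llen_append (A B : List (ZMod 2 × V)) : llen (A ++ B) = llen A + llen B := by
  simp [llen]

/-- The signed sum of `φ A B` over the splittings of a list into complementary sublists `A`, `B`;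
moving `x` past `y` costs the sign `-(-1) ^ (x y)`. -/
def unsh : (List (ZMod 2 × V) → List (ZMod 2 × V) → M) → List (ZMod 2 × V) → M
  | φ, [] => φ [] []
  | φ, x :: L => unsh (fun A B => φ (x :: A) B) L +
      unsh (fun A B => (-1 : ℤˣ) ^ (llen A + x.1 * lsum A) • φ A (x :: B)) L

theorem unsh_congr {φ ψ : List (ZMod 2 × V) → List (ZMod 2 × V) → M} (L : List (ZMod 2 × V))
    (h : ∀ A B, A.length + B.length = L.length → lsum A + lsum B = lsum L → φ A B = ψ A B) :
    unsh φ L = unsh ψ L := by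
  induction L generalizing φ ψ with
  | nil => exact h [] [] (by simp) (by simp)
  | cons x L ih =>
    simp only [unsh]
    congr 1
    · refine ih fun A B h1 h2 => h _ _ ?_ ?_
      · simp only [List.length_cons]; omega
      · rw [lsum_cons, lsum_cons, ← h2, add_assoc]
    · refine ih fun A B h1 h2 => congrArg _ (h _ _ ?_ ?_)
      · simp only [List.length_cons]; omega
      · rw [lsum_cons, lsum_cons, ← h2, add_left_comm]

theorem map_unsh {N F : Type*} [AddCommGroup N] [FunLike F M N] [AddMonoidHomClass F M N] (f : F)
    (φ : List (ZMod 2 × V) → List (ZMod 2 × V) → M) (L : List (ZMod 2 × V)) :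
    f (unsh φ L) = unsh (fun A B => f (φ A B)) L := by
  induction L generalizing φ with
  | nil => rfl
  | cons x L ih =>
    simp only [unsh, map_add, ih]
    congr 2
    funext A B
    rw [Units.smul_def, Units.smul_def, map_zsmul]

theorem unsh_add (φ ψ : List (ZMod 2 × V) → List (ZMod 2 × V) → M) (L : List (ZMod 2 × V)) :
    unsh (fun A B => φ A B + ψ A B) L = unsh φ L + unsh ψ L := by
  induction L generalizing φ ψ with
  | nil => rfl
  | cons x L ih =>
    simp only [unsh, smul_add, ih]
    abel

theorem unsh_zero (L : List (ZMod 2 × V)) : unsh (fun _ _ => (0 : M)) L = 0 := by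
  induction L with
  | nil => rfl
  | cons x L ih => simp only [unsh, smul_zero, ih, add_zero]

theorem unsh_eq_zero {φ : List (ZMod 2 × V) → List (ZMod 2 × V) → M} (L : List (ZMod 2 × V))
    (h : ∀ A B, A.length + B.length = L.length → lsum A + lsum B = lsum L → φ A B = 0) :
    unsh φ L = 0 :=
  (unsh_congr L h).trans (unsh_zero L)

theorem unsh_mem {S : Type*} [SetLike S M] [AddSubgroupClass S M] (N : S)
    {φ : List (ZMod 2 × V) → List (ZMod 2 × V) → M} (L : List (ZMod 2 × V))
    (h : ∀ A B, A.length + B.length = L.length → lsum A + lsum B = lsum L → φ A B ∈ N) :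
    unsh φ L ∈ N := by
  induction L generalizing φ with
  | nil => exact h [] [] (by simp) (by simp)
  | cons x L ih =>
    refine add_mem (ih fun A B h1 h2 => h _ _ ?_ ?_) (ih fun A B h1 h2 => ?_)
    · simp only [List.length_cons]; omega
    · rw [lsum_cons, lsum_cons, ← h2, add_assoc]
    · rw [Units.smul_def]
      refine zsmul_mem (h _ _ ?_ ?_) _
      · simp only [List.length_cons]; omega
      · rw [lsum_cons, lsum_cons, ← h2, add_left_comm]

theorem unsh_smul {R : Type*} [Monoid R] [DistribMulAction R M] (c : R)
    (φ : List (ZMod 2 × V) → List (ZMod 2 × V) → M) (L : List (ZMod 2 × V)) :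
    unsh (fun A B => c • φ A B) L = c • unsh φ L :=
  (map_unsh (DistribSMul.toAddMonoidHom M c) φ L).symm

theorem unsh_sub (φ ψ : List (ZMod 2 × V) → List (ZMod 2 × V) → M) (L : List (ZMod 2 × V)) :
    unsh (fun A B => φ A B - ψ A B) L = unsh φ L - unsh ψ L := by
  rw [eq_sub_iff_add_eq, ← unsh_add]
  simp only [sub_add_cancel]

/-- Both sides are the signed sum over the splittings of `L` into three sublists. In the induction
the first letter goes to one of the three. -/
theorem unsh_assoc (φ : List (ZMod 2 × V) → List (ZMod 2 × V) → List (ZMod 2 × V) → M)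
    (L : List (ZMod 2 × V)) :
    unsh (fun A B => unsh (fun A₁ A₂ => φ A₁ A₂ B) A) L =
      unsh (fun A B => unsh (fun B₁ B₂ => φ A B₁ B₂) B) L := by
  induction L generalizing φ with
  | nil => rfl
  | cons x L ih =>
    simp only [unsh, unsh_add, smul_add, ← add_assoc]
    rw [ih fun A₁ A₂ B => φ (x :: A₁) A₂ B]
    rw [ih fun A₁ A₂ B => (-1 : ℤˣ) ^ (llen A₁ + x.1 * lsum A₁) • φ A₁ (x :: A₂) B]
    simp only [unsh_smul, add_right_inj]
    -- The sign of moving `x` past `A` is the product of the signs for its two parts, because length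
    -- and label sum are additive over splittings.
    have h : ∀ A B : List (ZMod 2 × V),
        (-1 : ℤˣ) ^ (llen A + x.1 * lsum A) • unsh (fun A₁ A₂ => φ A₁ A₂ (x :: B)) A =
        unsh (fun A₁ A₂ => (-1 : ℤˣ) ^ (llen A₁ + x.1 * lsum A₁) •
          (-1 : ℤˣ) ^ (llen A₂ + x.1 * lsum A₂) • φ A₁ A₂ (x :: B)) A := by
      intro A B
      rw [← unsh_smul]
      refine unsh_congr A fun A₁ A₂ h1 h2 => ?_
      rw [smul_smul, ← uzpow_add, ← h2, llen, ← h1]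
      refine sign_smul_congr ?_ rfl
      simp only [llen]
      push_cast
      ring
    simp only [h]
    rw [ih fun A₁ A₂ B => (-1 : ℤˣ) ^ (llen A₁ + x.1 * lsum A₁) •
          (-1 : ℤˣ) ^ (llen A₂ + x.1 * lsum A₂) • φ A₁ A₂ (x :: B)]
    simp only [unsh_smul]

theorem unsh_comm (φ : List (ZMod 2 × V) → List (ZMod 2 × V) → M) (L : List (ZMod 2 × V)) :
    unsh φ L = unsh (fun A B => (-1 : ℤˣ) ^ (llen A * llen B + lsum A * lsum B) • φ B A) L := by
  induction L generalizing φ with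
  | nil => simp [unsh]
  | cons x L ih =>
    simp only [unsh]
    rw [ih fun A B => φ (x :: A) B, ih fun A B => _ • φ A (x :: B), add_comm]
    simp only [smul_smul, ← uzpow_add]
    congr 2 <;> funext A B <;> refine sign_smul_congr ?_ rfl <;> simp <;> grind

/-- A splitting cancels against its complement. The two are told apart by the place of the first
letter, so no division by `2` is needed; the empty list has no such letter and requires `h0`. -/
theorem unsh_eq_zero_of_antisymm (φ : List (ZMod 2 × V) → List (ZMod 2 × V) → M)
    (L : List (ZMod 2 × V)) (h0 : φ [] [] = 0)
    (h : ∀ A B, A.length + B.length = L.length →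
      φ A B = -((-1 : ℤˣ) ^ (llen A * llen B + lsum A * lsum B) • φ B A)) :
    unsh φ L = 0 := by
  cases L with
  | nil => exact h0
  | cons x L =>
    simp only [unsh]
    rw [unsh_comm fun A B => _ • φ A (x :: B), ← unsh_add]
    refine unsh_eq_zero L fun A B h1 _ => ?_
    rw [h (x :: A) B (by simp only [List.length_cons]; omega), smul_smul, ← uzpow_add,
      neg_add_eq_zero]
    refine sign_smul_congr ?_ rfl
    simp
    grind

/-- The defining recursion seen from the other end: a last letter that joins the first sublist has
to pass all of `B`. -/
theorem unsh_concat (φ : List (ZMod 2 × V) → List (ZMod 2 × V) → M) (L : List (ZMod 2 × V))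
    (y : ZMod 2 × V) :
    unsh φ (L ++ [y]) = unsh (fun A B => φ A (B ++ [y])) L +
      unsh (fun A B => (-1 : ℤˣ) ^ (llen B + y.1 * lsum B) • φ (A ++ [y]) B) L := by
  induction L generalizing φ with
  | nil => simp [unsh, add_comm]
  | cons x L ih =>
    simp only [List.cons_append, unsh, ih, smul_smul, ← uzpow_add]
    have : ∀ a b c d : M, a + b + (c + d) = a + c + (b + d) := fun a b c d => by abel
    rw [this]
    congr 3
    funext A B
    refine sign_smul_congr ?_ rfl
    simp
    grind

/-- Interchanging neighbours `x`, `y` multiplies `Φ` by `-(-1) ^ (x y)`. -/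
def IsAlternating (Φ : List (ZMod 2 × V) → M) : Prop :=
  ∀ A x y B, Φ (A ++ x :: y :: B) = (-1 : ℤˣ) ^ (1 + x.1 * y.1) • Φ (A ++ y :: x :: B)

theorem lsum_swap (A : List (ZMod 2 × V)) (x y : ZMod 2 × V) (B : List (ZMod 2 × V)) :
    lsum (A ++ x :: y :: B) = lsum (A ++ y :: x :: B) := by
  simp; ring

theorem llen_swap (A : List (ZMod 2 × V)) (x y : ZMod 2 × V) (B : List (ZMod 2 × V)) :
    llen (A ++ x :: y :: B) = llen (A ++ y :: x :: B) := by
  simp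

/-- If the neighbours `x`, `y` fall into the same sublist, the hypothesis on that argument applies;
if they are separated, exchanging them permutes the two mixed terms of the sum, and the sign is the
one of moving `x` past `y`. -/
theorem IsAlternating.unsh {φ : List (ZMod 2 × V) → List (ZMod 2 × V) → M}
    (h₁ : ∀ B, IsAlternating fun A => φ A B) (h₂ : ∀ A, IsAlternating (φ A)) :
    IsAlternating (unsh φ) := by
  intro L x y L'
  induction L generalizing φ with
  | nil =>
    simp only [List.nil_append, SuperLie.unsh, smul_smul, ← uzpow_add, smul_add, ← add_assoc]
    have : ∀ a b c d : M, a + b + c + d = a + c + b + d := fun a b c d => by abel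
    rw [this]
    simp only [← unsh_smul, smul_smul, ← uzpow_add]
    congr 1
    · congr 1
      · congr 1
        · congr 1
          funext A B
          exact h₁ B [] x y A
        · congr 1
          funext A B
          refine sign_smul_congr ?_ rfl
          simp
          grind
      · congr 1
        funext A B
        refine sign_smul_congr ?_ rfl
        simp
        grind
    · congr 1
      funext A B
      have := h₂ A [] x y B
      rw [List.nil_append, List.nil_append] at this
      rw [this, smul_smul, ← uzpow_add]
      refine sign_smul_congr ?_ rfl
      grind
  | cons z L ih =>
    simp only [List.cons_append, SuperLie.unsh, smul_add]
    congr 1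
    · exact ih (fun B A x y C => h₁ B (z :: A) x y C) (fun A => h₂ (z :: A))
    · refine ih (fun B A x y C => ?_) (fun A B x y C => ?_)
      · simp only [lsum_swap A x y, llen_swap A x y]
        have := h₁ (z :: B) A x y C
        beta_reduce at this
        rw [this, smul_comm]
      · have := h₂ A (z :: B) x y C
        simp only [List.cons_append] at this
        simp only [this]
        rw [smul_comm]

end Unshuffle

/-! ### The composition product of functions on lists -/

section ListCirc

variable {V : Type*} [AddCommGroup V]

/-- The product `F ∘ F'` for functions of lists of labelled vectors; `c` is the degree of `F'`. -/
def lcirc (c : ZMod 2) (Φ Ψ : List (ZMod 2 × V) → V) : List (ZMod 2 × V) → V :=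
  unsh fun A B => (-1 : ℤˣ) ^ (c * lsum A) • Φ (A ++ [(c + lsum B, Ψ B)])

/-- The function vanishes on the lists whose length is not `n`. -/
def HasArity (n : ℕ) (Φ : List (ZMod 2 × V) → V) : Prop :=
  ∀ L, L.length ≠ n → Φ L = 0

/-- The function is additive in the last entry. -/
def IsAddLast (Φ : List (ZMod 2 × V) → V) : Prop :=
  ∀ A a v w, Φ (A ++ [(a, v + w)]) = Φ (A ++ [(a, v)]) + Φ (A ++ [(a, w)])

/-- The last entry as the argument of an additive map. -/
def IsAddLast.hom {Φ : List (ZMod 2 × V) → V} (h : IsAddLast Φ) (A : List (ZMod 2 × V))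
    (a : ZMod 2) : V →+ V :=
  AddMonoidHom.mk' (fun v => Φ (A ++ [(a, v)])) (h A a)

theorem IsAddLast.map_zero {Φ : List (ZMod 2 × V) → V} (h : IsAddLast Φ)
    (A : List (ZMod 2 × V)) (a : ZMod 2) : Φ (A ++ [(a, 0)]) = 0 :=
  (h.hom A a).map_zero

theorem IsAddLast.map_sub {Φ : List (ZMod 2 × V) → V} (h : IsAddLast Φ)
    (A : List (ZMod 2 × V)) (a : ZMod 2) (v w : V) :
    Φ (A ++ [(a, v - w)]) = Φ (A ++ [(a, v)]) - Φ (A ++ [(a, w)]) :=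
  (h.hom A a).map_sub v w

theorem IsAddLast.map_sign_smul {Φ : List (ZMod 2 × V) → V} (h : IsAddLast Φ)
    (A : List (ZMod 2 × V)) (a : ZMod 2) (u : ℤˣ) (v : V) :
    Φ (A ++ [(a, u • v)]) = u • Φ (A ++ [(a, v)]) := by
  rw [Units.smul_def, Units.smul_def]
  exact map_zsmul (h.hom A a) _ v

theorem IsAddLast.map_unsh {Φ : List (ZMod 2 × V) → V} (h : IsAddLast Φ)
    (A : List (ZMod 2 × V)) (a : ZMod 2) (φ : List (ZMod 2 × V) → List (ZMod 2 × V) → V)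
    (L : List (ZMod 2 × V)) :
    Φ (A ++ [(a, unsh φ L)]) = unsh (fun B C => Φ (A ++ [(a, φ B C)])) L :=
  SuperLie.map_unsh (h.hom A a) φ L

theorem lcirc_add_right (c : ZMod 2) {Φ : List (ZMod 2 × V) → V} (h : IsAddLast Φ)
    (Ψ₁ Ψ₂ : List (ZMod 2 × V) → V) : lcirc c Φ (Ψ₁ + Ψ₂) = lcirc c Φ Ψ₁ + lcirc c Φ Ψ₂ := by
  funext L
  simp only [lcirc, Pi.add_apply, h _ _ _ _, smul_add, unsh_add]

theorem lcirc_sub_right (c : ZMod 2) {Φ : List (ZMod 2 × V) → V} (h : IsAddLast Φ)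
    (Ψ₁ Ψ₂ : List (ZMod 2 × V) → V) : lcirc c Φ (Ψ₁ - Ψ₂) = lcirc c Φ Ψ₁ - lcirc c Φ Ψ₂ := by
  funext L
  simp only [lcirc, Pi.sub_apply, h.map_sub, smul_sub, unsh_sub]

theorem lcirc_add_left (c : ZMod 2) (Φ₁ Φ₂ Ψ : List (ZMod 2 × V) → V) :
    lcirc c (Φ₁ + Φ₂) Ψ = lcirc c Φ₁ Ψ + lcirc c Φ₂ Ψ := by
  funext L
  simp only [lcirc, Pi.add_apply, smul_add, unsh_add]

theorem lcirc_sub_left (c : ZMod 2) (Φ₁ Φ₂ Ψ : List (ZMod 2 × V) → V) :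
    lcirc c (Φ₁ - Φ₂) Ψ = lcirc c Φ₁ Ψ - lcirc c Φ₂ Ψ := by
  funext L
  simp only [lcirc, Pi.sub_apply, smul_sub, unsh_sub]

/-- The associator of the composition product: the sum over the insertions of `Ψ₁` and `Ψ₂` into
different entries of `Φ`. -/
def lassoc (c d : ZMod 2) (Φ Ψ₁ Ψ₂ : List (ZMod 2 × V) → V) : List (ZMod 2 × V) → V :=
  unsh fun A C => (-1 : ℤˣ) ^ ((c + d) * lsum A) • unsh (fun B₁ B₂ =>
    (-1 : ℤˣ) ^ (llen B₁ + lsum B₁ * lsum B₂ + c * d + c * lsum B₂) •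
      Φ (A ++ [(d + lsum B₂, Ψ₂ B₂), (c + lsum B₁, Ψ₁ B₁)])) C

/-- The value of `Ψ₂` is the last entry of the list that is split for `Φ ∘ Ψ₁`. By `unsh_concat` it
becomes an argument of `Ψ₁`, which gives `Φ ∘ (Ψ₁ ∘ Ψ₂)`, or an argument of `Φ`, which gives the
associator. -/
theorem lcirc_lcirc (c d : ZMod 2) {Φ : List (ZMod 2 × V) → V} (h : IsAddLast Φ)
    (Ψ₁ Ψ₂ : List (ZMod 2 × V) → V) :
    lcirc d (lcirc c Φ Ψ₁) Ψ₂ = lcirc (c + d) Φ (lcirc d Ψ₁ Ψ₂) + lassoc c d Φ Ψ₁ Ψ₂ := by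
  funext L
  simp only [Pi.add_apply]
  unfold lcirc lassoc
  simp only [unsh_concat, smul_add, unsh_add, ← unsh_smul, h.map_unsh, h.map_sign_smul]
  congr 1
  -- Writing the label `lsum B` as `lsum C₁ + lsum C₂` makes the summand a function of the three
  -- sublists, as `unsh_assoc` needs.
  · trans unsh (fun A B => unsh (fun C₁ C₂ => (-1 : ℤˣ) ^ ((c + d) * lsum A) •
        (-1 : ℤˣ) ^ (d * lsum C₁) •
          Φ (A ++ [(c + d + (lsum C₁ + lsum C₂), Ψ₁ (C₁ ++ [(d + lsum C₂, Ψ₂ C₂)]))])) B) L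
    swap
    · refine unsh_congr L fun A B _ _ => unsh_congr B fun C₁ C₂ _ e => ?_
      rw [e]
    rw [← unsh_assoc fun A C₁ C₂ => (-1 : ℤˣ) ^ ((c + d) * lsum A) • (-1 : ℤˣ) ^ (d * lsum C₁) •
      Φ (A ++ [(c + d + (lsum C₁ + lsum C₂), Ψ₁ (C₁ ++ [(d + lsum C₂, Ψ₂ C₂)]))])]
    refine unsh_congr L fun A B h1 h2 => unsh_congr A fun A₁ A₂ h3 h4 => ?_
    simp only [smul_smul, ← uzpow_add, lsum_append, lsum_cons, lsum_nil]
    rw [show c + (lsum A₂ + (d + lsum B + 0)) = c + d + (lsum A₂ + lsum B) by ring]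
    refine sign_smul_congr ?_ rfl
    grind
  · rw [← unsh_assoc fun A B₁ B₂ => (-1 : ℤˣ) ^ ((c + d) * lsum A) •
      (-1 : ℤˣ) ^ (llen B₁ + lsum B₁ * lsum B₂ + c * d + c * lsum B₂) •
        Φ (A ++ [(d + lsum B₂, Ψ₂ B₂), (c + lsum B₁, Ψ₁ B₁)])]
    refine unsh_congr L fun A B h1 h2 => unsh_congr A fun A₁ A₂ h3 h4 => ?_
    simp only [smul_smul, ← uzpow_add, lsum_append, lsum_cons, lsum_nil, List.append_assoc,
      List.cons_append, List.nil_append]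
    refine sign_smul_congr ?_ rfl
    grind

theorem IsAlternating.map_swap_last {Φ : List (ZMod 2 × V) → V} (h : IsAlternating Φ)
    (A : List (ZMod 2 × V)) (x y : ZMod 2 × V) :
    Φ (A ++ [x, y]) = (-1 : ℤˣ) ^ (1 + x.1 * y.1) • Φ (A ++ [y, x]) :=
  h A x y []

theorem IsAlternating.map_zero_left {Φ : List (ZMod 2 × V) → V} (h : IsAlternating Φ)
    (h' : IsAddLast Φ) (A : List (ZMod 2 × V)) (a : ZMod 2) (y : ZMod 2 × V) :
    Φ (A ++ [(a, 0), y]) = 0 := by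
  rw [h.map_swap_last, List.append_cons, h'.map_zero, smul_zero]

theorem IsAddLast.map_zero_right {Φ : List (ZMod 2 × V) → V} (h : IsAddLast Φ)
    (A : List (ZMod 2 × V)) (a : ZMod 2) (y : ZMod 2 × V) :
    Φ (A ++ [y, (a, 0)]) = 0 := by
  rw [List.append_cons, h.map_zero]

/-- Exchange `B₁` with `B₂` by `unsh_comm`, then exchange the last two entries of `Φ`. The resulting
sign depends on the lengths of `B₁` and `B₂`; the arities fix these, since all other terms vanish.
-/
theorem lassoc_symm (c d : ZMod 2) {m k : ℕ} {Φ Ψ₁ Ψ₂ : List (ZMod 2 × V) → V}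
    (h : IsAddLast Φ) (h' : IsAlternating Φ) (h₁ : HasArity (m + 1) Ψ₁)
    (h₂ : HasArity (k + 1) Ψ₂) :
    lassoc c d Φ Ψ₁ Ψ₂ = (-1 : ℤˣ) ^ ((m * k : ZMod 2) + c * d) • lassoc d c Φ Ψ₂ Ψ₁ := by
  funext L
  rw [Pi.smul_apply]
  unfold lassoc
  rw [← unsh_smul]
  refine unsh_congr L fun A C _ _ => ?_
  rw [smul_comm, add_comm d c, ← unsh_smul ((-1 : ℤˣ) ^ ((m * k : ZMod 2) + c * d))]
  refine congrArg _ ?_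
  refine (unsh_comm _ C).trans ?_
  refine unsh_congr C fun B₁ B₂ _ _ => ?_
  by_cases h1 : B₂.length = m + 1
  swap
  · rw [h₁ _ h1, h.map_zero_right, h'.map_zero_left h, smul_zero, smul_zero, smul_zero, smul_zero]
  by_cases h2 : B₁.length = k + 1
  swap
  · rw [h₂ _ h2, h.map_zero_right, h'.map_zero_left h, smul_zero, smul_zero, smul_zero, smul_zero]
  rw [h'.map_swap_last]
  simp only [smul_smul, ← uzpow_add]
  refine sign_smul_congr ?_ rfl
  simp only [llen, h1, h2]
  push_cast
  grind

/-- `lassoc_symm` would only give that twice the associator is zero. Here the inner summand is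
itself antisymmetric under the exchange of `B₁` and `B₂`, which makes the sum vanish in every
characteristic. -/
theorem lassoc_self {Φ Θ : List (ZMod 2 × V) → V} (h : IsAddLast Φ) (h' : IsAlternating Φ)
    (hΘ : HasArity 2 Θ) : lassoc 0 0 Φ Θ Θ = 0 := by
  funext L
  refine unsh_eq_zero L fun A C _ _ => ?_
  rw [unsh_eq_zero_of_antisymm, smul_zero]
  · rw [hΘ [] (by simp), h.map_zero_right, smul_zero]
  · intro B₁ B₂ _
    by_cases h1 : B₁.length = 2
    swap
    · rw [hΘ _ h1, h.map_zero_right, h'.map_zero_left h, smul_zero, smul_zero, smul_zero, neg_zero]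
    by_cases h2 : B₂.length = 2
    swap
    · rw [hΘ _ h2, h.map_zero_right, h'.map_zero_left h, smul_zero, smul_zero, smul_zero, neg_zero]
    rw [h'.map_swap_last, neg_eq_sign_smul]
    simp only [smul_smul, ← uzpow_add]
    refine sign_smul_congr ?_ rfl
    simp only [llen, h1, h2]
    push_cast
    grind

/-- The bracket of functions of degrees `(n, f)` and `(n', f')`. -/
def lbr (n n' f f' : ZMod 2) (Φ Ψ : List (ZMod 2 × V) → V) : List (ZMod 2 × V) → V :=
  lcirc f' Φ Ψ - (-1 : ℤˣ) ^ (n * n' + f * f') • lcirc f Ψ Φ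

theorem lcirc_sign_smul_left (c : ZMod 2) (u : ℤˣ) (Φ Ψ : List (ZMod 2 × V) → V) :
    lcirc c (u • Φ) Ψ = u • lcirc c Φ Ψ := by
  funext L
  simp only [lcirc, Pi.smul_apply, ← unsh_smul, smul_comm u]

theorem lcirc_sign_smul_right (c : ZMod 2) (u : ℤˣ) {Φ : List (ZMod 2 × V) → V}
    (h : IsAddLast Φ) (Ψ : List (ZMod 2 × V) → V) :
    lcirc c Φ (u • Ψ) = u • lcirc c Φ Ψ := by
  funext L
  simp only [lcirc, Pi.smul_apply, ← unsh_smul, smul_comm u, h.map_sign_smul]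

theorem lbr_skew (n n' f f' : ZMod 2) (Φ Ψ : List (ZMod 2 × V) → V) :
    lbr n n' f f' Φ Ψ = -((-1 : ℤˣ) ^ (n * n' + f * f') • lbr n' n f' f Ψ Φ) := by
  unfold lbr
  rw [smul_sub, smul_smul, ← uzpow_add, mul_comm n' n, mul_comm f' f, zmodTwo_add_self]
  simp

/-- Expand every double composition by `lcirc_lcirc`: the iterated terms `X ∘ (Y ∘ Z)` cancel
outright and the associators cancel in pairs by `lassoc_symm`. All signs are products of the three
signs of the pairs `(X, Y)`, `(X, Z)`, `(Y, Z)`, whose values are then run through. -/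
theorem lbr_jacobi {k l m : ℕ} (a b c : ZMod 2) {X Y Z : List (ZMod 2 × V) → V}
    (hX : HasArity (k + 1) X) (hY : HasArity (l + 1) Y) (hZ : HasArity (m + 1) Z)
    (hX' : IsAddLast X) (hY' : IsAddLast Y) (hZ' : IsAddLast Z)
    (aX : IsAlternating X) (aY : IsAlternating Y) (aZ : IsAlternating Z) :
    lbr k (l + m) a (b + c) X (lbr l m b c Y Z) =
      lbr (k + l) m (a + b) c (lbr k l a b X Y) Z +
        (-1 : ℤˣ) ^ ((k * l : ZMod 2) + a * b) • lbr l (k + m) b (a + c) Y (lbr k m a c X Z) := by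
  have e1 : (k * (l + m) + a * (b + c) : ZMod 2) = (k * l + a * b) + (k * m + a * c) := by ring
  have e2 : ((k + l) * m + (a + b) * c : ZMod 2) = (k * m + a * c) + (l * m + b * c) := by ring
  have e3 : (l * (k + m) + b * (a + c) : ZMod 2) = (k * l + a * b) + (l * m + b * c) := by ring
  unfold lbr
  simp only [lcirc_sub_right _ hX', lcirc_sub_right _ hY', lcirc_sub_right _ hZ', lcirc_sub_left,
    lcirc_sign_smul_left, lcirc_sign_smul_right _ _ hX', lcirc_sign_smul_right _ _ hY',
    lcirc_sign_smul_right _ _ hZ', lcirc_lcirc _ _ hX', lcirc_lcirc _ _ hY', lcirc_lcirc _ _ hZ']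
  rw [lassoc_symm c b hX' aX hZ hY, lassoc_symm c a hY' aY hZ hX, lassoc_symm b a hZ' aZ hY hX,
    mul_comm (m : ZMod 2) l, mul_comm (m : ZMod 2) k, mul_comm (l : ZMod 2) k,
    mul_comm c b, mul_comm c a, mul_comm b a, e1, e2, e3]
  rw [add_comm c b, add_comm c a, add_comm b a]
  simp only [uzpow_add (-1 : ℤˣ) (_ + _) (_ + _)]
  generalize (-1 : ℤˣ) ^ ((k * l : ZMod 2) + a * b) = u
  generalize (-1 : ℤˣ) ^ ((k * m : ZMod 2) + a * c) = v
  generalize (-1 : ℤˣ) ^ ((l * m : ZMod 2) + b * c) = w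
  rcases Int.units_eq_one_or u with rfl | rfl <;> rcases Int.units_eq_one_or v with rfl | rfl <;>
    rcases Int.units_eq_one_or w with rfl | rfl <;>
    simp only [one_smul, mul_one, neg_one_sign_smul, mul_neg, neg_neg] <;>
    abel

/-- The square of `[Θ, ·]` must vanish without halving a Jacobi identity, as `2` may be zero. The
term `(X ∘ Θ) ∘ Θ` vanishes by `lassoc_self`, and the three other terms of the expansion cancel by
`(Θ ∘ Θ) ∘ X = 0` and `lassoc_symm`. -/
theorem lbr_lbr_self {k : ℕ} (a : ZMod 2) {Θ X : List (ZMod 2 × V) → V}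
    (hΘ : HasArity 2 Θ) (hX : HasArity (k + 1) X) (hΘ' : IsAddLast Θ) (hX' : IsAddLast X)
    (aΘ : IsAlternating Θ) (aX : IsAlternating X) (h : lcirc 0 Θ Θ = 0) :
    lbr 1 (1 + k) 0 (0 + a) Θ (lbr 1 k 0 a Θ X) = 0 := by
  have h0 : lcirc a (lcirc 0 Θ Θ) X = 0 := by
    rw [h]
    funext L
    simp only [lcirc, Pi.zero_apply, smul_zero, unsh_zero]
  have h1 : lcirc 0 (lcirc 0 X Θ) Θ = 0 := by
    rw [lcirc_lcirc _ _ hX', lassoc_self hX' aX hΘ, h, add_zero]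
    funext L
    simp only [lcirc, Pi.zero_apply, hX'.map_zero, smul_zero, unsh_zero]
  have h2 := lassoc_symm 0 a hΘ' aΘ (show HasArity (1 + 1) Θ from hΘ) hX
  rw [lcirc_lcirc _ _ hΘ', h2] at h0
  unfold lbr
  simp only [lcirc_sub_right _ hΘ', lcirc_sub_left, lcirc_sign_smul_left,
    lcirc_sign_smul_right _ _ hΘ', h1, lcirc_lcirc _ _ hΘ']
  simp only [zero_mul, add_zero, one_mul, Nat.cast_one, smul_zero, sub_zero, zero_add,
    mul_add, mul_one, uzpow_add, uzpow_one] at h0 ⊢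
  generalize (-1 : ℤˣ) ^ (k : ZMod 2) = u at *
  have h0' := eq_neg_of_add_eq_zero_left h0
  rw [h0']
  rcases Int.units_eq_one_or u with rfl | rfl <;>
    simp only [one_smul, mul_one, neg_one_sign_smul, mul_neg, neg_neg] <;>
    abel

end ListCirc

/-! ### Signs of permutations and shuffles -/

section Shuffles

theorem ite_odd_eq_pow (a b : ZMod 2) :
    (if a = 1 ∧ b = 1 then (-1 : ℤˣ) else 1) = (-1 : ℤˣ) ^ (a * b) := by
  have h : ∀ c : ZMod 2, c = 0 ∨ c = 1 := by decide
  rcases h a with rfl | rfl <;> rcases h b with rfl | rfl <;> simp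

theorem eps_eq_prod {n : ℕ} (σ : Equiv.Perm (Fin n)) (p : Fin n → ZMod 2) :
    eps σ p = ∏ j, ∏ i, if i < j ∧ σ j < σ i then (-1 : ℤˣ) ^ (1 + p (σ i) * p (σ j)) else 1 := by
  have h1 : ∀ j, ∏ i < j, (if σ i < σ j then (1 : ℤˣ) else -1) =
      ∏ i, if i < j ∧ σ j < σ i then (-1 : ℤˣ) else 1 := by
    intro j
    rw [← Finset.prod_filter_mul_prod_filter_not Finset.univ (· < j), ← mul_one (Finset.prod _ _)]
    congr 1
    · refine Finset.prod_congr (by ext; simp) fun i hi => ?_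
      have hi : i < j := by simpa using hi
      have : σ i ≠ σ j := fun h => hi.ne (σ.injective h)
      grind
    · refine (Finset.prod_eq_one fun i hi => ?_).symm
      grind
  rw [eps, Equiv.Perm.sign_eq_prod_prod_Iio, Finset.prod_congr rfl fun j _ => h1 j,
    ← Finset.prod_const, Finset.prod_filter, Fintype.prod_prod_type_right,
    ← Finset.prod_mul_distrib]
  refine Finset.prod_congr rfl fun j _ => ?_
  rw [← Finset.prod_mul_distrib]
  refine Finset.prod_congr rfl fun i _ => ?_
  dsimp only
  rw [uzpow_add, uzpow_one, ← ite_odd_eq_pow]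
  grind

theorem prod_lt_comp {n : ℕ} {M : Type*} [CommMonoid M] (τ : Equiv.Perm (Fin n))
    (g : Fin n → Fin n → M) (hg : ∀ i j, g i j = g j i) :
    ∏ x : Fin n × Fin n with x.1 < x.2, g (τ x.1) (τ x.2) =
      ∏ x : Fin n × Fin n with x.1 < x.2, g x.1 x.2 := by
  have key : ∀ τ : Equiv.Perm (Fin n), ∀ x : Fin n × Fin n, x.1 < x.2 → τ x.1 ≠ τ x.2 :=
    fun τ x hx h => hx.ne (τ.injective h)
  refine Finset.prod_nbij'
    (fun x => if τ x.1 < τ x.2 then (τ x.1, τ x.2) else (τ x.2, τ x.1))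
    (fun x => if τ⁻¹ x.1 < τ⁻¹ x.2 then (τ⁻¹ x.1, τ⁻¹ x.2) else (τ⁻¹ x.2, τ⁻¹ x.1)) ?_ ?_ ?_ ?_ ?_
  · intro x hx
    have := key τ x (by simpa using hx)
    split_ifs with h
    · simpa using h
    · simpa using lt_of_le_of_ne (not_lt.1 h) this.symm
  · intro x hx
    have := key τ⁻¹ x (by simpa using hx)
    split_ifs with h
    · simpa using h
    · simpa using lt_of_le_of_ne (not_lt.1 h) this.symm
  · intro x hx
    have hx : x.1 < x.2 := by simpa using hx
    split_ifs <;> simp_all [not_lt_of_gt hx]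
  · intro x hx
    have hx : x.1 < x.2 := by simpa using hx
    split_ifs <;> simp_all [not_lt_of_gt hx]
  · intro x _
    split_ifs
    · rfl
    · exact hg _ _

/-- For `i ≠ j` the condition `i < j ↔ σ j < σ i` says that `σ` inverts the unordered pair. Being
symmetric in `i` and `j`, it survives the reindexing of pairs by a permutation in `prod_lt_comp`. -/
theorem eps_eq_prod_pairs {n : ℕ} (σ : Equiv.Perm (Fin n)) (p : Fin n → ZMod 2) :
    eps σ p = ∏ x : Fin n × Fin n with x.1 < x.2,
      if (x.1 < x.2 ↔ σ x.2 < σ x.1) then (-1 : ℤˣ) ^ (1 + p (σ x.1) * p (σ x.2)) else 1 := by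
  rw [eps_eq_prod, Finset.prod_filter, Fintype.prod_prod_type_right]
  refine Finset.prod_congr rfl fun j _ => Finset.prod_congr rfl fun i _ => ?_
  dsimp only
  by_cases h : i < j <;> simp [h]

/-- A pair is inverted by `σ * τ` exactly when one, but not both, of the following holds: `τ`
inverts it, `σ` inverts its image under `τ`. If both hold, the two factors are equal signs and
cancel. This cocycle rule makes `permAct` multiplicative. -/
theorem eps_mul {n : ℕ} (σ τ : Equiv.Perm (Fin n)) (p : Fin n → ZMod 2) :
    eps (σ * τ) p = eps σ p * eps τ (p ∘ σ) := by
  rw [eps_eq_prod_pairs (σ * τ), eps_eq_prod_pairs σ, eps_eq_prod_pairs τ,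
    ← prod_lt_comp τ fun i j =>
      if (i < j ↔ σ j < σ i) then (-1 : ℤˣ) ^ (1 + p (σ i) * p (σ j)) else 1,
    ← Finset.prod_mul_distrib]
  · refine Finset.prod_congr rfl fun x hx => ?_
    have hx : x.1 < x.2 := by simpa using hx
    have h1 : τ x.1 ≠ τ x.2 := fun h => hx.ne (τ.injective h)
    have h2 : σ (τ x.1) ≠ σ (τ x.2) := fun h => h1 (σ.injective h)
    simp only [Equiv.Perm.mul_apply, Function.comp_apply, hx, true_iff]
    rcases lt_or_gt_of_ne h1 with h1 | h1 <;> rcases lt_or_gt_of_ne h2 with h2 | h2 <;>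
      simp [h1, h2, not_lt_of_gt h1, not_lt_of_gt h2]
  · intro i j
    by_cases hij : i = j
    · rw [hij]
    · have : σ i ≠ σ j := fun h => hij (σ.injective h)
      rw [mul_comm (p (σ i))]
      congr 1
      simp only [eq_iff_iff]
      grind

end Shuffles

/-! ### Splittings of a list as sums over subsets of indices -/

section SubsetSums

variable {ι V M : Type*} [LinearOrder ι] [AddCommGroup M]

/-- The sign of the splitting of `S` into `S \ T` and `T`. -/
def splitSign (p : ι → ZMod 2) (S T : Finset ι) : ℤˣ :=
  ∏ t ∈ T, ∏ s ∈ S \ T, if t < s then (-1 : ℤˣ) ^ (1 + p s * p t) else 1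

theorem list_prod_sign (a : ZMod 2) (A : List (ZMod 2 × V)) :
    (A.map fun y => (-1 : ℤˣ) ^ (1 + y.1 * a)).prod = (-1 : ℤˣ) ^ (llen A + a * lsum A) := by
  induction A with
  | nil => simp
  | cons y A ih =>
    rw [List.map_cons, List.prod_cons, ih, ← uzpow_add]
    congr 1
    simp only [llen_cons, lsum_cons]
    ring

/-- The set `T` collects the indices of the entries that go to the second sublist. In the induction
the first index `x` is below all others, so it contributes to the sign only if it lies in `T`, and
then once for each index outside `T`. -/
theorem unsh_map_eq_sum (φ : List (ZMod 2 × V) → List (ZMod 2 × V) → M) (Y : ι → ZMod 2 × V)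
    (I : List ι) (hI : I.Pairwise (· < ·)) :
    unsh φ (I.map Y) = ∑ T ∈ I.toFinset.powerset, splitSign (fun i => (Y i).1) I.toFinset T •
      φ ((I.filter (· ∉ T)).map Y) ((I.filter (· ∈ T)).map Y) := by
  induction I generalizing φ with
  | nil => simp [unsh, splitSign]
  | cons x I ih =>
    obtain ⟨hx, hI⟩ := List.pairwise_cons.1 hI
    have hxI : x ∉ I := fun h => lt_irrefl _ (hx x h)
    have hxI' : x ∉ I.toFinset := by simpa using hxI
    rw [List.map_cons, unsh, ih _ hI, ih _ hI, List.toFinset_cons,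
      Finset.sum_powerset_insert hxI']
    congr 1
    · refine Finset.sum_congr rfl fun T hT => ?_
      have hxT : x ∉ T := fun h => hxI' (Finset.mem_powerset.1 hT h)
      congr 1
      · refine Finset.prod_congr rfl fun t ht => ?_
        rw [Finset.insert_sdiff_of_notMem _ hxT, Finset.prod_insert (by simp [hxI]),
          if_neg (not_lt_of_gt (hx t (by simpa using Finset.mem_powerset.1 hT ht))), one_mul]
      · simp [hxT]
    · refine Finset.sum_congr rfl fun T hT => ?_
      have hxT : x ∉ T := fun h => hxI' (Finset.mem_powerset.1 hT h)
      have h1 : I.filter (· ∉ insert x T) = I.filter (· ∉ T) := by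
        refine List.filter_congr fun i hi => ?_
        have : i ≠ x := fun h => hxI (h ▸ hi)
        simp [this]
      have h2 : I.filter (· ∈ insert x T) = I.filter (· ∈ T) := by
        refine List.filter_congr fun i hi => ?_
        have : i ≠ x := fun h => hxI (h ▸ hi)
        simp [this]
      rw [List.filter_cons_of_neg (by simp), List.filter_cons_of_pos (by simp), h1, h2,
        List.map_cons, smul_smul]
      congr 1
      rw [splitSign, splitSign, Finset.prod_insert hxT, mul_comm,
        Finset.insert_sdiff_of_mem _ (Finset.mem_insert_self x T),
        Finset.sdiff_insert_of_notMem hxI']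
      congr 1
      have h3 : I.toFinset \ T = (I.filter (· ∉ T)).toFinset := by
        ext i; simp
      rw [← list_prod_sign, List.map_map, h3,
        ← List.prod_toFinset _ ((hI.imp ne_of_lt).filter _)]
      refine Finset.prod_congr rfl fun i hi => ?_
      rw [if_pos (hx i (by simp at hi; exact hi.1))]
      rfl

end SubsetSums

/-! ### Shuffles as splittings of a list -/

section ShuffleSums

variable {V M : Type*} [AddCommGroup M] {n m : ℕ}

theorem castAdd_lt_natAdd (n m : ℕ) (i : Fin n) (j : Fin m) :
    Fin.castAdd m i < Fin.natAdd n j := by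
  rw [Fin.lt_def, Fin.val_castAdd, Fin.val_natAdd]
  omega

/-- The values of a shuffle on its last `m` indices. -/
def lastBlock (σ : Equiv.Perm (Fin (n + m))) : Finset (Fin (n + m)) :=
  Finset.univ.map ((Fin.natAddEmb n).trans σ.toEmbedding)

theorem natAdd_mem_lastBlock (σ : Equiv.Perm (Fin (n + m))) (j : Fin m) :
    σ (Fin.natAdd n j) ∈ lastBlock σ := by
  simp [lastBlock]

theorem castAdd_notMem_lastBlock (σ : Equiv.Perm (Fin (n + m))) (i : Fin n) :
    σ (Fin.castAdd m i) ∉ lastBlock σ := by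
  simp only [lastBlock, Finset.mem_map, Finset.mem_univ, true_and, not_exists]
  intro j h
  have := congrArg Fin.val (σ.injective h)
  simp at this
  omega

theorem univ_sdiff_lastBlock (σ : Equiv.Perm (Fin (n + m))) :
    Finset.univ \ lastBlock σ = Finset.univ.map ((Fin.castAddEmb m).trans σ.toEmbedding) := by
  ext k
  obtain ⟨k, rfl⟩ := σ.surjective k
  refine Fin.addCases (fun i => ?_) (fun j => ?_) k
  · simp [castAdd_notMem_lastBlock]
  · have : ∀ i : Fin n, Fin.castAdd m i ≠ Fin.natAdd n j := by
      intro i h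
      have := congrArg Fin.val h
      simp at this
      omega
    simp [natAdd_mem_lastBlock, this]

theorem mem_shuffles (σ : Equiv.Perm (Fin (n + m))) : σ ∈ shuffles n m ↔
    StrictMono (fun i : Fin n => σ (Fin.castAdd m i)) ∧
      StrictMono (fun j : Fin m => σ (Fin.natAdd n j)) := by
  simp [shuffles]

/-- A shuffle is increasing on each block, so every inversion has one index in the first block and
one in the last. -/
theorem eps_shuffle {σ : Equiv.Perm (Fin (n + m))} (hσ : σ ∈ shuffles n m)
    (p : Fin (n + m) → ZMod 2) : eps σ p = splitSign p Finset.univ (lastBlock σ) := by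
  obtain ⟨h1, h2⟩ := (mem_shuffles σ).1 hσ
  rw [eps_eq_prod, splitSign, univ_sdiff_lastBlock, lastBlock, Finset.prod_map, Fin.prod_univ_add]
  rw [Finset.prod_eq_one, one_mul]
  · refine Finset.prod_congr rfl fun j _ => ?_
    rw [Finset.prod_map, Fin.prod_univ_add, mul_comm, Finset.prod_eq_one, one_mul]
    · refine Finset.prod_congr rfl fun i _ => ?_
      have : Fin.castAdd m i < Fin.natAdd n j := castAdd_lt_natAdd n m i j
      simp [this]
    · intro i _
      rw [if_neg]
      rintro ⟨h, h'⟩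
      rw [Fin.natAdd_lt_natAdd_iff] at h
      exact lt_asymm h' (h2 h)
  · intro j _
    refine Finset.prod_eq_one fun i _ => if_neg ?_
    rintro ⟨h, h'⟩
    revert h h'
    refine Fin.addCases (fun i => ?_) (fun i => ?_) i
    · intro h h'
      exact lt_asymm h' (h1 h)
    · intro h
      exact absurd h (not_lt_of_gt (castAdd_lt_natAdd n m j i))

theorem filter_notMem_lastBlock {σ : Equiv.Perm (Fin (n + m))} (hσ : σ ∈ shuffles n m) :
    (List.finRange (n + m)).filter (· ∉ lastBlock σ) =
      List.ofFn fun i => σ (Fin.castAdd m i) := by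
  obtain ⟨h1, h2⟩ := (mem_shuffles σ).1 hσ
  refine List.Pairwise.eq_of_mem_iff (r := (· < ·))
    ((List.pairwise_lt_finRange _).filter _) (List.pairwise_ofFn.2 fun i j h => h1 h) fun k => ?_
  have := congrArg (k ∈ ·) (univ_sdiff_lastBlock σ)
  simpa [List.mem_ofFn] using this

theorem filter_mem_lastBlock {σ : Equiv.Perm (Fin (n + m))} (hσ : σ ∈ shuffles n m) :
    (List.finRange (n + m)).filter (· ∈ lastBlock σ) = List.ofFn fun j => σ (Fin.natAdd n j) := by
  obtain ⟨h1, h2⟩ := (mem_shuffles σ).1 hσ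
  refine List.Pairwise.eq_of_mem_iff (r := (· < ·))
    ((List.pairwise_lt_finRange _).filter _) (List.pairwise_ofFn.2 fun i j h => h2 h) fun k => ?_
  simp [List.mem_ofFn, lastBlock]

theorem exists_shuffle (T : Finset (Fin (n + m))) (hT : T.card = m) :
    ∃ σ ∈ shuffles n m, lastBlock σ = T := by
  have h1 : Tᶜ.card = n := by rw [Finset.card_compl, hT]; simp
  -- The increasing enumerations of `Tᶜ` and of its complement are glued; the double complement is
  -- the shape that `finSumEquivOfFinset` expects.
  have h2 : Tᶜᶜ.card = m := by rw [compl_compl, hT]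
  let σ : Equiv.Perm (Fin (n + m)) := finSumFinEquiv.symm.trans (finSumEquivOfFinset h1 h2)
  have e1 : ∀ i, σ (Fin.castAdd m i) = Tᶜ.orderEmbOfFin h1 i := by
    intro i; simp [σ]
  have e2 : ∀ j, σ (Fin.natAdd n j) = Tᶜᶜ.orderEmbOfFin h2 j := by
    intro i; simp [σ]
  refine ⟨σ, (mem_shuffles σ).2 ⟨?_, ?_⟩, ?_⟩
  · intro i j h
    simpa [e1] using h
  · intro i j h
    simpa [e2] using h
  · refine Finset.eq_of_subset_of_card_le ?_ (by simp [lastBlock, hT])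
    intro k hk
    obtain ⟨j, rfl⟩ : ∃ j, σ (Fin.natAdd n j) = k := by simpa [lastBlock] using hk
    rw [e2]
    simp

/-- A shuffle is determined by the set `lastBlock σ`, which can be any set of `m` indices. The
subsets of other sizes in `unsh_map_eq_sum` contribute nothing by `hφ`. -/
theorem sum_shuffles_eq_unsh (φ : List (ZMod 2 × V) → List (ZMod 2 × V) → M)
    (hφ : ∀ A B, B.length ≠ m → φ A B = 0) (Y : Fin (n + m) → ZMod 2 × V) :
    ∑ σ ∈ shuffles n m, eps σ (fun i => (Y i).1) •
      φ (List.ofFn fun i => Y (σ (Fin.castAdd m i))) (List.ofFn fun j => Y (σ (Fin.natAdd n j))) =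
    unsh φ (List.ofFn Y) := by
  rw [List.ofFn_eq_map, unsh_map_eq_sum φ Y _ (List.pairwise_lt_finRange _)]
  rw [← Finset.sum_subset (s₁ := Finset.powersetCard m Finset.univ)]
  · refine Finset.sum_bij (fun σ _ => lastBlock σ) ?_ ?_ ?_ ?_
    · intro σ _
      simp [lastBlock, Finset.mem_powersetCard]
    · intro σ hσ τ hτ h
      have h1 := filter_notMem_lastBlock hσ
      have h2 := filter_mem_lastBlock hσ
      rw [h, filter_notMem_lastBlock hτ] at h1
      rw [h, filter_mem_lastBlock hτ] at h2
      have h1 := List.ofFn_injective h1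
      have h2 := List.ofFn_injective h2
      refine Equiv.ext fun k => ?_
      refine Fin.addCases (fun i => ?_) (fun j => ?_) k
      · exact (congrFun h1 i).symm
      · exact (congrFun h2 j).symm
    · intro T hT
      obtain ⟨σ, hσ, h⟩ := exists_shuffle T (Finset.mem_powersetCard.1 hT).2
      exact ⟨σ, hσ, h⟩
    · intro σ hσ
      rw [filter_notMem_lastBlock hσ, filter_mem_lastBlock hσ, eps_shuffle hσ, List.map_ofFn,
        List.map_ofFn]
      congr 2
      simp
  · intro T _
    simp
  · intro T _ hT
    rw [hφ, smul_zero]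
    intro h
    refine hT (Finset.mem_powersetCard.2 ⟨Finset.subset_univ _, ?_⟩)
    rw [List.length_map, ← List.toFinset_card_of_nodup ((List.nodup_finRange _).filter _)] at h
    refine Eq.trans ?_ h
    congr 1
    ext k
    simp

end ShuffleSums

/-! ### Multilinear maps at homogeneous arguments -/

section Homogeneous

variable {K V W : Type*} [Field K] [AddCommGroup V] [Module K V] [AddCommGroup W] [Module K W]
variable (𝒱 : ZMod 2 → Submodule K V) (𝒲 : ZMod 2 → Submodule K W)
variable [DirectSum.Decomposition 𝒱] [DirectSum.Decomposition 𝒲]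

theorem map_eq_sum_proj {n : ℕ} (F : MultilinearMap K (fun _ : Fin n => V) W) (X : Fin n → V) :
    F X = ∑ p : Fin n → ZMod 2, F fun i => proj 𝒱 (p i) (X i) := by
  have h := F.map_sum (fun i α => proj 𝒱 α (X i))
  simpa only [sum_proj] using h

/-- All sign conventions are explicit only on homogeneous arguments; this reduces every identity of
multilinear maps to them. -/
theorem multilinear_ext {n : ℕ} {F G : MultilinearMap K (fun _ : Fin n => V) W}
    (h : ∀ (p : Fin n → ZMod 2) (X : Fin n → V), (∀ i, X i ∈ 𝒱 (p i)) → F X = G X) : F = G := by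
  ext X
  rw [map_eq_sum_proj 𝒱 F, map_eq_sum_proj 𝒱 G]
  exact Finset.sum_congr rfl fun p _ => h p _ fun i => proj_mem 𝒱 _ _

theorem map_proj_of_mem {n : ℕ} (F : MultilinearMap K (fun _ : Fin n => V) W)
    {p : Fin n → ZMod 2} {X : Fin n → V} (hX : ∀ i, X i ∈ 𝒱 (p i)) (q : Fin n → ZMod 2) :
    (F fun i => proj 𝒱 (q i) (X i)) = if q = p then F X else 0 := by
  split_ifs with h
  · subst h
    congr 1
    funext i
    rw [proj_of_mem 𝒱 (hX i), if_pos rfl]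
  · obtain ⟨i, hi⟩ := Function.ne_iff.1 h
    exact F.map_coord_zero i (by rw [proj_of_mem 𝒱 (hX i), if_neg hi])

theorem signTwist_apply_of_mem {n : ℕ} (c : (Fin n → ZMod 2) → ℤˣ)
    (F : MultilinearMap K (fun _ : Fin n => V) W) {p : Fin n → ZMod 2} {X : Fin n → V}
    (hX : ∀ i, X i ∈ 𝒱 (p i)) : signTwist 𝒱 c F X = c p • F X := by
  have h : signTwist 𝒱 c F X = ∑ q : Fin n → ZMod 2, c q • F fun i => proj 𝒱 (q i) (X i) := by
    simp only [signTwist, LinearMap.sum_apply, sum_apply]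
    rfl
  rw [h, Finset.sum_eq_single p]
  · rw [map_proj_of_mem 𝒱 F hX, if_pos rfl]
  · intro q _ hq
    rw [map_proj_of_mem 𝒱 F hX, if_neg hq, smul_zero]
  · simp

theorem permAct_apply_of_mem {n : ℕ} (σ : Equiv.Perm (Fin n))
    (F : MultilinearMap K (fun _ : Fin n => V) W) {p : Fin n → ZMod 2} {X : Fin n → V}
    (hX : ∀ i, X i ∈ 𝒱 (p i)) : permAct 𝒱 σ F X = eps σ p • F fun i => X (σ i) := by
  rw [permAct, LinearMap.comp_apply, signTwist_apply_of_mem 𝒱 _ _ hX]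
  rfl

theorem permAct_mul {n : ℕ} (σ τ : Equiv.Perm (Fin n))
    (F : MultilinearMap K (fun _ : Fin n => V) W) :
    permAct 𝒱 (σ * τ) F = permAct 𝒱 σ (permAct 𝒱 τ F) := by
  refine multilinear_ext 𝒱 fun p X hX => ?_
  rw [permAct_apply_of_mem 𝒱 _ _ hX, permAct_apply_of_mem 𝒱 _ _ hX,
    permAct_apply_of_mem 𝒱 (p := p ∘ σ) _ _ fun i => hX (σ i), eps_mul, smul_smul]
  rfl

theorem mem_superAlt {n : ℕ} {F : MultilinearMap K (fun _ : Fin n => V) W} :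
    F ∈ superAlt W 𝒱 n ↔ ∀ σ, permAct 𝒱 σ F = F := by
  simp [superAlt, LinearMap.mem_eqLocus]

/-- Adjacent transpositions generate the symmetric group as a monoid, and `permAct` is
multiplicative. So graded alternation can be tested on neighbours, which is the form it takes for
lists. -/
theorem mem_superAlt_of_swap {n : ℕ} {F : MultilinearMap K (fun _ : Fin (n + 1) => V) W}
    (h : ∀ i : Fin n, permAct 𝒱 (Equiv.swap i.castSucc i.succ) F = F) :
    F ∈ superAlt W 𝒱 (n + 1) := by
  refine (mem_superAlt 𝒱).2 fun σ => ?_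
  have hσ : σ ∈ Submonoid.closure
      (Set.range fun i : Fin n => Equiv.swap i.castSucc i.succ) := by
    rw [Equiv.Perm.mclosure_swap_castSucc_succ]
    trivial
  induction hσ using Submonoid.closure_induction with
  | mem σ hσ =>
    obtain ⟨i, rfl⟩ := hσ
    exact h i
  | one =>
    refine multilinear_ext 𝒱 fun p X hX => ?_
    rw [permAct_apply_of_mem 𝒱 _ _ hX]
    -- By `eps_mul` this unit equals its own square, hence is `1`.
    have h1 : eps (1 : Equiv.Perm (Fin (n + 1))) p = 1 := by
      have := eps_mul 1 1 p
      rw [mul_one] at this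
      exact mul_eq_left.1 this.symm
    rw [h1, one_smul]
    rfl
  | mul σ τ _ _ h1 h2 => rw [permAct_mul, h2, h1]

theorem homComp_apply_of_mem {n : ℕ} (α : ZMod 2) (F : MultilinearMap K (fun _ : Fin n => V) W)
    {p : Fin n → ZMod 2} {X : Fin n → V} (hX : ∀ i, X i ∈ 𝒱 (p i)) :
    homComp 𝒱 𝒲 n α F X = proj 𝒲 (α + ∑ i, p i) (F X) := by
  have h : homComp 𝒱 𝒲 n α F X =
      ∑ q : Fin n → ZMod 2, proj 𝒲 (α + ∑ i, q i) (F fun i => proj 𝒱 (q i) (X i)) := by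
    simp only [homComp, LinearMap.sum_apply, sum_apply]
    rfl
  rw [h, Finset.sum_eq_single p]
  · rw [map_proj_of_mem 𝒱 F hX, if_pos rfl]
  · intro q _ hq
    rw [map_proj_of_mem 𝒱 F hX, if_neg hq, map_zero]
  · simp

theorem homComp_mem {n : ℕ} (α : ZMod 2) (F : MultilinearMap K (fun _ : Fin n => V) W) :
    homComp 𝒱 𝒲 n α F ∈ homDeg 𝒱 𝒲 n α := by
  intro p X hX
  rw [homComp_apply_of_mem 𝒱 𝒲 α F hX]
  exact proj_mem 𝒲 _ _

theorem sum_homComp {n : ℕ} (F : MultilinearMap K (fun _ : Fin n => V) W) :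
    ∑ α, homComp 𝒱 𝒲 n α F = F := by
  refine multilinear_ext 𝒱 fun p X hX => ?_
  rw [sum_apply]
  simp only [homComp_apply_of_mem 𝒱 𝒲 _ F hX]
  exact (Equiv.sum_comp (Equiv.addRight (∑ i, p i)) fun α => proj 𝒲 α (F X)).trans (sum_proj 𝒲 (F X))

theorem homComp_of_mem {n : ℕ} {α : ZMod 2} {F : MultilinearMap K (fun _ : Fin n => V) W}
    (hF : F ∈ homDeg 𝒱 𝒲 n α) (β : ZMod 2) :
    homComp 𝒱 𝒲 n β F = if β = α then F else 0 := by
  refine multilinear_ext 𝒱 fun p X hX => ?_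
  rw [homComp_apply_of_mem 𝒱 𝒲 β F hX, proj_of_mem 𝒲 (hF p X hX)]
  by_cases h : β = α <;> simp [h]

theorem permAct_homComp {n : ℕ} (σ : Equiv.Perm (Fin n)) (α : ZMod 2)
    (F : MultilinearMap K (fun _ : Fin n => V) W) :
    permAct 𝒱 σ (homComp 𝒱 𝒲 n α F) = homComp 𝒱 𝒲 n α (permAct 𝒱 σ F) := by
  refine multilinear_ext 𝒱 fun p X hX => ?_
  rw [permAct_apply_of_mem 𝒱 _ _ hX, homComp_apply_of_mem 𝒱 𝒲 _ _ hX,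
    permAct_apply_of_mem 𝒱 _ _ hX,
    homComp_apply_of_mem 𝒱 𝒲 (p := p ∘ σ) _ _ fun i => hX (σ i), Units.smul_def, Units.smul_def,
    map_zsmul]
  congr 4
  exact Equiv.sum_comp σ p

theorem homComp_mem_superAlt {n : ℕ} (α : ZMod 2)
    {F : MultilinearMap K (fun _ : Fin n => V) W} (hF : F ∈ superAlt W 𝒱 n) :
    homComp 𝒱 𝒲 n α F ∈ superAlt W 𝒱 n := by
  refine (mem_superAlt 𝒱).2 fun σ => ?_
  rw [permAct_homComp, (mem_superAlt 𝒱).1 hF]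

theorem eps_swap {n : ℕ} (i : Fin n) (p : Fin (n + 1) → ZMod 2) :
    eps (Equiv.swap i.castSucc i.succ) p = (-1 : ℤˣ) ^ (1 + p i.castSucc * p i.succ) := by
  have hi : i.castSucc < i.succ := Fin.castSucc_lt_succ
  rw [eps_eq_prod, Finset.prod_eq_single i.succ, Finset.prod_eq_single i.castSucc]
  · simp [hi, mul_comm]
  · intro j _ hj
    rw [if_neg]
    rintro ⟨h1, h2⟩
    rw [Equiv.swap_apply_right, Equiv.swap_apply_of_ne_of_ne hj h1.ne] at h2
    exact absurd h1 (not_lt_of_ge (Fin.castSucc_lt_iff_succ_le.1 h2))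
  · simp
  · intro j _ hj
    refine Finset.prod_eq_one fun k _ => if_neg ?_
    rintro ⟨h1, h2⟩
    by_cases hj' : j = i.castSucc
    · subst hj'
      rw [Equiv.swap_apply_left, Equiv.swap_apply_of_ne_of_ne h1.ne (h1.trans hi).ne] at h2
      exact lt_asymm (h1.trans hi) h2
    · rw [Equiv.swap_apply_of_ne_of_ne hj' hj] at h2
      by_cases hk : k = i.castSucc
      · subst hk
        rw [Equiv.swap_apply_left] at h2
        exact absurd h2 (not_lt_of_ge (Fin.castSucc_lt_iff_succ_le.1 h1))
      · by_cases hk' : k = i.succ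
        · subst hk'
          rw [Equiv.swap_apply_right] at h2
          exact lt_asymm (h2.trans hi) h1
        · rw [Equiv.swap_apply_of_ne_of_ne hk hk'] at h2
          exact lt_asymm h1 h2
  · simp

end Homogeneous

/-! ### Multilinear maps as functions of lists -/

section Encoding

variable {K V : Type*} [Field K] [AddCommGroup V] [Module K V]
variable (𝒱 : ZMod 2 → Submodule K V) [DirectSum.Decomposition 𝒱]

/-- An `n`-linear map as a function of lists of labelled vectors: every vector is projected onto
the component of its label. -/
def enc (n : ℕ) : MultilinearMap K (fun _ : Fin n => V) V →ₗ[K] (List (ZMod 2 × V) → V) where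
  toFun F L := if h : L.length = n then
    F fun i => proj 𝒱 (L.get (i.cast h.symm)).1 (L.get (i.cast h.symm)).2 else 0
  map_add' F G := by
    funext L
    by_cases h : L.length = n <;> simp [h]
  map_smul' c F := by
    funext L
    by_cases h : L.length = n <;> simp [h]

theorem enc_of_length_ne {n : ℕ} (F : MultilinearMap K (fun _ : Fin n => V) V) :
    HasArity n (enc 𝒱 n F) :=
  fun _ h => dif_neg h

theorem enc_ofFn {n : ℕ} (F : MultilinearMap K (fun _ : Fin n => V) V)
    (Y : Fin n → ZMod 2 × V) :
    enc 𝒱 n F (List.ofFn Y) = F fun i => proj 𝒱 (Y i).1 (Y i).2 := by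
  refine (dif_pos (List.length_ofFn (f := Y))).trans ?_
  congr 1
  funext i
  simp

theorem exists_ofFn {α : Type*} {n : ℕ} {L : List α} (h : L.length = n) :
    ∃ Y : Fin n → α, L = List.ofFn Y := by
  subst h
  exact ⟨L.get, (List.ofFn_get L).symm⟩

theorem funext_of_hasArity {n : ℕ} {Φ Ψ : List (ZMod 2 × V) → V} (h₁ : HasArity n Φ)
    (h₂ : HasArity n Ψ) (h : ∀ Y : Fin n → ZMod 2 × V, Φ (List.ofFn Y) = Ψ (List.ofFn Y)) :
    Φ = Ψ := by
  funext L
  by_cases hL : L.length = n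
  · obtain ⟨Y, rfl⟩ := exists_ofFn hL
    exact h Y
  · rw [h₁ L hL, h₂ L hL]

theorem enc_injective (n : ℕ) : Function.Injective (enc 𝒱 n) := by
  intro F G h
  refine multilinear_ext 𝒱 fun p X hX => ?_
  have := congrFun h (List.ofFn fun i => (p i, X i))
  simpa only [enc_ofFn, proj_of_mem 𝒱 (hX _), if_true] using this

theorem ofFn_snoc {α : Type*} {n : ℕ} (Y : Fin n → α) (y : α) :
    List.ofFn (Fin.snoc (α := fun _ => α) Y y : Fin (n + 1) → α) = List.ofFn Y ++ [y] := by
  rw [List.ofFn_succ', List.concat_eq_append]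
  simp

theorem enc_snoc {n : ℕ} (F : MultilinearMap K (fun _ : Fin (n + 1) => V) V)
    (Y : Fin n → ZMod 2 × V) (y : ZMod 2 × V) :
    enc 𝒱 (n + 1) F (List.ofFn Y ++ [y]) =
      F (Fin.snoc (α := fun _ => V) (fun i => proj 𝒱 (Y i).1 (Y i).2) (proj 𝒱 y.1 y.2)) := by
  rw [← ofFn_snoc, enc_ofFn]
  congr 1
  funext i
  refine Fin.lastCases ?_ (fun i => ?_) i <;> simp

theorem enc_isAddLast {n : ℕ} (F : MultilinearMap K (fun _ : Fin (n + 1) => V) V) :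
    IsAddLast (enc 𝒱 (n + 1) F) := by
  intro A a v w
  by_cases h : A.length = n
  · obtain ⟨Y, rfl⟩ := exists_ofFn h
    simp only [enc_snoc, map_add]
    rw [snoc_eq_update, F.map_update_add, Fin.update_snoc_last, Fin.update_snoc_last]
  · have h' : ∀ x : ZMod 2 × V, enc 𝒱 (n + 1) F (A ++ [x]) = 0 :=
      fun x => enc_of_length_ne 𝒱 F _ (by simpa using h)
    rw [h', h', h', add_zero]

theorem enc_mem {n : ℕ} {α : ZMod 2} {F : MultilinearMap K (fun _ : Fin n => V) V}
    (hF : F ∈ homDeg 𝒱 𝒱 n α) (L : List (ZMod 2 × V)) : enc 𝒱 n F L ∈ 𝒱 (α + lsum L) := by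
  by_cases h : L.length = n
  · obtain ⟨Y, rfl⟩ := exists_ofFn h
    rw [enc_ofFn, lsum, List.map_ofFn, List.sum_ofFn]
    exact hF _ _ fun i => proj_mem 𝒱 _ _
  · rw [enc_of_length_ne 𝒱 F _ h]
    exact zero_mem _

theorem mem_homDeg_of_enc {n : ℕ} {α : ZMod 2} {F : MultilinearMap K (fun _ : Fin n => V) V}
    (h : ∀ L, enc 𝒱 n F L ∈ 𝒱 (α + lsum L)) : F ∈ homDeg 𝒱 𝒱 n α := by
  intro p X hX
  have := h (List.ofFn fun i => (p i, X i))
  rw [enc_ofFn, lsum, List.map_ofFn, List.sum_ofFn] at this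
  simpa only [proj_of_mem 𝒱 (hX _), if_true, Function.comp_apply] using this

theorem circ_apply {n m : ℕ} (F : MultilinearMap K (fun _ : Fin (n + 1) => V) V)
    (F' : MultilinearMap K (fun _ : Fin m => V) V) :
    circ 𝒱 n m F F' = ∑ σ ∈ shuffles n m, permAct 𝒱 σ (star 𝒱 F F') := rfl

theorem star_apply_of_mem {n m : ℕ} {b : ZMod 2}
    (F : MultilinearMap K (fun _ : Fin (n + 1) => V) V)
    {F' : MultilinearMap K (fun _ : Fin m => V) V} (hF' : F' ∈ homDeg 𝒱 𝒱 m b)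
    {p : Fin (n + m) → ZMod 2} {X : Fin (n + m) → V} (hX : ∀ i, X i ∈ 𝒱 (p i)) :
    star 𝒱 F F' X = (-1 : ℤˣ) ^ (b * ∑ i : Fin n, p (Fin.castAdd m i)) •
      F (Fin.snoc (α := fun _ => V) (fun i => X (Fin.castAdd m i))
        (F' fun j => X (Fin.natAdd n j))) := by
  rw [star, sum_apply, Finset.sum_eq_single b]
  · rw [signTwist_apply_of_mem 𝒱 _ _ hX, homComp_of_mem 𝒱 𝒱 hF', if_pos rfl]
    rfl
  · intro c _ hc
    rw [signTwist_apply_of_mem 𝒱 _ _ hX, homComp_of_mem 𝒱 𝒱 hF', if_neg hc]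
    have : insertLast F (0 : MultilinearMap K (fun _ : Fin m => V) V) = 0 := by
      have := insertLast_smul_right (0 : K) F (0 : MultilinearMap K (fun _ : Fin m => V) V)
      simpa using this
    rw [this, zero_apply, smul_zero]
  · simp

theorem hasArity_lcirc {n m : ℕ} (c : ZMod 2) {Φ Ψ : List (ZMod 2 × V) → V}
    (h₁ : HasArity (n + 1) Φ) (h₁' : IsAddLast Φ) (h₂ : HasArity m Ψ) :
    HasArity (n + m) (lcirc c Φ Ψ) := by
  intro L hL
  refine unsh_eq_zero L fun A B h _ => ?_
  by_cases hB : B.length = m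
  · rw [h₁, smul_zero]
    simp only [List.length_append, List.length_cons, List.length_nil]
    omega
  · rw [h₂ B hB, h₁'.map_zero, smul_zero]

/-- The dictionary between the two pictures: the sum over shuffles that defines `circ` is the
recursive sum over splittings, so every identity for `lcirc` passes to multilinear maps. -/
theorem enc_circ {n m : ℕ} {b : ZMod 2} (F : MultilinearMap K (fun _ : Fin (n + 1) => V) V)
    {F' : MultilinearMap K (fun _ : Fin m => V) V} (hF' : F' ∈ homDeg 𝒱 𝒱 m b) :
    enc 𝒱 (n + m) (circ 𝒱 n m F F') = lcirc b (enc 𝒱 (n + 1) F) (enc 𝒱 m F') := by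
  refine funext_of_hasArity (enc_of_length_ne 𝒱 _) (hasArity_lcirc b (enc_of_length_ne 𝒱 F)
    (enc_isAddLast 𝒱 F) (enc_of_length_ne 𝒱 F')) fun Y => ?_
  rw [lcirc, ← sum_shuffles_eq_unsh, enc_ofFn, circ_apply, sum_apply]
  · refine Finset.sum_congr rfl fun σ _ => ?_
    have hX : ∀ i, proj 𝒱 (Y i).1 (Y i).2 ∈ 𝒱 (Y i).1 := fun i => proj_mem 𝒱 _ _
    rw [permAct_apply_of_mem 𝒱 _ _ hX, star_apply_of_mem 𝒱 F hF' fun i => hX (σ i),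
      enc_snoc, enc_ofFn, lsum, List.map_ofFn, List.sum_ofFn, lsum, List.map_ofFn, List.sum_ofFn]
    dsimp only
    -- Since `F'` is homogeneous of degree `b`, its value already lies in the component of its
    -- label, and the projection built into `enc` does nothing.
    rw [proj_of_mem 𝒱 (hF' _ _ fun i => hX (σ (Fin.natAdd n i)))]
    simp only [Function.comp_apply, if_true]
  · intro A B hB
    rw [enc_of_length_ne 𝒱 F' _ hB, (enc_isAddLast 𝒱 F).map_zero, smul_zero]

/-- Composition with an adjacent transposition of indices is the exchange of two neighbours in the
list; this links `superAlt` with `IsAlternating`. -/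
theorem ofFn_eq_append {α : Type*} {n : ℕ} (Y : Fin (n + 1) → α) (i : Fin n) :
    ∃ A B : List α, A.length = (i : ℕ) ∧ List.ofFn Y = A ++ Y i.castSucc :: Y i.succ :: B ∧
      (List.ofFn fun j => Y (Equiv.swap i.castSucc i.succ j)) =
        A ++ Y i.succ :: Y i.castSucc :: B := by
  induction n with
  | zero => exact i.elim0
  | succ n ih =>
    refine Fin.cases ?_ (fun i => ?_) i
    · refine ⟨[], List.ofFn fun j : Fin n => Y j.succ.succ, rfl, ?_, ?_⟩
      · rw [List.ofFn_succ, List.ofFn_succ]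
        rfl
      · rw [List.ofFn_succ, List.ofFn_succ]
        have h : ∀ j : Fin n, Equiv.swap (Fin.castSucc 0) (Fin.succ 0) j.succ.succ = j.succ.succ :=
          fun j => Equiv.swap_apply_of_ne_of_ne (Fin.succ_ne_zero _) fun h =>
            Fin.succ_ne_zero _ (Fin.succ_injective _ h)
        simp only [h, Equiv.swap_apply_right, List.nil_append]
        have h0 : Equiv.swap (Fin.castSucc 0) (Fin.succ 0) (0 : Fin (n + 2)) = Fin.succ 0 :=
          Equiv.swap_apply_left _ _
        rw [h0]
    · obtain ⟨A, B, h0, h1, h2⟩ := ih (fun j => Y j.succ) i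
      refine ⟨Y 0 :: A, B, by simp [h0], ?_, ?_⟩
      · rw [List.ofFn_succ, h1]
        rfl
      · have h0 : Equiv.swap i.succ.castSucc i.succ.succ 0 = 0 :=
          Equiv.swap_apply_of_ne_of_ne (by rw [← Fin.succ_castSucc]; exact (Fin.succ_ne_zero _).symm)
            (Fin.succ_ne_zero _).symm
        rw [List.ofFn_succ, h0]
        have h : ∀ j : Fin (n + 1), Equiv.swap i.succ.castSucc i.succ.succ j.succ =
            (Equiv.swap i.castSucc i.succ j).succ := by
          intro j
          rw [← Fin.succ_castSucc]
          exact ((Fin.succ_injective _).swap_apply _ _ _)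
        simp only [h, h2]
        rfl

theorem enc_isAlternating {n : ℕ} {F : MultilinearMap K (fun _ : Fin n => V) V}
    (hF : F ∈ superAlt V 𝒱 n) : IsAlternating (enc 𝒱 n F) := by
  intro A x y B
  by_cases h : (A ++ x :: y :: B).length = n
  swap
  · rw [enc_of_length_ne 𝒱 F _ h, enc_of_length_ne 𝒱 F _ (by simpa using h), smul_zero]
  obtain _ | n := n
  · simp at h
  obtain ⟨Y, hY⟩ := exists_ofFn h
  have hi : A.length < n := by
    simp at h; omega
  obtain ⟨A', B', h0, h1, h2⟩ := ofFn_eq_append Y ⟨A.length, hi⟩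
  obtain ⟨rfl, h3⟩ := List.append_inj (hY.trans h1) h0.symm
  simp only [List.cons.injEq] at h3
  obtain ⟨rfl, rfl, rfl⟩ := h3
  rw [← h1, ← h2, enc_ofFn, enc_ofFn]
  conv_lhs => rw [← (mem_superAlt 𝒱).1 hF (Equiv.swap (Fin.castSucc ⟨A.length, hi⟩)
    (Fin.succ ⟨A.length, hi⟩))]
  rw [permAct_apply_of_mem 𝒱 (p := fun i => (Y i).1) _ _ fun i => proj_mem 𝒱 _ _, eps_swap]

theorem mem_superAlt_of_enc {n : ℕ} {F : MultilinearMap K (fun _ : Fin (n + 1) => V) V}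
    (hF : IsAlternating (enc 𝒱 (n + 1) F)) : F ∈ superAlt V 𝒱 (n + 1) := by
  refine mem_superAlt_of_swap 𝒱 fun i => multilinear_ext 𝒱 fun p X hX => ?_
  rw [permAct_apply_of_mem 𝒱 _ _ hX, eps_swap]
  obtain ⟨A, B, -, h1, h2⟩ := ofFn_eq_append (fun j => (p j, X j)) i
  have := hF A (p i.castSucc, X i.castSucc) (p i.succ, X i.succ) B
  rw [← h1, ← h2, enc_ofFn, enc_ofFn] at this
  simpa only [proj_of_mem 𝒱 (hX _), if_true] using this.symm

theorem IsAlternating.lcirc {c : ZMod 2} {Φ Ψ : List (ZMod 2 × V) → V} (h₁ : IsAlternating Φ)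
    (h₁' : IsAddLast Φ) (h₂ : IsAlternating Ψ) : IsAlternating (lcirc c Φ Ψ) := by
  refine IsAlternating.unsh (fun B A x y C => ?_) fun A B x y C => ?_
  · rw [smul_comm, lsum_swap]
    simpa using h₁ A x y (C ++ [(c + lsum B, Ψ B)])
  · rw [smul_comm, lsum_swap, h₂ B x y C, h₁'.map_sign_smul]

theorem circ_mem_superAlt {n m : ℕ} {b : ZMod 2}
    {F : MultilinearMap K (fun _ : Fin (n + 1) => V) V}
    {F' : MultilinearMap K (fun _ : Fin (m + 1) => V) V} (hF' : F' ∈ homDeg 𝒱 𝒱 (m + 1) b)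
    (h : F ∈ superAlt V 𝒱 (n + 1)) (h' : F' ∈ superAlt V 𝒱 (m + 1)) :
    circ 𝒱 n (m + 1) F F' ∈ superAlt V 𝒱 (n + m + 1) := by
  refine mem_superAlt_of_enc 𝒱 ?_
  have : enc 𝒱 (n + m + 1) (circ 𝒱 n (m + 1) F F') = _ := enc_circ 𝒱 F hF'
  rw [this]
  exact (enc_isAlternating 𝒱 h).lcirc (enc_isAddLast 𝒱 F) (enc_isAlternating 𝒱 h')

theorem circ_mem_homDeg {n m : ℕ} {a b : ZMod 2}
    {F : MultilinearMap K (fun _ : Fin (n + 1) => V) V}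
    {F' : MultilinearMap K (fun _ : Fin m => V) V} (hF : F ∈ homDeg 𝒱 𝒱 (n + 1) a)
    (hF' : F' ∈ homDeg 𝒱 𝒱 m b) : circ 𝒱 n m F F' ∈ homDeg 𝒱 𝒱 (n + m) (a + b) := by
  refine mem_homDeg_of_enc 𝒱 fun L => ?_
  rw [enc_circ 𝒱 F hF']
  refine unsh_mem _ L fun A B _ h => ?_
  have := enc_mem 𝒱 hF (A ++ [(b + lsum B, enc 𝒱 m F' B)])
  rw [lsum_append, lsum_cons, lsum_nil, add_zero, add_left_comm (lsum A), h, ← add_assoc] at this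
  rw [Units.smul_def]
  exact zsmul_mem this _

end Encoding

/-! ### The Nijenhuis–Richardson algebra -/

section NijenhuisRichardson

variable {K V : Type*} [Field K] [AddCommGroup V] [Module K V]
variable (𝒱 : ZMod 2 → Submodule K V) [DirectSum.Decomposition 𝒱]

/-- The elements of `Multi K V` as functions of lists of labelled vectors. -/
def encM : Multi K V →ₗ[K] (List (ZMod 2 × V) → V) :=
  DirectSum.toModule K ℕ _ fun s => enc 𝒱 (s + 1)

theorem encM_incl (s : ℕ) (F : MultilinearMap K (fun _ : Fin (s + 1) => V) V) :
    encM 𝒱 (Multi.incl K V s F) = enc 𝒱 (s + 1) F := by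
  rw [encM, Multi.incl, DirectSum.toModule_lof]

theorem encM_apply (x : Multi K V) {s : ℕ} {L : List (ZMod 2 × V)} (hL : L.length = s + 1) :
    encM 𝒱 x L = enc 𝒱 (s + 1) (x s) L := by
  induction x using DirectSum.induction_on with
  | zero => simp
  | add x y hx hy => rw [map_add, Pi.add_apply, hx, hy, DirectSum.add_apply, map_add, Pi.add_apply]
  | of t F =>
    refine (congrFun (encM_incl 𝒱 t F) L).trans ?_
    by_cases h : t = s
    · subst h
      rw [DirectSum.of_eq_same]
    · rw [DirectSum.of_eq_of_ne _ _ _ (Ne.symm h), map_zero, enc_of_length_ne 𝒱 F L (by omega)]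
      rfl

/-- The summand of index `s` is recovered from the lists of length `s + 1`. Identities in `Multi K
V` can thus be checked as identities of functions, where the indices `k + l` and `l + k` need no
identification. -/
theorem encM_injective : Function.Injective (encM (K := K) 𝒱) := by
  intro x y h
  refine DirectSum.ext_component K fun s => ?_
  refine enc_injective 𝒱 (s + 1) (funext_of_hasArity (enc_of_length_ne 𝒱 _)
    (enc_of_length_ne 𝒱 _) fun Y => ?_)
  exact (encM_apply 𝒱 x (List.length_ofFn)).symm.trans
    ((congrFun h _).trans (encM_apply 𝒱 y List.length_ofFn))

/-- The graded alternating `(k + 1)`-linear maps of degree `a`. -/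
def nrDeg (k : ℕ) (a : ZMod 2) : Submodule K (Multi K V) :=
  (superAlt V 𝒱 (k + 1) ⊓ homDeg 𝒱 𝒱 (k + 1) a).map (Multi.incl K V k)

variable {𝒱}

theorem hasArity_encM {k : ℕ} {a : ZMod 2} {x : Multi K V} (hx : x ∈ nrDeg 𝒱 k a) :
    HasArity (k + 1) (encM 𝒱 x) := by
  obtain ⟨F, -, rfl⟩ := hx
  rw [encM_incl]
  exact enc_of_length_ne 𝒱 F

theorem isAddLast_encM {k : ℕ} {a : ZMod 2} {x : Multi K V} (hx : x ∈ nrDeg 𝒱 k a) :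
    IsAddLast (encM 𝒱 x) := by
  obtain ⟨F, -, rfl⟩ := hx
  rw [encM_incl]
  exact enc_isAddLast 𝒱 F

theorem isAlternating_encM {k : ℕ} {a : ZMod 2} {x : Multi K V} (hx : x ∈ nrDeg 𝒱 k a) :
    IsAlternating (encM 𝒱 x) := by
  obtain ⟨F, hF, rfl⟩ := hx
  rw [encM_incl]
  exact enc_isAlternating 𝒱 hF.1

theorem nrBracket_incl {k l : ℕ} {a b : ZMod 2}
    {F : MultilinearMap K (fun _ : Fin (k + 1) => V) V}
    {G : MultilinearMap K (fun _ : Fin (l + 1) => V) V} (hF : F ∈ homDeg 𝒱 𝒱 (k + 1) a)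
    (hG : G ∈ homDeg 𝒱 𝒱 (l + 1) b) :
    nrBracket 𝒱 (Multi.incl K V k F) (Multi.incl K V l G) =
      Multi.incl K V (k + l) (circ 𝒱 k (l + 1) F G) -
        (-1 : ℤˣ) ^ ((k * l : ZMod 2) + a * b) •
          Multi.incl K V (l + k) (circ 𝒱 l (k + 1) G F) := by
  have h : nrBracket 𝒱 (Multi.incl K V k F) (Multi.incl K V l G) =
      Multi.incl K V (k + l) (circ 𝒱 k (l + 1) F G) -
        ∑ f : ZMod 2, ∑ f' : ZMod 2, ((-1 : ℤˣ) ^ (k * l) * (-1 : ℤˣ) ^ (f * f')) •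
          Multi.incl K V (l + k) (circ 𝒱 l (k + 1)
            (homComp 𝒱 𝒱 (l + 1) f' G) (homComp 𝒱 𝒱 (k + 1) f F)) := by
    simp only [nrBracket, Multi.incl, DirectSum.toModule_lof, LinearMap.flip_apply,
      LinearMap.mk₂_apply]
  rw [h, Finset.sum_eq_single a, Finset.sum_eq_single b]
  · rw [homComp_of_mem 𝒱 𝒱 hF, homComp_of_mem 𝒱 𝒱 hG, if_pos rfl, if_pos rfl, uzpow_add,
      ← Nat.cast_mul, uzpow_natCast]
  · intro c _ hc
    rw [homComp_of_mem 𝒱 𝒱 hG, if_neg hc, map_zero, LinearMap.zero_apply, map_zero, smul_zero]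
  · simp
  · intro c _ hc
    refine Finset.sum_eq_zero fun d _ => ?_
    rw [homComp_of_mem 𝒱 𝒱 hF, if_neg hc, map_zero, map_zero, smul_zero]
  · simp

theorem circ_mem_nrDeg {k l : ℕ} {a b : ZMod 2}
    {F : MultilinearMap K (fun _ : Fin (k + 1) => V) V}
    {G : MultilinearMap K (fun _ : Fin (l + 1) => V) V}
    (hF : F ∈ superAlt V 𝒱 (k + 1) ⊓ homDeg 𝒱 𝒱 (k + 1) a)
    (hG : G ∈ superAlt V 𝒱 (l + 1) ⊓ homDeg 𝒱 𝒱 (l + 1) b) :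
    Multi.incl K V (k + l) (circ 𝒱 k (l + 1) F G) ∈ nrDeg 𝒱 (k + l) (a + b) := by
  have h₁ : circ 𝒱 k (l + 1) F G ∈ superAlt V 𝒱 (k + l + 1) :=
    circ_mem_superAlt 𝒱 hG.2 hF.1 hG.1
  have h₂ : circ 𝒱 k (l + 1) F G ∈ homDeg 𝒱 𝒱 (k + l + 1) (a + b) :=
    circ_mem_homDeg (n := k) (m := l + 1) 𝒱 hF.2 hG.2
  exact Submodule.mem_map_of_mem (Submodule.mem_inf.2 ⟨h₁, h₂⟩)

theorem nrBracket_mem {k l : ℕ} {a b : ZMod 2} {x y : Multi K V} (hx : x ∈ nrDeg 𝒱 k a)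
    (hy : y ∈ nrDeg 𝒱 l b) : nrBracket 𝒱 x y ∈ nrDeg 𝒱 (k + l) (a + b) := by
  obtain ⟨F, hF, rfl⟩ := hx
  obtain ⟨G, hG, rfl⟩ := hy
  rw [nrBracket_incl hF.2 hG.2, Units.smul_def]
  refine sub_mem (circ_mem_nrDeg hF hG) (zsmul_mem ?_ _)
  rw [add_comm k l, add_comm a b]
  exact circ_mem_nrDeg hG hF

theorem encM_nrBracket {k l : ℕ} {a b : ZMod 2} {x y : Multi K V} (hx : x ∈ nrDeg 𝒱 k a)
    (hy : y ∈ nrDeg 𝒱 l b) :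
    encM 𝒱 (nrBracket 𝒱 x y) = lbr k l a b (encM 𝒱 x) (encM 𝒱 y) := by
  obtain ⟨F, hF, rfl⟩ := hx
  obtain ⟨G, hG, rfl⟩ := hy
  rw [nrBracket_incl hF.2 hG.2, map_sub, Units.smul_def, map_zsmul]
  simp only [encM_incl]
  exact congrArg₂ _ (enc_circ 𝒱 F hG.2) (congrArg _ (enc_circ 𝒱 G hF.2))

theorem nrBracket_skew {k l : ℕ} {a b : ZMod 2} {x y : Multi K V} (hx : x ∈ nrDeg 𝒱 k a)
    (hy : y ∈ nrDeg 𝒱 l b) :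
    nrBracket 𝒱 x y = -((-1 : ℤˣ) ^ ((k * l : ZMod 2) + a * b) • nrBracket 𝒱 y x) := by
  refine encM_injective 𝒱 ?_
  rw [map_neg, Units.smul_def, map_zsmul, encM_nrBracket hx hy, encM_nrBracket hy hx]
  exact lbr_skew _ _ _ _ _ _

theorem nrBracket_jacobi {k l m : ℕ} {a b c : ZMod 2} {x y z : Multi K V}
    (hx : x ∈ nrDeg 𝒱 k a) (hy : y ∈ nrDeg 𝒱 l b) (hz : z ∈ nrDeg 𝒱 m c) :
    nrBracket 𝒱 x (nrBracket 𝒱 y z) = nrBracket 𝒱 (nrBracket 𝒱 x y) z +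
      (-1 : ℤˣ) ^ ((k * l : ZMod 2) + a * b) • nrBracket 𝒱 y (nrBracket 𝒱 x z) := by
  refine encM_injective 𝒱 ?_
  rw [map_add, Units.smul_def, map_zsmul, encM_nrBracket hx (nrBracket_mem hy hz),
    encM_nrBracket (nrBracket_mem hx hy) hz, encM_nrBracket hy (nrBracket_mem hx hz),
    encM_nrBracket hx hy, encM_nrBracket hx hz, encM_nrBracket hy hz]
  push_cast
  exact lbr_jacobi a b c (hasArity_encM hx) (hasArity_encM hy) (hasArity_encM hz)
    (isAddLast_encM hx) (isAddLast_encM hy) (isAddLast_encM hz)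
    (isAlternating_encM hx) (isAlternating_encM hy) (isAlternating_encM hz)

theorem nrBracket_nrBracket_self {k : ℕ} {a : ZMod 2} {θ x : Multi K V} (hθ : θ ∈ nrDeg 𝒱 1 0)
    (hx : x ∈ nrDeg 𝒱 k a) (h : lcirc 0 (encM 𝒱 θ) (encM 𝒱 θ) = 0) :
    nrBracket 𝒱 θ (nrBracket 𝒱 θ x) = 0 := by
  refine encM_injective 𝒱 ?_
  rw [encM_nrBracket hθ (nrBracket_mem hθ hx), encM_nrBracket hθ hx, map_zero]
  have := lbr_lbr_self a (hasArity_encM hθ) (hasArity_encM hx) (isAddLast_encM hθ)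
    (isAddLast_encM hx) (isAlternating_encM hθ) (isAlternating_encM hx) h
  push_cast
  exact this

end NijenhuisRichardson

/-! ### Bilinear maps -/

section Bilinear

variable {K V : Type*} [Field K] [AddCommGroup V] [Module K V]
variable {𝒱 : ZMod 2 → Submodule K V} [DirectSum.Decomposition 𝒱]

theorem ofBilin_add (B C : V →ₗ[K] V →ₗ[K] V) : ofBilin (B + C) = ofBilin B + ofBilin C := by
  rw [ofBilin, ofBilin, ofBilin, ← map_add]
  rfl

theorem ofBilin_zero : ofBilin (0 : V →ₗ[K] V →ₗ[K] V) = 0 := by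
  have h := ofBilin_add (0 : V →ₗ[K] V →ₗ[K] V) 0
  rwa [add_zero, left_eq_add] at h

theorem encM_ofBilin (B : V →ₗ[K] V →ₗ[K] V) (x y : ZMod 2 × V) :
    encM 𝒱 (ofBilin B) [x, y] = B (proj 𝒱 x.1 x.2) (proj 𝒱 y.1 y.2) := by
  rw [ofBilin, encM_incl]
  exact enc_ofFn 𝒱 _ ![x, y]

theorem hasArity_ofBilin (B : V →ₗ[K] V →ₗ[K] V) : HasArity 2 (encM 𝒱 (ofBilin B)) := by
  rw [ofBilin, encM_incl]
  exact enc_of_length_ne 𝒱 _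

theorem ofBilin_mem_nrDeg {B : V →ₗ[K] V →ₗ[K] V}
    (h₁ : ∀ α β a b, a ∈ 𝒱 α → b ∈ 𝒱 β → B a b ∈ 𝒱 (α + β))
    (h₂ : ∀ α β a b, a ∈ 𝒱 α → b ∈ 𝒱 β → B a b = -((-1 : ℤˣ) ^ (α * β) • B b a)) :
    ofBilin B ∈ nrDeg 𝒱 1 0 := by
  refine ⟨_, ⟨?_, ?_⟩, rfl⟩
  · refine mem_superAlt_of_enc 𝒱 ?_
    rw [← encM_incl]
    intro A x y C
    change encM 𝒱 (ofBilin B) _ = _ • encM 𝒱 (ofBilin B) _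
    by_cases h : (A ++ x :: y :: C).length = 2
    · have h' : A.length + (C.length + 2) = 2 := by simpa using h
      obtain rfl : A = [] := List.length_eq_zero_iff.1 (by omega)
      obtain rfl : C = [] := List.length_eq_zero_iff.1 (by omega)
      rw [List.nil_append, List.nil_append, encM_ofBilin, encM_ofBilin,
        h₂ x.1 y.1 _ _ (proj_mem 𝒱 _ _) (proj_mem 𝒱 _ _), neg_eq_sign_smul, smul_smul,
        ← uzpow_add]
    · rw [hasArity_ofBilin B _ h, hasArity_ofBilin B _ (by simpa using h), smul_zero]
  · intro p X hX
    have := h₁ (p 0) (p 1) (X 0) (X 1) (hX 0) (hX 1)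
    rw [zero_add, Fin.sum_univ_two]
    exact this

/-- On a triple only the three splittings with two entries in the second list survive, and their
signed sum is the Jacobi identity, after skew-symmetry turns `B (B a b) c` into a multiple of `B c
(B a b)`. -/
theorem lcirc_ofBilin_self {B : V →ₗ[K] V →ₗ[K] V}
    (h₁ : ∀ α β a b, a ∈ 𝒱 α → b ∈ 𝒱 β → B a b ∈ 𝒱 (α + β))
    (h₂ : ∀ α β a b, a ∈ 𝒱 α → b ∈ 𝒱 β → B a b = -((-1 : ℤˣ) ^ (α * β) • B b a))
    (h₃ : ∀ α β γ a b c, a ∈ 𝒱 α → b ∈ 𝒱 β → c ∈ 𝒱 γ →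
      B a (B b c) = B (B a b) c + (-1 : ℤˣ) ^ (α * β) • B b (B a c)) :
    lcirc 0 (encM 𝒱 (ofBilin B)) (encM 𝒱 (ofBilin B)) = 0 := by
  have hB := ofBilin_mem_nrDeg h₁ h₂
  refine funext_of_hasArity (n := 3) (hasArity_lcirc (n := 1) (m := 2) 0 (hasArity_ofBilin B)
    (isAddLast_encM hB) (hasArity_ofBilin B)) (fun _ _ => rfl) fun Y => ?_
  have hY : List.ofFn Y = [Y 0, Y 1, Y 2] := by
    simp [List.ofFn_succ]
  rw [hY]
  generalize Y 0 = x
  generalize Y 1 = y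
  generalize Y 2 = z
  have e : ∀ L : List (ZMod 2 × V), L.length ≠ 2 → encM 𝒱 (ofBilin B) L = 0 :=
    hasArity_ofBilin B
  have e0 : encM 𝒱 (ofBilin B) [] = 0 := e _ (by simp)
  have e1 : ∀ x, encM 𝒱 (ofBilin B) [x] = 0 := fun x => e _ (by simp)
  have e3 : ∀ x y z, encM 𝒱 (ofBilin B) [x, y, z] = 0 := fun x y z => e _ (by simp)
  have e4 : ∀ x y z w, encM 𝒱 (ofBilin B) [x, y, z, w] = 0 := fun x y z w => e _ (by simp)
  simp only [lcirc, unsh, List.nil_append, List.cons_append, e0, e1, e3, e4, encM_ofBilin]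
  have hx : proj 𝒱 x.1 x.2 ∈ 𝒱 x.1 := proj_mem 𝒱 _ _
  have hy : proj 𝒱 y.1 y.2 ∈ 𝒱 y.1 := proj_mem 𝒱 _ _
  have hz : proj 𝒱 z.1 z.2 ∈ 𝒱 z.1 := proj_mem 𝒱 _ _
  simp only [lsum_cons, lsum_nil, add_zero, zero_add, zero_mul, uzpow_zero, one_smul, llen_nil,
    llen_cons, mul_zero, smul_zero, proj_of_mem 𝒱 (h₁ _ _ _ _ hx hy), if_true,
    proj_of_mem 𝒱 (h₁ _ _ _ _ hx hz), proj_of_mem 𝒱 (h₁ _ _ _ _ hy hz), Pi.zero_apply]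
  rw [h₃ _ _ _ _ _ _ hx hy hz, h₂ _ _ _ _ (h₁ _ _ _ _ hx hy) hz, add_mul]
  simp only [uzpow_add, uzpow_one, mul_smul, neg_one_sign_smul]
  generalize (-1 : ℤˣ) ^ (x.1 * y.1) = u
  generalize (-1 : ℤˣ) ^ (x.1 * z.1) = v
  generalize (-1 : ℤˣ) ^ (y.1 * z.1) = w
  rcases Int.units_eq_one_or u with rfl | rfl <;> rcases Int.units_eq_one_or v with rfl | rfl <;>
    rcases Int.units_eq_one_or w with rfl | rfl <;>
    simp only [one_smul, neg_one_sign_smul, neg_neg] <;> abel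

end Bilinear

/-! ### The semidirect product -/

section Semidirect

variable {K 𝔤 𝔥 : Type*} [Field K] [AddCommGroup 𝔤] [Module K 𝔤] [AddCommGroup 𝔥] [Module K 𝔥]
variable {𝒢 : ZMod 2 → Submodule K 𝔤} {ℋ : ZMod 2 → Submodule K 𝔥}

variable {π : 𝔤 →ₗ[K] 𝔤 →ₗ[K] 𝔤} {μ : 𝔥 →ₗ[K] 𝔥 →ₗ[K] 𝔥} {ρ : 𝔤 →ₗ[K] 𝔥 →ₗ[K] 𝔥}

theorem isLieSuperalgebra_zero : IsLieSuperalgebra 𝒢 0 where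
  bracket_mem _ _ _ _ _ _ := zero_mem _
  skew _ _ _ _ _ _ := by simp
  jacobi _ _ _ _ _ _ _ := by simp

theorem IsAction.of_abelian (hρ : IsAction 𝒢 ℋ π μ ρ) : IsAction 𝒢 ℋ π 0 ρ where
  derivation α x hx :=
    { map_mem := (hρ.derivation α x hx).map_mem
      leibniz _ _ _ _ := by simp }
  map_bracket := hρ.map_bracket

theorem isAction_zero : IsAction 𝒢 ℋ (0 : 𝔤 →ₗ[K] 𝔤 →ₗ[K] 𝔤) μ 0 where
  derivation _ _ _ :=
    { map_mem _ _ _ := zero_mem _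
      leibniz _ _ _ _ := by simp }
  map_bracket _ _ _ _ _ _ := by simp

variable [DirectSum.Decomposition 𝒢] [DirectSum.Decomposition ℋ]

theorem proj_prodGrading (α : ZMod 2) (z : 𝔤 × 𝔥) :
    proj (prodGrading 𝒢 ℋ) α z = (proj 𝒢 α z.1, proj ℋ α z.2) := by
  have e : z = ∑ β, (proj 𝒢 β z.1, proj ℋ β z.2) := by
    ext
    · rw [Prod.fst_sum]
      exact (sum_proj 𝒢 z.1).symm
    · rw [Prod.snd_sum]
      exact (sum_proj ℋ z.2).symm
  conv_lhs => rw [e, map_sum]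
  have h : ∀ β, (proj 𝒢 β z.1, proj ℋ β z.2) ∈ prodGrading 𝒢 ℋ β :=
    fun β => ⟨proj_mem 𝒢 β _, proj_mem ℋ β _⟩
  simp only [proj_of_mem _ (h _)]
  simp

variable (𝒢 ℋ) in
/-- The bracket of the semidirect product on `𝔤 ⊕ 𝔥`. -/
def semidirect (π : 𝔤 →ₗ[K] 𝔤 →ₗ[K] 𝔤) (μ : 𝔥 →ₗ[K] 𝔥 →ₗ[K] 𝔥) (ρ : 𝔤 →ₗ[K] 𝔥 →ₗ[K] 𝔥) :
    (𝔤 × 𝔥) →ₗ[K] (𝔤 × 𝔥) →ₗ[K] (𝔤 × 𝔥) :=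
  (π.compl₁₂ (LinearMap.fst K 𝔤 𝔥) (LinearMap.fst K 𝔤 𝔥)).compr₂ (LinearMap.inl K 𝔤 𝔥) +
  (ρ.compl₁₂ (LinearMap.fst K 𝔤 𝔥) (LinearMap.snd K 𝔤 𝔥) -
    ∑ α : ZMod 2, ∑ β : ZMod 2, (-1 : ℤˣ) ^ (α * β) •
      (ρ.compl₁₂ (proj 𝒢 β ∘ₗ LinearMap.fst K 𝔤 𝔥) (proj ℋ α ∘ₗ LinearMap.snd K 𝔤 𝔥)).flip).compr₂
        (LinearMap.inr K 𝔤 𝔥) +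
  (μ.compl₁₂ (LinearMap.snd K 𝔤 𝔥) (LinearMap.snd K 𝔤 𝔥)).compr₂ (LinearMap.inr K 𝔤 𝔥)

theorem ofBilin_semidirect (π : 𝔤 →ₗ[K] 𝔤 →ₗ[K] 𝔤) (μ : 𝔥 →ₗ[K] 𝔥 →ₗ[K] 𝔥)
    (ρ : 𝔤 →ₗ[K] 𝔥 →ₗ[K] 𝔥) :
    ofBilin (semidirect 𝒢 ℋ π μ ρ) = hatPi 𝔥 π + hatRho 𝒢 ℋ ρ + hatMu 𝔤 μ := by
  rw [semidirect, ofBilin_add, ofBilin_add]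
  rfl

theorem hatPi_zero : hatPi 𝔥 (0 : 𝔤 →ₗ[K] 𝔤 →ₗ[K] 𝔤) = 0 := by
  refine (congrArg ofBilin ?_).trans ofBilin_zero
  ext <;> simp

theorem hatMu_zero : hatMu 𝔤 (0 : 𝔥 →ₗ[K] 𝔥 →ₗ[K] 𝔥) = 0 := by
  refine (congrArg ofBilin ?_).trans ofBilin_zero
  ext <;> simp

theorem hatRho_zero : hatRho 𝒢 ℋ (0 : 𝔤 →ₗ[K] 𝔥 →ₗ[K] 𝔥) = 0 := by
  refine (congrArg ofBilin ?_).trans ofBilin_zero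
  ext <;> simp

theorem semidirect_apply (π : 𝔤 →ₗ[K] 𝔤 →ₗ[K] 𝔤) (μ : 𝔥 →ₗ[K] 𝔥 →ₗ[K] 𝔥)
    (ρ : 𝔤 →ₗ[K] 𝔥 →ₗ[K] 𝔥) {α β : ZMod 2} {x y : 𝔤 × 𝔥} (hx : x ∈ prodGrading 𝒢 ℋ α)
    (hy : y ∈ prodGrading 𝒢 ℋ β) : semidirect 𝒢 ℋ π μ ρ x y =
      (π x.1 y.1, ρ x.1 y.2 - (-1 : ℤˣ) ^ (α * β) • ρ y.1 x.2 + μ x.2 y.2) := by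
  have h : (∑ a : ZMod 2, ∑ b : ZMod 2, (-1 : ℤˣ) ^ (a * b) •
      (ρ.compl₁₂ (proj 𝒢 b ∘ₗ LinearMap.fst K 𝔤 𝔥) (proj ℋ a ∘ₗ LinearMap.snd K 𝔤 𝔥)).flip) x y =
      (-1 : ℤˣ) ^ (α * β) • ρ y.1 x.2 := by
    simp only [LinearMap.sum_apply]
    rw [Finset.sum_eq_single α, Finset.sum_eq_single β]
    · simp [proj_of_mem 𝒢 hy.1, proj_of_mem ℋ hx.2]
    · intro b _ hb
      simp [proj_of_mem 𝒢 hy.1, hb]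
    · simp
    · intro b _ hb
      simp [proj_of_mem ℋ hx.2, hb]
    · simp
  simp only [semidirect, LinearMap.add_apply, LinearMap.compr₂_apply, LinearMap.sub_apply, h]
  ext <;> simp

theorem semidirect_mem (hπ : IsLieSuperalgebra 𝒢 π) (hμ : IsLieSuperalgebra ℋ μ)
    (hρ : IsAction 𝒢 ℋ π μ ρ) (α β : ZMod 2) (x y : 𝔤 × 𝔥) (hx : x ∈ prodGrading 𝒢 ℋ α)
    (hy : y ∈ prodGrading 𝒢 ℋ β) :
    semidirect 𝒢 ℋ π μ ρ x y ∈ prodGrading 𝒢 ℋ (α + β) := by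
  rw [semidirect_apply π μ ρ hx hy, Units.smul_def]
  refine ⟨hπ.bracket_mem _ _ _ _ hx.1 hy.1, add_mem (sub_mem ?_ (zsmul_mem ?_ _)) ?_⟩
  · exact (hρ.derivation _ _ hx.1).map_mem _ _ hy.2
  · rw [add_comm]
    exact (hρ.derivation _ _ hy.1).map_mem _ _ hx.2
  · exact hμ.bracket_mem _ _ _ _ hx.2 hy.2

theorem semidirect_skew (hπ : IsLieSuperalgebra 𝒢 π) (hμ : IsLieSuperalgebra ℋ μ)
    (α β : ZMod 2) (x y : 𝔤 × 𝔥) (hx : x ∈ prodGrading 𝒢 ℋ α) (hy : y ∈ prodGrading 𝒢 ℋ β) :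
    semidirect 𝒢 ℋ π μ ρ x y = -((-1 : ℤˣ) ^ (α * β) • semidirect 𝒢 ℋ π μ ρ y x) := by
  rw [semidirect_apply π μ ρ hx hy, semidirect_apply π μ ρ hy hx, mul_comm β α]
  refine Prod.ext (hπ.skew _ _ _ _ hx.1 hy.1) ?_
  dsimp only [Prod.snd_neg, Prod.smul_snd]
  rw [hμ.skew _ _ _ _ hx.2 hy.2]
  generalize (-1 : ℤˣ) ^ (α * β) = u
  rcases Int.units_eq_one_or u with rfl | rfl <;>
    simp only [one_smul, neg_one_sign_smul, neg_neg] <;> abel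

/-- In the component `𝔥`, the terms with one argument from `𝔥` cancel because `ρ` preserves
brackets, those with two because `ρ` acts by derivations, and those with three by the Jacobi
identity of `μ`. -/
theorem semidirect_jacobi (hπ : IsLieSuperalgebra 𝒢 π) (hμ : IsLieSuperalgebra ℋ μ)
    (hρ : IsAction 𝒢 ℋ π μ ρ) (α β γ : ZMod 2) (x y z : 𝔤 × 𝔥) (hx : x ∈ prodGrading 𝒢 ℋ α)
    (hy : y ∈ prodGrading 𝒢 ℋ β) (hz : z ∈ prodGrading 𝒢 ℋ γ) :
    semidirect 𝒢 ℋ π μ ρ x (semidirect 𝒢 ℋ π μ ρ y z) =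
      semidirect 𝒢 ℋ π μ ρ (semidirect 𝒢 ℋ π μ ρ x y) z +
        (-1 : ℤˣ) ^ (α * β) • semidirect 𝒢 ℋ π μ ρ y (semidirect 𝒢 ℋ π μ ρ x z) := by
  rw [semidirect_apply π μ ρ hx (semidirect_mem hπ hμ hρ _ _ _ _ hy hz),
    semidirect_apply π μ ρ hy (semidirect_mem hπ hμ hρ _ _ _ _ hx hz),
    semidirect_apply π μ ρ (semidirect_mem hπ hμ hρ _ _ _ _ hx hy) hz,
    semidirect_apply π μ ρ hx hy, semidirect_apply π μ ρ hx hz, semidirect_apply π μ ρ hy hz]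
  refine Prod.ext (hπ.jacobi _ _ _ _ _ hx.1 hy.1) ?_
  obtain ⟨x, u⟩ := x
  obtain ⟨y, v⟩ := y
  obtain ⟨z, w⟩ := z
  obtain ⟨hx, hu⟩ := hx
  obtain ⟨hy, hv⟩ := hy
  obtain ⟨hz, hw⟩ := hz
  dsimp only [Prod.snd_add, Prod.smul_snd] at *
  have hs : ∀ (s : ℤˣ) (a b : 𝔥), μ a (s • b) = s • μ a b := fun s a b => by
    rw [Units.smul_def, Units.smul_def, map_zsmul]
  have hs' : ∀ (s : ℤˣ) (a b : 𝔥), μ (s • a) b = s • μ a b := fun s a b => by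
    rw [Units.smul_def, Units.smul_def, map_zsmul]; rfl
  have ht : ∀ (s : ℤˣ) (a : 𝔤) (b : 𝔥), ρ a (s • b) = s • ρ a b := fun s a b => by
    rw [Units.smul_def, Units.smul_def, map_zsmul]
  -- The right side contains `μ v (ρ z u)` and, through the Leibniz rule for `ρ z`, also `μ (ρ z u)
  -- v`; both are brought to one order.
  have e1 := hμ.skew _ _ _ _ hv ((hρ.derivation _ _ hz).map_mem _ _ hu)
  simp only [map_add, map_sub, LinearMap.add_apply, LinearMap.sub_apply, hs, hs', ht,
    hρ.map_bracket _ _ _ _ hx hy, hρ.map_bracket _ _ _ _ hx hz, hρ.map_bracket _ _ _ _ hy hz,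
    LinearMap.smul_apply, LinearMap.comp_apply,
    (hρ.derivation _ _ hx).leibniz _ _ w hv, (hρ.derivation _ _ hy).leibniz _ _ w hu,
    (hρ.derivation _ _ hz).leibniz _ _ v hu, e1, hμ.jacobi _ _ _ _ w hu hv]
  simp only [mul_add, add_mul, uzpow_add, mul_comm β α, mul_comm γ α]
  generalize (-1 : ℤˣ) ^ (α * β) = s
  generalize (-1 : ℤˣ) ^ (α * γ) = t
  generalize (-1 : ℤˣ) ^ (β * γ) = r
  rcases Int.units_eq_one_or s with rfl | rfl <;> rcases Int.units_eq_one_or t with rfl | rfl <;>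
    rcases Int.units_eq_one_or r with rfl | rfl <;>
    simp only [one_smul, neg_one_sign_smul, neg_neg, mul_one, mul_neg, neg_sub, sub_neg_eq_add] <;>
    abel

theorem semidirect_lcirc_self (hπ : IsLieSuperalgebra 𝒢 π) (hμ : IsLieSuperalgebra ℋ μ)
    (hρ : IsAction 𝒢 ℋ π μ ρ) :
    lcirc 0 (encM (prodGrading 𝒢 ℋ) (hatPi 𝔥 π + hatRho 𝒢 ℋ ρ + hatMu 𝔤 μ))
      (encM (prodGrading 𝒢 ℋ) (hatPi 𝔥 π + hatRho 𝒢 ℋ ρ + hatMu 𝔤 μ)) = 0 := by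
  rw [← ofBilin_semidirect]
  exact lcirc_ofBilin_self (semidirect_mem hπ hμ hρ) (semidirect_skew hπ hμ)
    (semidirect_jacobi hπ hμ hρ)

theorem semidirect_mem_nrDeg (hπ : IsLieSuperalgebra 𝒢 π) (hμ : IsLieSuperalgebra ℋ μ)
    (hρ : IsAction 𝒢 ℋ π μ ρ) :
    hatPi 𝔥 π + hatRho 𝒢 ℋ ρ + hatMu 𝔤 μ ∈ nrDeg (prodGrading 𝒢 ℋ) 1 0 := by
  rw [← ofBilin_semidirect]
  exact ofBilin_mem_nrDeg (semidirect_mem hπ hμ hρ) (semidirect_skew hπ hμ)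

theorem hatPi_add_hatRho_mem (hπ : IsLieSuperalgebra 𝒢 π) (hρ : IsAction 𝒢 ℋ π μ ρ) :
    hatPi 𝔥 π + hatRho 𝒢 ℋ ρ ∈ nrDeg (prodGrading 𝒢 ℋ) 1 0 := by
  simpa [hatMu_zero] using semidirect_mem_nrDeg hπ isLieSuperalgebra_zero hρ.of_abelian

theorem hatMu_mem (hμ : IsLieSuperalgebra ℋ μ) :
    hatMu 𝔤 μ ∈ nrDeg (prodGrading 𝒢 ℋ) 1 0 := by
  simpa [hatPi_zero, hatRho_zero] using
    semidirect_mem_nrDeg (𝒢 := 𝒢) isLieSuperalgebra_zero hμ isAction_zero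

theorem hatPi_add_hatRho_lcirc_self (hπ : IsLieSuperalgebra 𝒢 π) (hρ : IsAction 𝒢 ℋ π μ ρ) :
    lcirc 0 (encM (prodGrading 𝒢 ℋ) (hatPi 𝔥 π + hatRho 𝒢 ℋ ρ))
      (encM (prodGrading 𝒢 ℋ) (hatPi 𝔥 π + hatRho 𝒢 ℋ ρ)) = 0 := by
  simpa [hatMu_zero] using semidirect_lcirc_self hπ isLieSuperalgebra_zero hρ.of_abelian

theorem hatMu_lcirc_self (hμ : IsLieSuperalgebra ℋ μ) :
    lcirc 0 (encM (prodGrading 𝒢 ℋ) (hatMu 𝔤 μ)) (encM (prodGrading 𝒢 ℋ) (hatMu 𝔤 μ)) = 0 := by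
  simpa [hatPi_zero, hatRho_zero] using
    semidirect_lcirc_self (𝒢 := 𝒢) isLieSuperalgebra_zero hμ isAction_zero

/-- Expand the square of `π + ρ + μ`. The squares of `π + ρ` and of `μ` vanish, and the mixed terms
are the bracket, since for two elements of degree `(1, 0)` its sign is `+`. -/
theorem nrBracket_hatPi_add_hatRho_hatMu (hπ : IsLieSuperalgebra 𝒢 π)
    (hμ : IsLieSuperalgebra ℋ μ) (hρ : IsAction 𝒢 ℋ π μ ρ) :
    nrBracket (prodGrading 𝒢 ℋ) (hatPi 𝔥 π + hatRho 𝒢 ℋ ρ) (hatMu 𝔤 μ) = 0 := by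
  have h₁ := hatPi_add_hatRho_mem hπ hρ
  have h₂ : hatMu 𝔤 μ ∈ nrDeg (prodGrading 𝒢 ℋ) 1 0 := hatMu_mem hμ
  have h := semidirect_lcirc_self hπ hμ hρ
  rw [map_add, lcirc_add_left, lcirc_add_right _ (isAddLast_encM h₁),
    lcirc_add_right _ (isAddLast_encM h₂), hatPi_add_hatRho_lcirc_self hπ hρ,
    hatMu_lcirc_self hμ, zero_add, add_zero] at h
  refine encM_injective (prodGrading 𝒢 ℋ) ?_
  rw [encM_nrBracket h₁ h₂, map_zero, ← h, lbr]
  simp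

end Semidirect

/-! ### Weights on `𝔤 ⊕ 𝔥` -/

section Weights

variable {𝔤 𝔥 : Type*} [AddCommGroup 𝔤] [AddCommGroup 𝔥]

variable (𝔤 𝔥) in
/-- The part of weight `w` of `𝔤 ⊕ 𝔥`, where `𝔤` has weight `0` and `𝔥` has weight `1`. -/
def weightPart (w : ℤ) : AddSubgroup (𝔤 × 𝔥) :=
  AddSubgroup.prod (if w = 0 then ⊤ else ⊥) (if w = 1 then ⊤ else ⊥)

theorem mem_weightPart {w : ℤ} {z : 𝔤 × 𝔥} :
    z ∈ weightPart 𝔤 𝔥 w ↔ (w ≠ 0 → z.1 = 0) ∧ (w ≠ 1 → z.2 = 0) := by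
  rw [weightPart, AddSubgroup.mem_prod]
  refine and_congr ?_ ?_ <;> split_ifs with h <;> simp [h]

/-- The entries of the list have weights of sum `w`. -/
inductive ListWeight : List (ZMod 2 × (𝔤 × 𝔥)) → ℤ → Prop
  | nil : ListWeight [] 0
  | cons {y : ZMod 2 × (𝔤 × 𝔥)} {L : List (ZMod 2 × (𝔤 × 𝔥))} {v w : ℤ} :
      y.2 ∈ weightPart 𝔤 𝔥 v → ListWeight L w → ListWeight (y :: L) (v + w)

/-- The function raises the weights by `w`. -/
def HasWeight (w : ℤ) (Φ : List (ZMod 2 × (𝔤 × 𝔥)) → 𝔤 × 𝔥) : Prop :=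
  ∀ L q, ListWeight L q → Φ L ∈ weightPart 𝔤 𝔥 (w + q)

theorem ListWeight.concat {L : List (ZMod 2 × (𝔤 × 𝔥))} {w v : ℤ} (h : ListWeight L w)
    {y : ZMod 2 × (𝔤 × 𝔥)} (hy : y.2 ∈ weightPart 𝔤 𝔥 v) : ListWeight (L ++ [y]) (w + v) := by
  induction h with
  | nil =>
    rw [add_comm]
    exact .cons hy .nil
  | cons h _ ih =>
    rw [add_assoc]
    exact .cons h ih

theorem ListWeight.ofFn {n : ℕ} {Y : Fin n → ZMod 2 × (𝔤 × 𝔥)} {w : Fin n → ℤ}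
    (h : ∀ i, (Y i).2 ∈ weightPart 𝔤 𝔥 (w i)) : ListWeight (List.ofFn Y) (∑ i, w i) := by
  induction n with
  | zero => exact .nil
  | succ n ih =>
    rw [List.ofFn_succ, Fin.sum_univ_succ]
    exact .cons (h 0) (ih fun i => h i.succ)

/-- A vector may have several weights, as zero has all of them, so the total weight is not a
function of the list. What is needed is only that a nonzero total forces an entry without `𝔤`-part.
-/
theorem ListWeight.eq_zero_or {L : List (ZMod 2 × (𝔤 × 𝔥))} {w : ℤ} (h : ListWeight L w) :
    w = 0 ∨ ∃ y ∈ L, y.2.1 = 0 := by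
  induction h with
  | nil => exact .inl rfl
  | @cons y L v w hy _ ih =>
    by_cases hv : v = 0
    · rcases ih with h | ⟨z, hz, h⟩
      · exact .inl (by rw [hv, h, add_zero])
      · exact .inr ⟨z, List.mem_cons_of_mem _ hz, h⟩
    · exact .inr ⟨y, List.mem_cons_self, (mem_weightPart.1 hy).1 hv⟩

theorem ListWeight.unsh_mem {M : Type*} [AddCommGroup M] (N : AddSubgroup M)
    {φ : List (ZMod 2 × (𝔤 × 𝔥)) → List (ZMod 2 × (𝔤 × 𝔥)) → M} {L : List (ZMod 2 × (𝔤 × 𝔥))}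
    {w : ℤ} (hL : ListWeight L w)
    (h : ∀ A B a b, ListWeight A a → ListWeight B b → a + b = w → φ A B ∈ N) :
    unsh φ L ∈ N := by
  induction hL generalizing φ with
  | nil => exact h _ _ 0 0 .nil .nil (add_zero 0)
  | cons hy _ ih =>
    refine add_mem (ih fun A B a b hA hB e => h _ _ _ _ (.cons hy hA) hB ?_)
      (ih fun A B a b hA hB e => ?_)
    · rw [← e, add_assoc]
    · rw [Units.smul_def]
      refine zsmul_mem (h _ _ _ _ hA (.cons hy hB) ?_) _
      rw [← e, add_left_comm]

theorem HasWeight.lcirc {v w : ℤ} {Φ Ψ : List (ZMod 2 × (𝔤 × 𝔥)) → 𝔤 × 𝔥} (c : ZMod 2)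
    (hΦ : HasWeight v Φ) (hΨ : HasWeight w Ψ) : HasWeight (v + w) (lcirc c Φ Ψ) := by
  intro L q hL
  refine hL.unsh_mem _ fun A B a b hA hB e => ?_
  rw [Units.smul_def]
  refine zsmul_mem ?_ _
  have := hΦ _ _ (hA.concat (y := (c + lsum B, Ψ B)) (hΨ B b hB))
  rwa [show v + (a + (w + b)) = v + w + q by rw [← e]; ring] at this

theorem HasWeight.lbr {v w : ℤ} {Φ Ψ : List (ZMod 2 × (𝔤 × 𝔥)) → 𝔤 × 𝔥} (n n' c c' : ZMod 2)
    (hΦ : HasWeight v Φ) (hΨ : HasWeight w Ψ) : HasWeight (v + w) (lbr n n' c c' Φ Ψ) := by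
  intro L q hL
  refine sub_mem (hΦ.lcirc c' hΨ L q hL) ?_
  rw [Pi.smul_apply, Units.smul_def]
  refine zsmul_mem ?_ _
  rw [add_comm v w]
  exact hΨ.lcirc c hΦ L q hL

end Weights

/-! ### The cochains as the maps of weight one -/

section HatImage

variable {K 𝔤 𝔥 : Type*} [Field K] [AddCommGroup 𝔤] [Module K 𝔤] [AddCommGroup 𝔥] [Module K 𝔥]
variable {𝒢 : ZMod 2 → Submodule K 𝔤} {ℋ : ZMod 2 → Submodule K 𝔥}
/-- The map `((x₁, u₁), …, (xₙ, uₙ)) ↦ (0, f(x₁, …, xₙ))`. -/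
def hatMap {n : ℕ} (f : MultilinearMap K (fun _ : Fin n => 𝔤) 𝔥) :
    MultilinearMap K (fun _ : Fin n => 𝔤 × 𝔥) (𝔤 × 𝔥) :=
  (LinearMap.inr K 𝔤 𝔥).compMultilinearMap (f.compLinearMap fun _ => LinearMap.fst K 𝔤 𝔥)

/-- The map `(x₁, …, xₙ) ↦ F((x₁, 0), …, (xₙ, 0))`, projected onto `𝔥`. -/
def unhatMap {n : ℕ} (F : MultilinearMap K (fun _ : Fin n => 𝔤 × 𝔥) (𝔤 × 𝔥)) :
    MultilinearMap K (fun _ : Fin n => 𝔤) 𝔥 :=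
  (LinearMap.snd K 𝔤 𝔥).compMultilinearMap (F.compLinearMap fun _ => LinearMap.inl K 𝔤 𝔥)

theorem hatMap_apply {n : ℕ} (f : MultilinearMap K (fun _ : Fin n => 𝔤) 𝔥)
    (X : Fin n → 𝔤 × 𝔥) : hatMap f X = (0, f fun i => (X i).1) := rfl

theorem unhatMap_apply {n : ℕ} (F : MultilinearMap K (fun _ : Fin n => 𝔤 × 𝔥) (𝔤 × 𝔥))
    (X : Fin n → 𝔤) : unhatMap F X = (F fun i => (X i, 0)).2 := rfl

theorem unhatMap_mem_homDeg {n : ℕ} {a : ZMod 2}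
    {F : MultilinearMap K (fun _ : Fin n => 𝔤 × 𝔥) (𝔤 × 𝔥)}
    (hF : F ∈ homDeg (prodGrading 𝒢 ℋ) (prodGrading 𝒢 ℋ) n a) :
    unhatMap F ∈ homDeg 𝒢 ℋ n a :=
  fun p _ hX => (hF p _ fun i => ⟨hX i, zero_mem _⟩).2

variable [DirectSum.Decomposition 𝒢] [DirectSum.Decomposition ℋ]

theorem proj_mem_weightPart {w : ℤ} {z : 𝔤 × 𝔥} (hz : z ∈ weightPart 𝔤 𝔥 w) (α : ZMod 2) :
    proj (prodGrading 𝒢 ℋ) α z ∈ weightPart 𝔤 𝔥 w := by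
  rw [mem_weightPart] at hz ⊢
  rw [proj_prodGrading]
  exact ⟨fun h => by rw [hz.1 h, map_zero], fun h => by rw [hz.2 h, map_zero]⟩

theorem HasWeight.nrBracket {k l : ℕ} {a b : ZMod 2} {u v w : ℤ} (hu : v + w = u) {x y : Multi K (𝔤 × 𝔥)}
    (hx : x ∈ nrDeg (prodGrading 𝒢 ℋ) k a) (hy : y ∈ nrDeg (prodGrading 𝒢 ℋ) l b)
    (hx' : HasWeight v (encM (prodGrading 𝒢 ℋ) x))
    (hy' : HasWeight w (encM (prodGrading 𝒢 ℋ) y)) :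
    HasWeight u (encM (prodGrading 𝒢 ℋ) (nrBracket (prodGrading 𝒢 ℋ) x y)) := by
  rw [encM_nrBracket hx hy, ← hu]
  exact hx'.lbr _ _ _ _ hy'

theorem hasWeight_ofBilin {w : ℤ} {B : (𝔤 × 𝔥) →ₗ[K] (𝔤 × 𝔥) →ₗ[K] (𝔤 × 𝔥)}
    (h : ∀ a b x y, x ∈ weightPart 𝔤 𝔥 a → y ∈ weightPart 𝔤 𝔥 b →
      B x y ∈ weightPart 𝔤 𝔥 (w + (a + b))) :
    HasWeight w (encM (prodGrading 𝒢 ℋ) (ofBilin B)) := by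
  intro L q hL
  by_cases hl : L.length = 2
  · rcases hL with _ | ⟨hx, _ | ⟨hy, _ | _⟩⟩
    · simp at hl
    · simp at hl
    · rw [encM_ofBilin, add_zero]
      exact h _ _ _ _ (proj_mem_weightPart hx _) (proj_mem_weightPart hy _)
    · simp at hl
  · rw [hasArity_ofBilin B L hl]
    exact zero_mem _

theorem hasWeight_hatMu (μ : 𝔥 →ₗ[K] 𝔥 →ₗ[K] 𝔥) :
    HasWeight (-1) (encM (prodGrading 𝒢 ℋ) (hatMu 𝔤 μ)) := by
  refine hasWeight_ofBilin fun a b x y hx hy => mem_weightPart.2 ⟨fun _ => rfl, fun h => ?_⟩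
  rw [mem_weightPart] at hx hy
  change μ x.2 y.2 = 0
  by_cases ha : a = 1
  · rw [hy.2 (by omega), map_zero]
  · rw [hx.2 ha, map_zero, LinearMap.zero_apply]

theorem hasWeight_hatPi (π : 𝔤 →ₗ[K] 𝔤 →ₗ[K] 𝔤) :
    HasWeight 0 (encM (prodGrading 𝒢 ℋ) (hatPi 𝔥 π)) := by
  refine hasWeight_ofBilin fun a b x y hx hy => mem_weightPart.2 ⟨fun h => ?_, fun _ => rfl⟩
  rw [mem_weightPart] at hx hy
  change π x.1 y.1 = 0
  by_cases ha : a = 0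
  · rw [hy.1 (by omega), map_zero]
  · rw [hx.1 ha, map_zero, LinearMap.zero_apply]

theorem hasWeight_hatRho (ρ : 𝔤 →ₗ[K] 𝔥 →ₗ[K] 𝔥) :
    HasWeight 0 (encM (prodGrading 𝒢 ℋ) (hatRho 𝒢 ℋ ρ)) := by
  refine hasWeight_ofBilin fun a b x y hx hy => mem_weightPart.2 ⟨fun _ => rfl, fun h => ?_⟩
  rw [mem_weightPart] at hx hy
  have h₁ : x.1 = 0 ∨ y.2 = 0 := by
    by_cases ha : a = 0
    · exact .inr (hy.2 (by omega))
    · exact .inl (hx.1 ha)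
  have h₂ : x.2 = 0 ∨ y.1 = 0 := by
    by_cases ha : a = 1
    · exact .inr (hy.1 (by omega))
    · exact .inl (hx.2 ha)
  rcases h₁ with h₁ | h₁ <;> rcases h₂ with h₂ | h₂ <;> simp [h₁, h₂]

theorem HasWeight.add {w : ℤ} {Φ Ψ : List (ZMod 2 × (𝔤 × 𝔥)) → 𝔤 × 𝔥} (hΦ : HasWeight w Φ)
    (hΨ : HasWeight w Ψ) : HasWeight w (Φ + Ψ) :=
  fun L q hL => add_mem (hΦ L q hL) (hΨ L q hL)

theorem hat_lof (k : ℕ) (f : superAlt 𝔥 𝒢 (k + 1)) :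
    hat 𝔥 𝒢 (DirectSum.lof K ℕ _ k f) =
      Multi.incl K (𝔤 × 𝔥) k (hatMap (f : MultilinearMap K (fun _ : Fin (k + 1) => 𝔤) 𝔥)) := by
  rw [hat, DirectSum.lmap_lof]
  rfl

theorem hatMap_mem {n : ℕ} {a : ZMod 2} {f : MultilinearMap K (fun _ : Fin n => 𝔤) 𝔥}
    (hf : f ∈ superAlt 𝔥 𝒢 n) (hf' : f ∈ homDeg 𝒢 ℋ n a) :
    hatMap f ∈ superAlt (𝔤 × 𝔥) (prodGrading 𝒢 ℋ) n ⊓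
      homDeg (prodGrading 𝒢 ℋ) (prodGrading 𝒢 ℋ) n a := by
  refine ⟨(mem_superAlt _).2 fun σ => multilinear_ext (prodGrading 𝒢 ℋ) fun p X hX => ?_,
    fun p X hX => ⟨zero_mem _, hf' p _ fun i => (hX i).1⟩⟩
  rw [permAct_apply_of_mem _ _ _ hX, hatMap_apply, hatMap_apply]
  conv_rhs => rw [← (mem_superAlt 𝒢).1 hf σ, permAct_apply_of_mem 𝒢 _ _ fun i => (hX i).1]
  ext <;> simp

theorem unhatMap_mem_superAlt {n : ℕ}
    {F : MultilinearMap K (fun _ : Fin n => 𝔤 × 𝔥) (𝔤 × 𝔥)}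
    (hF : F ∈ superAlt (𝔤 × 𝔥) (prodGrading 𝒢 ℋ) n) : unhatMap F ∈ superAlt 𝔥 𝒢 n := by
  refine (mem_superAlt _).2 fun σ => multilinear_ext 𝒢 fun p X hX => ?_
  rw [permAct_apply_of_mem _ _ _ hX, unhatMap_apply, unhatMap_apply]
  conv_rhs => rw [← (mem_superAlt _).1 hF σ,
    permAct_apply_of_mem (prodGrading 𝒢 ℋ) (p := p) _ _ fun i => ⟨hX i, zero_mem _⟩]
  rfl

theorem map_mem_weightPart {n : ℕ} {w : ℤ}
    {F : MultilinearMap K (fun _ : Fin n => 𝔤 × 𝔥) (𝔤 × 𝔥)}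
    (hF : HasWeight w (enc (prodGrading 𝒢 ℋ) n F)) {p : Fin n → ZMod 2} {X : Fin n → 𝔤 × 𝔥}
    {q : Fin n → ℤ} (hX : ∀ i, X i ∈ prodGrading 𝒢 ℋ (p i))
    (hX' : ∀ i, X i ∈ weightPart 𝔤 𝔥 (q i)) : F X ∈ weightPart 𝔤 𝔥 (w + ∑ i, q i) := by
  have := hF (List.ofFn fun i => (p i, X i)) _ (ListWeight.ofFn hX')
  rw [enc_ofFn] at this
  simpa only [proj_of_mem _ (hX _), if_true] using this

/-- Split every argument into its `𝔤`-part and `𝔥`-part. A summand with some argument from `𝔥` has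
weight at least `w + 1 ≥ 2`, where `𝔤 ⊕ 𝔥` is zero. -/
theorem map_eq_of_hasWeight {n : ℕ} {w : ℤ} (hw : 1 ≤ w)
    {F : MultilinearMap K (fun _ : Fin n => 𝔤 × 𝔥) (𝔤 × 𝔥)}
    (hF : HasWeight w (enc (prodGrading 𝒢 ℋ) n F)) {p : Fin n → ZMod 2} {X : Fin n → 𝔤 × 𝔥}
    (hX : ∀ i, X i ∈ prodGrading 𝒢 ℋ (p i)) :
    F X = F (fun i => ((X i).1, 0)) ∧ F X ∈ weightPart 𝔤 𝔥 w := by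
  have e : F X = F (fun i => ((X i).1, 0)) := by
    have h : X = (fun i => ((X i).1, (0 : 𝔥))) + fun i => ((0 : 𝔤), (X i).2) := by
      funext i
      simp
    conv_lhs => rw [h, F.map_add_univ]
    -- The set `s` marks the arguments replaced by their `𝔤`-parts; only `s = univ` survives.
    rw [Finset.sum_eq_single Finset.univ, Finset.piecewise_univ]
    · intro s _ hs
      have hq := map_mem_weightPart hF (p := p)
        (X := s.piecewise (fun i => ((X i).1, (0 : 𝔥))) fun i => ((0 : 𝔤), (X i).2))
        (q := fun i => if i ∈ s then 0 else 1) (fun i => ?_) (fun i => ?_)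
      · have hpos : 0 < ∑ i, (if i ∈ s then (0 : ℤ) else 1) := by
          obtain ⟨i, hi⟩ : ∃ i, i ∉ s := by
            by_contra! h
            exact hs (Finset.eq_univ_iff_forall.2 h)
          refine Finset.sum_pos' (fun j _ => ?_) ⟨i, Finset.mem_univ _, ?_⟩
          · split_ifs <;> simp
          · simp [hi]
        rw [mem_weightPart] at hq
        exact Prod.ext (hq.1 (by omega)) (hq.2 (by omega))
      · by_cases hi : i ∈ s
        · rw [Finset.piecewise_eq_of_mem _ _ _ hi]
          exact ⟨(hX i).1, zero_mem _⟩
        · rw [Finset.piecewise_eq_of_notMem _ _ _ hi]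
          exact ⟨zero_mem _, (hX i).2⟩
      · by_cases hi : i ∈ s
        · rw [Finset.piecewise_eq_of_mem _ _ _ hi, if_pos hi]
          exact mem_weightPart.2 ⟨by simp, by simp⟩
        · rw [Finset.piecewise_eq_of_notMem _ _ _ hi, if_neg hi]
          exact mem_weightPart.2 ⟨by simp, by simp⟩
    · simp
  refine ⟨e, ?_⟩
  have := map_mem_weightPart hF (p := p) (X := fun i => ((X i).1, 0)) (q := fun _ => 0)
    (fun i => ⟨(hX i).1, zero_mem _⟩) fun i => mem_weightPart.2 ⟨by simp, by simp⟩
  rwa [Finset.sum_const_zero, add_zero, ← e] at this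

theorem eq_zero_of_hasWeight_two {k : ℕ} {a : ZMod 2} {x : Multi K (𝔤 × 𝔥)}
    (hx : x ∈ nrDeg (prodGrading 𝒢 ℋ) k a) (h : HasWeight 2 (encM (prodGrading 𝒢 ℋ) x)) :
    x = 0 := by
  obtain ⟨F, -, rfl⟩ := hx
  rw [encM_incl] at h
  have : F = 0 := multilinear_ext (prodGrading 𝒢 ℋ) fun p X hX => by
    have := mem_weightPart.1 (map_eq_of_hasWeight (by norm_num) h hX).2
    exact Prod.ext (this.1 (by norm_num)) (this.2 (by norm_num))
  rw [this, map_zero]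

theorem exists_hat_eq {k : ℕ} {a : ZMod 2} {x : Multi K (𝔤 × 𝔥)}
    (hx : x ∈ nrDeg (prodGrading 𝒢 ℋ) k a) (h : HasWeight 1 (encM (prodGrading 𝒢 ℋ) x)) :
    ∃ f ∈ cochainGrading 𝒢 ℋ (k + 1, a), hat 𝔥 𝒢 f = x := by
  obtain ⟨F, hF, rfl⟩ := hx
  rw [encM_incl] at h
  refine ⟨DirectSum.lof K ℕ _ k ⟨unhatMap F, unhatMap_mem_superAlt hF.1⟩,
    Submodule.mem_map_of_mem (unhatMap_mem_homDeg hF.2), ?_⟩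
  rw [hat_lof]
  congr 1
  refine multilinear_ext (prodGrading 𝒢 ℋ) fun p X hX => ?_
  obtain ⟨h₁, h₂⟩ := map_eq_of_hasWeight le_rfl h hX
  rw [hatMap_apply]
  refine Prod.ext ((mem_weightPart.1 h₂).1 (by norm_num)).symm ?_
  rw [h₁]
  rfl

theorem hat_mem_nrDeg {k : ℕ} {a : ZMod 2} {f : Cochain 𝒢 𝔥}
    (hf : f ∈ cochainGrading 𝒢 ℋ (k + 1, a)) : hat 𝔥 𝒢 f ∈ nrDeg (prodGrading 𝒢 ℋ) k a := by
  obtain ⟨f, hf, rfl⟩ := hf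
  rw [hat_lof]
  exact Submodule.mem_map_of_mem (hatMap_mem f.2 hf)

/-- For arguments of total weight `0` the value lies in `𝔥`, of weight `1`. Otherwise some argument
has no `𝔤`-part and the value is zero. -/
theorem hasWeight_hat {k : ℕ} {a : ZMod 2} {f : Cochain 𝒢 𝔥}
    (hf : f ∈ cochainGrading 𝒢 ℋ (k + 1, a)) :
    HasWeight 1 (encM (prodGrading 𝒢 ℋ) (hat 𝔥 𝒢 f)) := by
  obtain ⟨f, hf, rfl⟩ := hf
  rw [hat_lof, encM_incl]
  intro L q hL
  by_cases hl : L.length = k + 1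
  · rcases hL.eq_zero_or with rfl | ⟨y, hy, h⟩
    · obtain ⟨Y, rfl⟩ := exists_ofFn hl
      rw [enc_ofFn, hatMap_apply]
      exact mem_weightPart.2 ⟨fun _ => rfl, by simp⟩
    · obtain ⟨Y, rfl⟩ := exists_ofFn hl
      obtain ⟨i, rfl⟩ := (List.mem_ofFn' _ _).1 hy
      rw [enc_ofFn, hatMap_apply, MultilinearMap.map_coord_zero _ i]
      · exact zero_mem _
      · rw [proj_prodGrading, h, map_zero]
  · rw [enc_of_length_ne _ _ _ hl]
    exact zero_mem _

end HatImage

/-! ### The grading of the cochains -/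

section CochainGrading

variable {K V W : Type*} [Field K] [AddCommGroup V] [Module K V] [AddCommGroup W] [Module K W]
variable (𝒱 : ZMod 2 → Submodule K V) (𝒲 : ZMod 2 → Submodule K W)
variable [DirectSum.Decomposition 𝒱] [DirectSum.Decomposition 𝒲]

/-- The component of degree `α` of a graded alternating map. -/
def altComp (n : ℕ) (α : ZMod 2) : superAlt W 𝒱 n →ₗ[K] superAlt W 𝒱 n :=
  (homComp 𝒱 𝒲 n α).restrict fun _ => homComp_mem_superAlt 𝒱 𝒲 α

theorem sum_altComp {n : ℕ} (f : superAlt W 𝒱 n) : ∑ α, altComp 𝒱 𝒲 n α f = f := by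
  refine Subtype.ext ?_
  rw [AddSubmonoidClass.coe_finsetSum]
  exact sum_homComp 𝒱 𝒲 f.1

theorem lof_altComp_mem {k : ℕ} (α : ZMod 2) (f : superAlt W 𝒱 (k + 1)) :
    DirectSum.lof K ℕ (fun k => superAlt (W := W) 𝒱 (k + 1)) k (altComp 𝒱 𝒲 (k + 1) α f) ∈
      cochainGrading 𝒱 𝒲 (k + 1, α) :=
  Submodule.mem_map_of_mem (homComp_mem 𝒱 𝒲 α f.1)

/-- The decomposition of the cochains into components. -/
def cochainDecompose : Cochain 𝒱 W →ₗ[K] ⨁ i, cochainGrading 𝒱 𝒲 i :=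
  DirectSum.toModule K ℕ _ fun k => ∑ α : ZMod 2,
    DirectSum.lof K (ℕ × ZMod 2) (fun i => cochainGrading 𝒱 𝒲 i) (k + 1, α) ∘ₗ
      (DirectSum.lof K ℕ (fun k => superAlt (W := W) 𝒱 (k + 1)) k ∘ₗ
        altComp 𝒱 𝒲 (k + 1) α).codRestrict _ (lof_altComp_mem 𝒱 𝒲 α)

theorem cochainDecompose_lof (k : ℕ) (f : superAlt W 𝒱 (k + 1)) :
    cochainDecompose 𝒱 𝒲 (DirectSum.lof K ℕ _ k f) = ∑ α : ZMod 2,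
      DirectSum.lof K (ℕ × ZMod 2) (fun i => cochainGrading 𝒱 𝒲 i) (k + 1, α)
        ⟨_, lof_altComp_mem 𝒱 𝒲 α f⟩ := by
  rw [cochainDecompose, DirectSum.toModule_lof, LinearMap.sum_apply]
  rfl

/-- The `ℕ × ℤ₂`-grading of the cochains is a decomposition. -/
@[reducible]
def cochainDecomposition : DirectSum.Decomposition (cochainGrading 𝒱 𝒲) :=
  DirectSum.Decomposition.ofLinearMap _ (cochainDecompose 𝒱 𝒲)
    (by
      refine DirectSum.linearMap_ext K fun k => LinearMap.ext fun f => ?_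
      simp only [LinearMap.comp_apply, cochainDecompose_lof, map_sum, DirectSum.coeLinearMap_lof,
        LinearMap.id_apply]
      rw [← map_sum, sum_altComp])
    (by
      refine DirectSum.linearMap_ext K fun i => LinearMap.ext fun x => ?_
      simp only [LinearMap.comp_apply, DirectSum.coeLinearMap_lof, LinearMap.id_apply]
      obtain ⟨_ | k, α⟩ := i
      · obtain ⟨x, hx⟩ := x
        obtain rfl : x = 0 := hx
        rw [map_zero]
        exact (map_zero _).symm
      · obtain ⟨x, f, hf, rfl⟩ := x
        dsimp only
        rw [cochainDecompose_lof, Finset.sum_eq_single α]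
        · congr 2
          refine congrArg _ (Subtype.ext ?_)
          exact (homComp_of_mem 𝒱 𝒲 hf α).trans (if_pos rfl)
        · intro β _ hβ
          have h : altComp 𝒱 𝒲 (k + 1) β f = 0 :=
            Subtype.ext ((homComp_of_mem 𝒱 𝒲 hf β).trans (if_neg hβ))
          refine (congrArg _ (Subtype.ext ?_)).trans (map_zero _)
          exact (congrArg _ h).trans (map_zero _)
        · simp)

theorem cochainGrading_isInternal : DirectSum.IsInternal (cochainGrading 𝒱 𝒲) :=
  letI := cochainDecomposition 𝒱 𝒲
  DirectSum.Decomposition.isInternal _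

/-- The axioms of the theorem leave the last argument arbitrary; additivity reduces it to a
homogeneous one. -/
theorem cochain_induction {P : Cochain 𝒱 W → Prop} (zero : P 0)
    (add : ∀ x y, P x → P y → P (x + y))
    (mem : ∀ k a x, x ∈ cochainGrading 𝒱 𝒲 (k + 1, a) → P x) (x : Cochain 𝒱 W) : P x := by
  induction x using DirectSum.induction_on with
  | zero => exact zero
  | add x y hx hy => exact add x y hx hy
  | of k f =>
    change P (DirectSum.lof K ℕ _ k f)
    rw [← sum_altComp 𝒱 𝒲 f, map_sum]
    exact Finset.sum_induction _ P add zero fun α _ => mem k α _ (lof_altComp_mem 𝒱 𝒲 α f)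

theorem koszulSign_eq (i j : ℕ × ZMod 2) :
    koszulSign i j = (-1 : ℤˣ) ^ ((i.1 * j.1 : ZMod 2) + i.2 * j.2) := by
  rw [koszulSign, uzpow_add, ← Nat.cast_mul, uzpow_natCast]

theorem neg_one_pow_smul (k : ℕ) (x : V) : (-1 : K) ^ k • x = (-1 : ℤˣ) ^ (k : ZMod 2) • x := by
  rw [uzpow_natCast]
  rcases Nat.even_or_odd k with h | h
  · rw [h.neg_one_pow, h.neg_one_pow, one_smul, one_smul]
  · rw [h.neg_one_pow, h.neg_one_pow, neg_one_sign_smul, neg_one_smul]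

theorem map_sign_smul (f : V →ₗ[K] W) (u : ℤˣ) (x : V) : f (u • x) = u • f x := by
  rw [Units.smul_def, Units.smul_def, map_zsmul]

theorem map_sign_smul₂ {U : Type*} [AddCommGroup U] [Module K U] (f : V →ₗ[K] U →ₗ[K] W)
    (u : ℤˣ) (x : V) (y : U) : f (u • x) y = u • f x y :=
  map_sign_smul (f.flip y) u x

end CochainGrading

/-! ### Derived brackets -/

section Derived

variable {K V : Type*} [Field K] [AddCommGroup V] [Module K V]
variable {𝒱 : ZMod 2 → Submodule K V} [DirectSum.Decomposition 𝒱]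
variable {k l m : ℕ} {a b c : ZMod 2} {θ ν x y z : Multi K V}

/-- Apply `[ν, ·]` to `[x, y] = 0`. The exponents `k + 1` and `l + 1` are the degrees of `x` and `y`
as cochains, one more than in `nrDeg`. -/
theorem derived_skew (hν : ν ∈ nrDeg 𝒱 1 0) (hx : x ∈ nrDeg 𝒱 k a) (hy : y ∈ nrDeg 𝒱 l b)
    (hxy : nrBracket 𝒱 x y = 0) :
    (-1 : ℤˣ) ^ (k : ZMod 2) • nrBracket 𝒱 (nrBracket 𝒱 ν x) y =
      -((-1 : ℤˣ) ^ (((k + 1) * (l + 1) : ZMod 2) + a * b) •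
        (-1 : ℤˣ) ^ (l : ZMod 2) • nrBracket 𝒱 (nrBracket 𝒱 ν y) x) := by
  have h₁ := nrBracket_jacobi hν hx hy
  rw [hxy, map_zero, nrBracket_skew hx (nrBracket_mem hν hy)] at h₁
  rw [eq_neg_of_add_eq_zero_left h₁.symm]
  simp only [smul_smul, ← uzpow_add, neg_eq_sign_smul]
  refine sign_smul_congr ?_ rfl
  push_cast
  grind

/-- Jacobi for `[ν, x]`, `[ν, y]`, `z` leaves `[[ν, x], [ν, y]]`, which is `± [ν, [[ν, x], y]]`
because `[ν, [ν, x]] = 0`. -/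
theorem derived_jacobi (hν : ν ∈ nrDeg 𝒱 1 0) (hνν : lcirc 0 (encM 𝒱 ν) (encM 𝒱 ν) = 0)
    (hx : x ∈ nrDeg 𝒱 k a) (hy : y ∈ nrDeg 𝒱 l b) (hz : z ∈ nrDeg 𝒱 m c) :
    (-1 : ℤˣ) ^ (k : ZMod 2) • nrBracket 𝒱 (nrBracket 𝒱 ν x)
        ((-1 : ℤˣ) ^ (l : ZMod 2) • nrBracket 𝒱 (nrBracket 𝒱 ν y) z) =
      (-1 : ℤˣ) ^ ((1 + k + l : ℕ) : ZMod 2) • nrBracket 𝒱 (nrBracket 𝒱 ν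
        ((-1 : ℤˣ) ^ (k : ZMod 2) • nrBracket 𝒱 (nrBracket 𝒱 ν x) y)) z +
      (-1 : ℤˣ) ^ (((k + 1) * (l + 1) : ZMod 2) + a * b) •
        (-1 : ℤˣ) ^ (l : ZMod 2) • nrBracket 𝒱 (nrBracket 𝒱 ν y)
          ((-1 : ℤˣ) ^ (k : ZMod 2) • nrBracket 𝒱 (nrBracket 𝒱 ν x) z) := by
  have hνx := nrBracket_mem hν hx
  have hνy := nrBracket_mem hν hy
  have h₁ := nrBracket_jacobi hνx hνy hz
  have h₂ := nrBracket_jacobi hν hνx hy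
  rw [nrBracket_nrBracket_self hν hx hνν, map_zero, LinearMap.zero_apply, zero_add] at h₂
  simp only [map_sign_smul, map_sign_smul₂, h₁, h₂, smul_add, smul_smul, ← uzpow_add]
  congr 1 <;> refine sign_smul_congr ?_ rfl <;> push_cast <;> grind

/-- `[θ, ·]` is a derivation of `nrBracket`, and it anticommutes with `[ν, ·]` because `[θ, ν] = 0`.
-/
theorem derived_leibniz (hν : ν ∈ nrDeg 𝒱 1 0) (hθ : θ ∈ nrDeg 𝒱 1 0)
    (hθν : nrBracket 𝒱 θ ν = 0) (hx : x ∈ nrDeg 𝒱 k a) (hy : y ∈ nrDeg 𝒱 l b) :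
    nrBracket 𝒱 θ ((-1 : ℤˣ) ^ (k : ZMod 2) • nrBracket 𝒱 (nrBracket 𝒱 ν x) y) =
      (-1 : ℤˣ) ^ ((1 + k : ℕ) : ZMod 2) •
        nrBracket 𝒱 (nrBracket 𝒱 ν (nrBracket 𝒱 θ x)) y +
      (-1 : ℤˣ) ^ ((k : ZMod 2) + 1) • (-1 : ℤˣ) ^ (k : ZMod 2) •
        nrBracket 𝒱 (nrBracket 𝒱 ν x) (nrBracket 𝒱 θ y) := by
  have h₁ := nrBracket_jacobi hθ (nrBracket_mem hν hx) hy
  have h₂ := nrBracket_jacobi hθ hν hx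
  rw [hθν, map_zero, LinearMap.zero_apply, zero_add] at h₂
  rw [map_sign_smul, h₁, h₂]
  simp only [map_sign_smul₂, smul_add, smul_smul, ← uzpow_add]
  congr 1 <;> refine sign_smul_congr ?_ rfl <;> push_cast <;> grind

end Derived

/-! ### Maurer–Cartan elements -/

section MaurerCartan

theorem lcirc_unary_right {V : Type*} [AddCommGroup V] {Φ η : List (ZMod 2 × V) → V}
    (hΦ : HasArity 2 Φ) (x y : ZMod 2 × V) :
    lcirc 0 Φ η [x, y] = Φ [x, (y.1, η [y])] +
      (-1 : ℤˣ) ^ (1 + x.1 * y.1) • Φ [y, (x.1, η [x])] := by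
  have e1 : ∀ x, Φ [x] = 0 := fun x => hΦ _ (by simp)
  have e3 : ∀ x y z, Φ [x, y, z] = 0 := fun x y z => hΦ _ (by simp)
  simp only [lcirc, unsh, List.nil_append, List.cons_append, e1, e3]
  simp

theorem lcirc_unary_left {V : Type*} [AddCommGroup V] {Φ η : List (ZMod 2 × V) → V}
    (hη : HasArity 1 η) (x y : ZMod 2 × V) :
    lcirc 0 η Φ [x, y] = η [(x.1 + y.1, Φ [x, y])] := by
  have e2 : ∀ x y, η [x, y] = 0 := fun x y => hη _ (by simp)
  have e3 : ∀ x y z, η [x, y, z] = 0 := fun x y z => hη _ (by simp)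
  simp only [lcirc, unsh, List.nil_append, List.cons_append, e2, e3]
  simp

theorem lbr_unary {V : Type*} [AddCommGroup V] {Φ η : List (ZMod 2 × V) → V}
    (hΦ : HasArity 2 Φ) (hη : HasArity 1 η) (x y : ZMod 2 × V) :
    lbr 1 0 0 0 Φ η [x, y] = Φ [x, (y.1, η [y])] +
      (-1 : ℤˣ) ^ (1 + x.1 * y.1) • Φ [y, (x.1, η [x])] - η [(x.1 + y.1, Φ [x, y])] := by
  rw [lbr, Pi.sub_apply, Pi.smul_apply, lcirc_unary_right hΦ, lcirc_unary_left hη]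
  simp

variable {K 𝔤 𝔥 : Type*} [Field K] [AddCommGroup 𝔤] [Module K 𝔤] [AddCommGroup 𝔥] [Module K 𝔥]
variable {𝒢 : ZMod 2 → Submodule K 𝔤} {ℋ : ZMod 2 → Submodule K 𝔥}
variable [DirectSum.Decomposition 𝒢]
variable {π : 𝔤 →ₗ[K] 𝔤 →ₗ[K] 𝔤} {μ : 𝔥 →ₗ[K] 𝔥 →ₗ[K] 𝔥} {ρ : 𝔤 →ₗ[K] 𝔥 →ₗ[K] 𝔥}
variable {D : 𝔤 →ₗ[K] 𝔥}

theorem ofLinear_mem (hD : ∀ α x, x ∈ 𝒢 α → D x ∈ ℋ α) :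
    ofLinear 𝒢 D ∈ cochainGrading 𝒢 ℋ (1, 0) := by
  refine Submodule.mem_map_of_mem fun p X hX => ?_
  rw [zero_add, Fin.sum_univ_one]
  exact hD _ _ (hX 0)

variable [DirectSum.Decomposition ℋ]

theorem encM_hat_ofLinear (x : ZMod 2 × (𝔤 × 𝔥)) :
    encM (prodGrading 𝒢 ℋ) (hat 𝔥 𝒢 (ofLinear 𝒢 D)) [x] = (0, D (proj 𝒢 x.1 x.2.1)) := by
  rw [ofLinear, hat_lof, encM_incl]
  refine (enc_ofFn _ _ ![x]).trans ?_
  rw [hatMap_apply]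
  simp only [proj_prodGrading]
  rfl

theorem encM_nrBracket_hatRho_ofLinear (hπ : IsLieSuperalgebra 𝒢 π)
    (hρ : IsAction 𝒢 ℋ π μ ρ) (hD : ∀ α x, x ∈ 𝒢 α → D x ∈ ℋ α) {α β : ZMod 2} {x y : 𝔤 × 𝔥}
    (hx : x ∈ prodGrading 𝒢 ℋ α) (hy : y ∈ prodGrading 𝒢 ℋ β) :
    encM (prodGrading 𝒢 ℋ) (nrBracket (prodGrading 𝒢 ℋ) (hatPi 𝔥 π + hatRho 𝒢 ℋ ρ)
      (hat 𝔥 𝒢 (ofLinear 𝒢 D))) [(α, x), (β, y)] =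
      (0, ρ x.1 (D y.1) - (-1 : ℤˣ) ^ (α * β) • ρ y.1 (D x.1) - D (π x.1 y.1)) := by
  have hθ := hatPi_add_hatRho_mem hπ hρ
  have hη := hat_mem_nrDeg (ofLinear_mem hD)
  rw [encM_nrBracket hθ hη, Nat.cast_one, Nat.cast_zero,
    lbr_unary (hasArity_encM hθ) (hasArity_encM hη)]
  have e : hatPi 𝔥 π + hatRho 𝒢 ℋ ρ = ofBilin (semidirect 𝒢 ℋ π 0 ρ) := by
    rw [ofBilin_semidirect, hatMu_zero, add_zero]
  have hDx : ((0 : 𝔤), D x.1) ∈ prodGrading 𝒢 ℋ α := ⟨zero_mem _, hD _ _ hx.1⟩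
  have hDy : ((0 : 𝔤), D y.1) ∈ prodGrading 𝒢 ℋ β := ⟨zero_mem _, hD _ _ hy.1⟩
  simp only [e, encM_ofBilin, encM_hat_ofLinear, proj_of_mem _ hx, proj_of_mem _ hy,
    proj_of_mem _ hx.1, proj_of_mem _ hy.1, proj_of_mem _ hDx, proj_of_mem _ hDy, if_true,
    semidirect_apply _ _ _ hx hDy, semidirect_apply _ _ _ hy hDx, semidirect_apply _ _ _ hx hy,
    proj_of_mem 𝒢 (hπ.bracket_mem _ _ _ _ hx.1 hy.1)]
  refine Prod.ext (by simp) ?_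
  simp [uzpow_add, sub_eq_add_neg]

/-- Each of the two slots of `μ` can receive either copy of `D`, and skew-symmetry of `μ` makes the
two contributions equal. The term in which `D` is applied last vanishes, since `D` ignores `𝔥`. -/
theorem encM_nrBracket_hatMu_ofLinear (hμ : IsLieSuperalgebra ℋ μ)
    (hD : ∀ α x, x ∈ 𝒢 α → D x ∈ ℋ α) {α β : ZMod 2} {x y : 𝔤 × 𝔥}
    (hx : x ∈ prodGrading 𝒢 ℋ α) (hy : y ∈ prodGrading 𝒢 ℋ β) :
    encM (prodGrading 𝒢 ℋ) (nrBracket (prodGrading 𝒢 ℋ) (nrBracket (prodGrading 𝒢 ℋ)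
      (hatMu 𝔤 μ) (hat 𝔥 𝒢 (ofLinear 𝒢 D))) (hat 𝔥 𝒢 (ofLinear 𝒢 D))) [(α, x), (β, y)] =
      (0, μ (D x.1) (D y.1) + μ (D x.1) (D y.1)) := by
  have hν : hatMu 𝔤 μ ∈ nrDeg (prodGrading 𝒢 ℋ) 1 0 := hatMu_mem hμ
  have hη := hat_mem_nrDeg (ofLinear_mem hD)
  have hνη := nrBracket_mem hν hη
  have e : ∀ z w, encM (prodGrading 𝒢 ℋ) (hatMu 𝔤 μ) [z, w] =
      (0, μ (proj ℋ z.1 z.2.2) (proj ℋ w.1 w.2.2)) := by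
    intro z w
    rw [hatMu, encM_ofBilin, proj_prodGrading, proj_prodGrading]
    rfl
  have hν' : ∀ z w, encM (prodGrading 𝒢 ℋ) (nrBracket (prodGrading 𝒢 ℋ)
      (hatMu 𝔤 μ) (hat 𝔥 𝒢 (ofLinear 𝒢 D))) [z, w] =
      (0, μ (proj ℋ z.1 z.2.2) (D (proj 𝒢 w.1 w.2.1)) - (-1 : ℤˣ) ^ (z.1 * w.1) •
        μ (proj ℋ w.1 w.2.2) (D (proj 𝒢 z.1 z.2.1))) := by
    intro z w
    rw [encM_nrBracket hν hη, Nat.cast_one, Nat.cast_zero,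
      lbr_unary (hasArity_encM hν) (hasArity_encM hη)]
    simp only [e, encM_hat_ofLinear]
    rw [proj_of_mem ℋ (hD _ _ (proj_mem 𝒢 _ _)), if_pos rfl,
      proj_of_mem ℋ (hD _ _ (proj_mem 𝒢 _ _)), if_pos rfl]
    refine Prod.ext (by simp) ?_
    simp [uzpow_add, sub_eq_add_neg]
  rw [encM_nrBracket hνη hη, add_zero, add_zero, Nat.cast_one, Nat.cast_zero,
    lbr_unary (hasArity_encM hνη) (hasArity_encM hη)]
  simp only [hν', encM_hat_ofLinear, proj_of_mem 𝒢 hx.1, proj_of_mem 𝒢 hy.1, if_true,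
    proj_of_mem ℋ (hD _ _ hx.1), proj_of_mem ℋ (hD _ _ hy.1)]
  rw [hμ.skew _ _ _ _ (hD _ _ hy.1) (hD _ _ hx.1), mul_comm β α]
  refine Prod.ext (by simp) ?_
  generalize hu : (-1 : ℤˣ) ^ (α * β) = u
  rcases Int.units_eq_one_or u with rfl | rfl <;>
    simp [uzpow_add, hu]

end MaurerCartan

/-! ### The differential graded Lie algebra of cochains -/

section CochainAlgebra

variable {K 𝔤 𝔥 : Type*} [Field K] [AddCommGroup 𝔤] [Module K 𝔤] [AddCommGroup 𝔥] [Module K 𝔥]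
variable {𝒢 : ZMod 2 → Submodule K 𝔤} {ℋ : ZMod 2 → Submodule K 𝔥}
variable [DirectSum.Decomposition 𝒢]

theorem eq_zero_of_mem_zero {a : ZMod 2} {x : Cochain 𝒢 𝔥}
    (hx : x ∈ cochainGrading 𝒢 ℋ (0, a)) : x = 0 := hx

variable [DirectSum.Decomposition ℋ]
variable {π : 𝔤 →ₗ[K] 𝔤 →ₗ[K] 𝔤} {μ : 𝔥 →ₗ[K] 𝔥 →ₗ[K] 𝔥} {ρ : 𝔤 →ₗ[K] 𝔥 →ₗ[K] 𝔥}

theorem hat_sign_smul (u : ℤˣ) (x : Cochain 𝒢 𝔥) : hat 𝔥 𝒢 (u • x) = u • hat 𝔥 𝒢 x := by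
  rw [Units.smul_def, Units.smul_def, map_zsmul]

/-- The sign `(-1) ^ k` on the summand of index `k` of the cochains. -/
def cochainSign (𝒢 : ZMod 2 → Submodule K 𝔤) [DirectSum.Decomposition 𝒢] :
    Cochain 𝒢 𝔥 →ₗ[K] Cochain 𝒢 𝔥 :=
  DirectSum.lmap fun k => (-1 : K) ^ k • LinearMap.id

theorem cochainSign_lof (k : ℕ) (f : superAlt 𝔥 𝒢 (k + 1)) :
    cochainSign 𝒢 (DirectSum.lof K ℕ _ k f) = (-1 : K) ^ k • DirectSum.lof K ℕ _ k f := by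
  rw [cochainSign, DirectSum.lmap_lof, ← map_smul]
  rfl

variable (𝒢 ℋ μ) in
/-- The derived bracket `(-1) ^ k [[μ, f₁], f₂]` on `𝔤 ⊕ 𝔥`. -/
def derivedForm : Cochain 𝒢 𝔥 →ₗ[K] Cochain 𝒢 𝔥 →ₗ[K] Multi K (𝔤 × 𝔥) :=
  (nrBracket (prodGrading 𝒢 ℋ)).compl₁₂
    (nrBracket (prodGrading 𝒢 ℋ) (hatMu 𝔤 μ) ∘ₗ hat 𝔥 𝒢 ∘ₗ cochainSign 𝒢) (hat 𝔥 𝒢)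

theorem derivedForm_lof (k : ℕ) (f : superAlt 𝔥 𝒢 (k + 1)) (y : Cochain 𝒢 𝔥) :
    derivedForm 𝒢 ℋ μ (DirectSum.lof K ℕ _ k f) y =
      (-1 : K) ^ k • nrBracket (prodGrading 𝒢 ℋ)
        (nrBracket (prodGrading 𝒢 ℋ) (hatMu 𝔤 μ) (hat 𝔥 𝒢 (DirectSum.lof K ℕ _ k f)))
          (hat 𝔥 𝒢 y) := by
  rw [derivedForm, LinearMap.compl₁₂_apply, LinearMap.comp_apply, LinearMap.comp_apply,
    cochainSign_lof, map_smul, map_smul, map_smul, LinearMap.smul_apply]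

theorem derivedForm_of_mem {k : ℕ} {a : ZMod 2} {x : Cochain 𝒢 𝔥}
    (hx : x ∈ cochainGrading 𝒢 ℋ (k + 1, a)) (y : Cochain 𝒢 𝔥) :
    derivedForm 𝒢 ℋ μ x y = (-1 : ℤˣ) ^ (k : ZMod 2) • nrBracket (prodGrading 𝒢 ℋ)
      (nrBracket (prodGrading 𝒢 ℋ) (hatMu 𝔤 μ) (hat 𝔥 𝒢 x)) (hat 𝔥 𝒢 y) := by
  obtain ⟨f, -, rfl⟩ := hx
  rw [derivedForm_lof]
  exact neg_one_pow_smul (K := K) (V := Multi K (𝔤 × 𝔥)) k _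

theorem exists_hat_eq_derivedForm (hμ : IsLieSuperalgebra ℋ μ) {k l : ℕ} {a b : ZMod 2}
    {x y : Cochain 𝒢 𝔥} (hx : x ∈ cochainGrading 𝒢 ℋ (k + 1, a))
    (hy : y ∈ cochainGrading 𝒢 ℋ (l + 1, b)) :
    ∃ f ∈ cochainGrading 𝒢 ℋ (1 + k + l + 1, 0 + a + b),
      hat 𝔥 𝒢 f = derivedForm 𝒢 ℋ μ x y := by
  have hν : hatMu 𝔤 μ ∈ nrDeg (prodGrading 𝒢 ℋ) 1 0 := hatMu_mem hμ
  have hx' := hat_mem_nrDeg hx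
  have hy' := hat_mem_nrDeg hy
  have hw := HasWeight.nrBracket (neg_add_cancel 1) hν hx' (hasWeight_hatMu μ) (hasWeight_hat hx)
  obtain ⟨f, hf, h⟩ := exists_hat_eq (nrBracket_mem (nrBracket_mem hν hx') hy')
    (HasWeight.nrBracket (zero_add 1) (nrBracket_mem hν hx') hy' hw (hasWeight_hat hy))
  refine ⟨(-1 : ℤˣ) ^ (k : ZMod 2) • f, ?_, ?_⟩
  · rcases Int.units_eq_one_or ((-1 : ℤˣ) ^ (k : ZMod 2)) with h | h
    · rwa [h, one_smul]
    · rw [h, Units.neg_smul, one_smul]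
      exact Submodule.neg_mem (M := Cochain 𝒢 𝔥) _ hf
  · rw [hat_sign_smul, h, derivedForm_of_mem hx]

theorem exists_hat_eq_differential (hπ : IsLieSuperalgebra 𝒢 π) (hρ : IsAction 𝒢 ℋ π μ ρ)
    {k : ℕ} {a : ZMod 2} {x : Cochain 𝒢 𝔥} (hx : x ∈ cochainGrading 𝒢 ℋ (k + 1, a)) :
    ∃ f ∈ cochainGrading 𝒢 ℋ (1 + k + 1, 0 + a), hat 𝔥 𝒢 f =
      nrBracket (prodGrading 𝒢 ℋ) (hatPi 𝔥 π + hatRho 𝒢 ℋ ρ) (hat 𝔥 𝒢 x) := by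
  have hθ := hatPi_add_hatRho_mem hπ hρ
  have hθ' : HasWeight 0 (encM (prodGrading 𝒢 ℋ) (hatPi 𝔥 π + hatRho 𝒢 ℋ ρ)) := by
    rw [map_add]
    exact (hasWeight_hatPi π).add (hasWeight_hatRho ρ)
  have hw := HasWeight.nrBracket (zero_add 1) hθ (hat_mem_nrDeg hx) hθ' (hasWeight_hat hx)
  exact exists_hat_eq (nrBracket_mem hθ (hat_mem_nrDeg hx)) hw

theorem nrBracket_hat_hat {k l : ℕ} {a b : ZMod 2} {x y : Cochain 𝒢 𝔥}
    (hx : x ∈ cochainGrading 𝒢 ℋ (k + 1, a)) (hy : y ∈ cochainGrading 𝒢 ℋ (l + 1, b)) :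
    nrBracket (prodGrading 𝒢 ℋ) (hat 𝔥 𝒢 x) (hat 𝔥 𝒢 y) = 0 :=
  eq_zero_of_hasWeight_two (nrBracket_mem (hat_mem_nrDeg hx) (hat_mem_nrDeg hy))
    (HasWeight.nrBracket one_add_one_eq_two (hat_mem_nrDeg hx) (hat_mem_nrDeg hy)
      (hasWeight_hat hx) (hasWeight_hat hy))

theorem exists_leftInverse {V W : Type*} [AddCommGroup V] [Module K V] [AddCommGroup W]
    [Module K W] {f : V →ₗ[K] W} (hf : Function.Injective f) : ∃ g : W →ₗ[K] V, ∀ x, g (f x) = x :=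
  let ⟨g, hg⟩ := LinearMap.exists_leftInverse_of_injective f (LinearMap.ker_eq_bot.2 hf)
  ⟨g, LinearMap.congr_fun hg⟩

variable (𝒢) in
theorem exists_hat_leftInverse :
    ∃ g : Multi K (𝔤 × 𝔥) →ₗ[K] Cochain 𝒢 𝔥, ∀ x, g (hat 𝔥 𝒢 x) = x :=
  exists_leftInverse (V := Cochain 𝒢 𝔥) (W := Multi K (𝔤 × 𝔥)) (hat_injective 𝒢)

/-- The bracket is the derived form followed by a linear left inverse of `hat`. The choice of this
inverse is immaterial, because weights put the derived form in the image of `hat`. -/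
theorem exists_bracket (hμ : IsLieSuperalgebra ℋ μ) :
    ∃ br : Cochain 𝒢 𝔥 →ₗ[K] Cochain 𝒢 𝔥 →ₗ[K] Cochain 𝒢 𝔥,
      ∀ x y, hat 𝔥 𝒢 (br x y) = derivedForm 𝒢 ℋ μ x y := by
  obtain ⟨g, hg⟩ := exists_hat_leftInverse (𝔥 := 𝔥) 𝒢
  refine ⟨(derivedForm 𝒢 ℋ μ).compr₂ g, fun x y => ?_⟩
  rw [LinearMap.compr₂_apply]
  induction x using cochain_induction 𝒢 ℋ with
  | zero => simp only [map_zero, LinearMap.zero_apply]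
  | add x x' h h' => simp only [map_add, LinearMap.add_apply, h, h']
  | mem k a x hx =>
    induction y using cochain_induction 𝒢 ℋ with
    | zero => simp only [map_zero]
    | add y y' h h' => simp only [map_add, h, h']
    | mem l b y hy =>
      obtain ⟨f, -, hf⟩ := exists_hat_eq_derivedForm hμ hx hy
      rw [← hf, hg]

theorem exists_differential (hπ : IsLieSuperalgebra 𝒢 π) (hρ : IsAction 𝒢 ℋ π μ ρ) :
    ∃ d : Cochain 𝒢 𝔥 →ₗ[K] Cochain 𝒢 𝔥, ∀ x, hat 𝔥 𝒢 (d x) =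
      nrBracket (prodGrading 𝒢 ℋ) (hatPi 𝔥 π + hatRho 𝒢 ℋ ρ) (hat 𝔥 𝒢 x) := by
  obtain ⟨g, hg⟩ := exists_hat_leftInverse (𝔥 := 𝔥) 𝒢
  refine ⟨g ∘ₗ nrBracket (prodGrading 𝒢 ℋ) (hatPi 𝔥 π + hatRho 𝒢 ℋ ρ) ∘ₗ hat 𝔥 𝒢, fun x => ?_⟩
  rw [LinearMap.comp_apply, LinearMap.comp_apply]
  induction x using cochain_induction 𝒢 ℋ with
  | zero => simp only [map_zero]
  | add x x' h h' => simp only [map_add (hat 𝔥 𝒢) x x', map_add (nrBracket _ _), map_add g,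
      map_add (hat 𝔥 𝒢) (g _), h, h']
  | mem k a x hx =>
    obtain ⟨f, -, hf⟩ := exists_hat_eq_differential hπ hρ hx
    rw [← hf, hg]

variable {br : Cochain 𝒢 𝔥 →ₗ[K] Cochain 𝒢 𝔥 →ₗ[K] Cochain 𝒢 𝔥}
variable {d : Cochain 𝒢 𝔥 →ₗ[K] Cochain 𝒢 𝔥}

theorem bracket_mem (hμ : IsLieSuperalgebra ℋ μ)
    (hbr : ∀ x y, hat 𝔥 𝒢 (br x y) = derivedForm 𝒢 ℋ μ x y) {k l : ℕ} {a b : ZMod 2}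
    {x y : Cochain 𝒢 𝔥} (hx : x ∈ cochainGrading 𝒢 ℋ (k + 1, a))
    (hy : y ∈ cochainGrading 𝒢 ℋ (l + 1, b)) :
    br x y ∈ cochainGrading 𝒢 ℋ (1 + k + l + 1, 0 + a + b) := by
  obtain ⟨f, hf, h⟩ := exists_hat_eq_derivedForm hμ hx hy
  rw [← hbr] at h
  rwa [← hat_injective 𝒢 h]

theorem differential_mem (hπ : IsLieSuperalgebra 𝒢 π) (hρ : IsAction 𝒢 ℋ π μ ρ)
    (hd : ∀ x, hat 𝔥 𝒢 (d x) =
      nrBracket (prodGrading 𝒢 ℋ) (hatPi 𝔥 π + hatRho 𝒢 ℋ ρ) (hat 𝔥 𝒢 x))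
    {k : ℕ} {a : ZMod 2} {x : Cochain 𝒢 𝔥} (hx : x ∈ cochainGrading 𝒢 ℋ (k + 1, a)) :
    d x ∈ cochainGrading 𝒢 ℋ (1 + k + 1, 0 + a) := by
  obtain ⟨f, hf, h⟩ := exists_hat_eq_differential hπ hρ hx
  rw [← hd] at h
  rwa [← hat_injective 𝒢 h]

theorem isGradedLieAlgebra_cochain (hμ : IsLieSuperalgebra ℋ μ)
    (hbr : ∀ x y, hat 𝔥 𝒢 (br x y) = derivedForm 𝒢 ℋ μ x y) :
    IsGradedLieAlgebra (K := K) (E := Cochain 𝒢 𝔥) (cochainGrading 𝒢 ℋ) br where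
  isInternal := cochainGrading_isInternal 𝒢 ℋ
  bracket_mem := by
    rintro ⟨_ | k, a⟩ ⟨_ | l, b⟩ x y hx hy
    · rw [eq_zero_of_mem_zero hx, map_zero]
      exact zero_mem _
    · rw [eq_zero_of_mem_zero hx, map_zero]
      exact zero_mem _
    · rw [eq_zero_of_mem_zero hy, map_zero]
      exact zero_mem _
    · have e : ((k + 1, a) + (l + 1, b) : ℕ × ZMod 2) = (1 + k + l + 1, 0 + a + b) :=
        Prod.ext (by simp only [Prod.fst_add]; omega) (by simp only [Prod.snd_add, zero_add])
      rw [e]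
      exact SuperLie.bracket_mem hμ hbr hx hy
  skew := by
    rintro ⟨_ | k, a⟩ ⟨_ | l, b⟩ x y hx hy
    · simp [eq_zero_of_mem_zero hx]
    · simp [eq_zero_of_mem_zero hx]
    · simp [eq_zero_of_mem_zero hy]
    · refine hat_injective 𝒢 ?_
      rw [map_neg, hat_sign_smul, hbr, hbr, derivedForm_of_mem hx, derivedForm_of_mem hy,
        koszulSign_eq]
      push_cast
      exact derived_skew (hatMu_mem hμ) (hat_mem_nrDeg hx) (hat_mem_nrDeg hy)
        (nrBracket_hat_hat hx hy)
  jacobi := by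
    rintro ⟨_ | k, a⟩ ⟨_ | l, b⟩ x y z hx hy
    · simp [eq_zero_of_mem_zero hx]
    · simp [eq_zero_of_mem_zero hx]
    · simp [eq_zero_of_mem_zero hy]
    · induction z using cochain_induction 𝒢 ℋ with
      | zero => simp only [map_zero, smul_zero, add_zero]
      | add z z' h h' =>
        simp only [map_add, h, h', smul_add]
        abel
      | mem m c z hz =>
        refine hat_injective 𝒢 ?_
        rw [map_add, hat_sign_smul, hbr, hbr, hbr, derivedForm_of_mem hx, hbr,
          derivedForm_of_mem hy, derivedForm_of_mem hy, hbr, derivedForm_of_mem hx,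
          derivedForm_of_mem (SuperLie.bracket_mem hμ hbr hx hy), hbr, derivedForm_of_mem hx,
          koszulSign_eq, Nat.cast_succ, Nat.cast_succ]
        exact derived_jacobi (hatMu_mem hμ) (hatMu_lcirc_self hμ) (hat_mem_nrDeg hx)
          (hat_mem_nrDeg hy) (hat_mem_nrDeg hz)

theorem isDGLieAlgebra_cochain (hπ : IsLieSuperalgebra 𝒢 π) (hμ : IsLieSuperalgebra ℋ μ)
    (hρ : IsAction 𝒢 ℋ π μ ρ) (hbr : ∀ x y, hat 𝔥 𝒢 (br x y) = derivedForm 𝒢 ℋ μ x y)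
    (hd : ∀ x, hat 𝔥 𝒢 (d x) =
      nrBracket (prodGrading 𝒢 ℋ) (hatPi 𝔥 π + hatRho 𝒢 ℋ ρ) (hat 𝔥 𝒢 x)) :
    IsDGLieAlgebra (K := K) (E := Cochain 𝒢 𝔥) (cochainGrading 𝒢 ℋ) br d where
  gradedLie := isGradedLieAlgebra_cochain hμ hbr
  derivation :=
    { map_mem := by
        rintro ⟨_ | k, a⟩ x hx
        · rw [eq_zero_of_mem_zero hx, map_zero]
          exact zero_mem _
        · have e : ((k + 1, a) + (1, 0) : ℕ × ZMod 2) = (1 + k + 1, 0 + a) :=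
            Prod.ext (by simp only [Prod.fst_add]; omega)
              (by simp only [Prod.snd_add, zero_add, add_zero])
          rw [e]
          exact differential_mem hπ hρ hd hx
      leibniz := by
        rintro ⟨_ | k, a⟩ x y hx
        · simp [eq_zero_of_mem_zero hx]
        · induction y using cochain_induction 𝒢 ℋ with
          | zero => simp only [map_zero, smul_zero, add_zero]
          | add z z' h h' =>
            simp only [map_add, h, h', smul_add]
            abel
          | mem l b y hy =>
            refine hat_injective 𝒢 ?_
            rw [map_add, hat_sign_smul, hd, hbr, hbr, hbr, derivedForm_of_mem hx,
              derivedForm_of_mem hx, derivedForm_of_mem (differential_mem hπ hρ hd hx), hd, hd,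
              koszulSign_eq, zero_mul, add_zero, Nat.cast_one, one_mul, Nat.cast_succ]
            exact derived_leibniz (hatMu_mem hμ) (hatPi_add_hatRho_mem hπ hρ)
              (nrBracket_hatPi_add_hatRho_hatMu hπ hμ hρ) (hat_mem_nrDeg hx) (hat_mem_nrDeg hy) }
  d_d x := by
    induction x using cochain_induction 𝒢 ℋ with
    | zero => simp only [map_zero]
    | add x x' h h' => rw [map_add, map_add, h, h', add_zero]
    | mem k a x hx =>
      refine hat_injective 𝒢 ?_
      rw [hd, hd, map_zero]
      exact nrBracket_nrBracket_self (hatPi_add_hatRho_mem hπ hρ) (hat_mem_nrDeg hx)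
        (hatPi_add_hatRho_lcirc_self hπ hρ)

theorem isCrossedHom_iff_isMaurerCartan (hπ : IsLieSuperalgebra 𝒢 π)
    (hμ : IsLieSuperalgebra ℋ μ) (hρ : IsAction 𝒢 ℋ π μ ρ)
    (hbr : ∀ x y, hat 𝔥 𝒢 (br x y) = derivedForm 𝒢 ℋ μ x y)
    (hd : ∀ x, hat 𝔥 𝒢 (d x) =
      nrBracket (prodGrading 𝒢 ℋ) (hatPi 𝔥 π + hatRho 𝒢 ℋ ρ) (hat 𝔥 𝒢 x))
    (h2 : (2 : K) ≠ 0) {D : 𝔤 →ₗ[K] 𝔥} (hD : ∀ α x, x ∈ 𝒢 α → D x ∈ ℋ α) :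
    IsCrossedHom 𝒢 π μ ρ D ↔ IsMaurerCartan (cochainGrading 𝒢 ℋ) br d (ofLinear 𝒢 D) := by
  have hω := ofLinear_mem (𝒢 := 𝒢) hD
  set ω := ofLinear 𝒢 D with hω_def
  have hW : d ω + (1 / 2 : K) • br ω ω ∈ cochainGrading 𝒢 ℋ (1 + 1, 0) :=
    add_mem (differential_mem hπ hρ hd hω)
      (Submodule.smul_mem _ _ (SuperLie.bracket_mem hμ hbr hω hω))
  have key : ∀ α β (x y : 𝔤 × 𝔥), x ∈ prodGrading 𝒢 ℋ α → y ∈ prodGrading 𝒢 ℋ β →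
      encM (prodGrading 𝒢 ℋ) (hat 𝔥 𝒢 (d ω + (1 / 2 : K) • br ω ω)) [(α, x), (β, y)] =
        (0, ρ x.1 (D y.1) - (-1 : ℤˣ) ^ (α * β) • ρ y.1 (D x.1) - D (π x.1 y.1) +
          μ (D x.1) (D y.1)) := by
    intro α β x y hx hy
    rw [map_add, map_smul, hd, hbr, derivedForm_of_mem hω, Nat.cast_zero, uzpow_zero, one_smul,
      map_add, map_smul, Pi.add_apply, Pi.smul_apply,
      encM_nrBracket_hatRho_ofLinear hπ hρ hD hx hy,
      encM_nrBracket_hatMu_ofLinear hμ hD hx hy]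
    refine Prod.ext (by simp) ?_
    -- The factor `1 / 2` cancels the doubled `μ` term; this is where `2 ≠ 0` enters.
    simp only [Prod.snd_add, Prod.smul_snd, ← two_smul K, smul_smul, one_div,
      inv_mul_cancel₀ h2, one_smul]
  constructor
  · intro h
    refine ⟨hω, hat_injective 𝒢 (encM_injective (prodGrading 𝒢 ℋ) ?_)⟩
    rw [map_zero, map_zero]
    refine funext_of_hasArity (hasArity_encM (hat_mem_nrDeg hW)) (fun _ _ => rfl) fun Y => ?_
    obtain ⟨F, -, hF⟩ := hat_mem_nrDeg hW
    -- The encoding sees only the projections of the entries onto the components of their labels, so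
    -- `key` applies to arbitrary labelled entries.
    have e : ∀ Y : Fin 2 → ZMod 2 × (𝔤 × 𝔥),
        encM (prodGrading 𝒢 ℋ) (hat 𝔥 𝒢 (d ω + (1 / 2 : K) • br ω ω)) (List.ofFn Y) =
        encM (prodGrading 𝒢 ℋ) (hat 𝔥 𝒢 (d ω + (1 / 2 : K) • br ω ω)) (List.ofFn fun i =>
          ((Y i).1, proj (prodGrading 𝒢 ℋ) (Y i).1 (Y i).2)) := by
      intro Y
      rw [← hF, encM_incl, enc_ofFn, enc_ofFn]
      simp only [proj_of_mem _ (proj_mem (prodGrading 𝒢 ℋ) _ _), if_true]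
    have hY₀ := proj_mem (prodGrading 𝒢 ℋ) (Y 0).1 (Y 0).2
    have hY₁ := proj_mem (prodGrading 𝒢 ℋ) (Y 1).1 (Y 1).2
    refine (e Y).trans ((key _ _ _ _ hY₀ hY₁).trans ?_)
    rw [h _ _ _ _ hY₀.1 hY₁.1]
    refine Prod.ext rfl ?_
    simp
  · rintro ⟨-, h⟩ α β x y hx hy
    have := key α β (x, 0) (y, 0) ⟨hx, zero_mem _⟩ ⟨hy, zero_mem _⟩
    rw [h, map_zero, map_zero] at this
    have := congrArg Prod.snd this
    simp only [Pi.zero_apply, Prod.snd_zero] at this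
    rw [← sub_eq_zero, ← neg_eq_zero, this]
    abel

end CochainAlgebra

end SuperLie

end


/-- An element of the summand of index `k` is `(k + 1)`-linear, so the sign `(-1) ^ (m - 1)` of the
derived bracket is `(-1) ^ k`. Since `hat` is injective, the two displayed formulas determine `br`
and `d`. -/
theorem mainTheorem1 {K 𝔤 𝔥 : Type*} [Field K] [AddCommGroup 𝔤] [Module K 𝔤]
    [AddCommGroup 𝔥] [Module K 𝔥]
    (𝒢 : ZMod 2 → Submodule K 𝔤) [DirectSum.Decomposition 𝒢]
    (ℋ : ZMod 2 → Submodule K 𝔥) [DirectSum.Decomposition ℋ]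
    (π : 𝔤 →ₗ[K] 𝔤 →ₗ[K] 𝔤) (μ : 𝔥 →ₗ[K] 𝔥 →ₗ[K] 𝔥) (ρ : 𝔤 →ₗ[K] 𝔥 →ₗ[K] 𝔥)
    (hπ : SuperLie.IsLieSuperalgebra 𝒢 π) (hμ : SuperLie.IsLieSuperalgebra ℋ μ)
    (hρ : SuperLie.IsAction 𝒢 ℋ π μ ρ) :
    ∃ (br : SuperLie.Cochain 𝒢 𝔥 →ₗ[K] SuperLie.Cochain 𝒢 𝔥 →ₗ[K] SuperLie.Cochain 𝒢 𝔥)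
      (d : SuperLie.Cochain 𝒢 𝔥 →ₗ[K] SuperLie.Cochain 𝒢 𝔥),
      (∀ (k l : ℕ) (f₁ : SuperLie.superAlt 𝔥 𝒢 (k + 1)) (f₂ : SuperLie.superAlt 𝔥 𝒢 (l + 1)),
        SuperLie.hat 𝔥 𝒢 (br (DirectSum.lof K ℕ _ k f₁) (DirectSum.lof K ℕ _ l f₂)) =
          (-1 : K) ^ k •
            SuperLie.nrBracket (SuperLie.prodGrading 𝒢 ℋ)
              (SuperLie.nrBracket (SuperLie.prodGrading 𝒢 ℋ) (SuperLie.hatMu 𝔤 μ)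
                (SuperLie.hat 𝔥 𝒢 (DirectSum.lof K ℕ _ k f₁)))
              (SuperLie.hat 𝔥 𝒢 (DirectSum.lof K ℕ _ l f₂))) ∧
      (∀ f : SuperLie.Cochain 𝒢 𝔥,
        SuperLie.hat 𝔥 𝒢 (d f) =
          SuperLie.nrBracket (SuperLie.prodGrading 𝒢 ℋ)
            (SuperLie.hatPi 𝔥 π + SuperLie.hatRho 𝒢 ℋ ρ) (SuperLie.hat 𝔥 𝒢 f)) ∧
      SuperLie.IsDGLieAlgebra (K := K) (E := SuperLie.Cochain 𝒢 𝔥) (SuperLie.cochainGrading 𝒢 ℋ) br d ∧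
      ((2 : K) ≠ 0 → ∀ D : 𝔤 →ₗ[K] 𝔥, (∀ α x, x ∈ 𝒢 α → D x ∈ ℋ α) →
        (SuperLie.IsCrossedHom 𝒢 π μ ρ D ↔
          SuperLie.IsMaurerCartan (SuperLie.cochainGrading 𝒢 ℋ) br d
            (SuperLie.ofLinear 𝒢 D))) := by
  obtain ⟨br, hbr⟩ := SuperLie.exists_bracket (𝒢 := 𝒢) hμ
  obtain ⟨d, hd⟩ := SuperLie.exists_differential hπ hρ
  refine ⟨br, d, fun k l f₁ f₂ => ?_, hd, SuperLie.isDGLieAlgebra_cochain hπ hμ hρ hbr hd,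
    fun h2 D hD => SuperLie.isCrossedHom_iff_isMaurerCartan hπ hμ hρ hbr hd h2 hD⟩
  rw [hbr, SuperLie.derivedForm_lof]
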